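/- Let $B^n\subset\mathbb R^n$ be the closed unit ball and let $f:B^n\to B^n$ be a conformal transformation of the ball: a bijection of $B^n$, smooth up to the boundary, with $f^*\delta=u^2\delta$ for a positive function $u$, where $\delta$ is the Euclidean metric ($u$ is the length magnification factor of $f$). (1) Let $\Sigma$ be a compact immersed free boundary minimal surface in $B^n$, i.e. a smooth immersion of a compact surface with boundary into $B^n$, with zero mean curvature, with $\partial\Sigma\subset\partial B^n$, and meeting $\partial B^n$ orthogonally along $\partial\Sigma$. Then $$|f(\partial\Sigma)|\le|\partial\Sigma|,$$ where $|\cdot|$ is length (one-dimensional Hausdorff measure, counted with multiplicity). (2) The same holds for varifolds. Let $V$ be a two-dimensional integer multiplicity rectifiable varifold in $B^n$ that is stationary for deformations which preserve the ball, i.e. its first variation $$\delta V(X)=\int \operatorname{div}_S X(x)\,dV(x,S)$$ vanishes for every smooth vector field $X$ on $\mathbb R^n$ with $X(x)\cdot x=0$ for all $x\in\partial B^n$. Then $V$ has a boundary, in the sense that there is a unique finite measure $\sigma$ on $\partial B^n$ (the boundary length measure of $V$) such that $\delta V(X)=\int_{\partial B^n}X\cdot x\,d\sigma$ for every smooth vector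 field $X$ on $\mathbb R^n$; and its length does not increase under $f$, that is, $$\int_{\partial B^n}u\,d\sigma\le\sigma(\partial B^n).$$ -/

import Mathlib

open MeasureTheory Set Filter Topology
open scoped Manifold ContDiff

namespace FreeBoundary

/-- The Euclidean space `ℝⁿ`. -/
abbrev Euc (n : ℕ) : Type := EuclideanSpace ℝ (Fin n)

/-- The closed unit ball `Bⁿ`. -/
abbrev unitBall (n : ℕ) : Set (Euc n) := Metric.closedBall (0 : Euc n) 1

/-- The unit sphere `∂Bⁿ`. -/
abbrev unitSphere (n : ℕ) : Set (Euc n) := Metric.sphere (0 : Euc n) 1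

/-! ### Conformal transformations of the ball -/

/-- The differential of a map defined on the closed ball (one-sided at the points of the sphere). -/
noncomputable def ballDeriv {n : ℕ} (f : Euc n → Euc n) (x : Euc n) : Euc n →L[ℝ] Euc n :=
  fderivWithin ℝ f (unitBall n) x

/-- `f` is a conformal transformation of the closed ball: it is smooth up to the boundary, maps the
ball bijectively onto itself, and at every point its differential is a positive multiple of a
linear isometry, so that `f^*δ = u²δ` with `u > 0`. Only the values of `f` on the ball matter. -/
structure IsConformalTransformation {n : ℕ} (f : Euc n → Euc n) : Prop where
  smooth : ContDiffOn ℝ ∞ f (unitBall n)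
  bijective : BijOn f (unitBall n) (unitBall n)
  conformal : ∀ x ∈ unitBall n, IsConformalMap (ballDeriv f x)

/-! ### Immersed free boundary minimal surfaces -/

section Parametrized

variable {n : ℕ}

/-- The second fundamental form of the parametrized surface `φ : S → ℝⁿ`, `S ⊆ ℝ²`, at `z`:
the component of `D²φ(v, w)` normal to the tangent plane `range Dφ`. -/
noncomputable def secondFundamentalForm (φ : Euc 2 → Euc n) (S : Set (Euc 2)) (z v w : Euc 2) :
    Euc n :=
  (LinearMap.range (fderivWithin ℝ φ S z).toLinearMap)ᗮ.starProjection
    (fderivWithin ℝ (fderivWithin ℝ φ S) S z v w)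

/-- The matrix `g i j = ⟨∂ᵢφ, ∂ⱼφ⟩` of the induced metric. -/
noncomputable def inducedMetric (φ : Euc 2 → Euc n) (S : Set (Euc 2)) (z : Euc 2) :
    Matrix (Fin 2) (Fin 2) ℝ :=
  Matrix.of fun i j =>
    inner ℝ (fderivWithin ℝ φ S z (EuclideanSpace.single i 1))
      (fderivWithin ℝ φ S z (EuclideanSpace.single j 1))

/-- The mean curvature vector `∑ gⁱʲ II(∂ᵢ, ∂ⱼ)`. -/
noncomputable def meanCurvature (φ : Euc 2 → Euc n) (S : Set (Euc 2)) (z : Euc 2) : Euc n :=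
  ∑ i, ∑ j, (inducedMetric φ S z)⁻¹ i j •
    secondFundamentalForm φ S z (EuclideanSpace.single i 1) (EuclideanSpace.single j 1)

end Parametrized

section Surface

variable {n : ℕ} {M : Type*} [TopologicalSpace M] [ChartedSpace (EuclideanHalfSpace 2) M]

/-- `u : M → ℝⁿ` is an immersed free boundary minimal surface in the unit ball, `M` being a
surface with boundary: a smooth immersion into the ball which maps `∂M` into the sphere, whose mean
curvature vanishes, and whose tangent plane at each boundary point contains the position vector,
that is, the normal of the sphere. -/
structure IsFreeBoundaryMinimalSurface (u : M → Euc n) : Prop where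
  smooth : ContMDiff (𝓡∂ 2) 𝓘(ℝ, Euc n) ∞ u
  immersion : ∀ p : M, Function.Injective (mfderiv (𝓡∂ 2) 𝓘(ℝ, Euc n) u p)
  mem_ball : ∀ p : M, u p ∈ unitBall n
  boundary : ∀ p ∈ (𝓡∂ 2).boundary M, u p ∈ unitSphere n
  minimal : ∀ c : M, ∀ z ∈ (extChartAt (𝓡∂ 2) c).target,
    meanCurvature (u ∘ (extChartAt (𝓡∂ 2) c).symm) (range (𝓡∂ 2)) z = 0
  orthogonal : ∀ p ∈ (𝓡∂ 2).boundary M,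
    ∃ v : TangentSpace (𝓡∂ 2) p, mfderiv (𝓡∂ 2) 𝓘(ℝ, Euc n) u p v = u p

/-- The length of the image of `∂M` under `g : M → ℝⁿ`, counted with multiplicity: the integral of
the number of preimages in `∂M` with respect to one-dimensional Hausdorff measure. If `g` is
injective on `∂M`, it is the one-dimensional Hausdorff measure of `g(∂M)`. -/
noncomputable def boundaryLength (g : M → Euc n) : ENNReal :=
  ∫⁻ y, (({p | p ∈ (𝓡∂ 2).boundary M ∧ g p = y}.encard : ℕ∞) : ENNReal) ∂(μH[1] : Measure (Euc n))

end Surface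

/-! ### Two-dimensional varifolds

A two-dimensional varifold is a measure on pairs `(x, S)` of a point and a plane; the plane `S` is
represented by the orthogonal projection onto it. -/

/-- Two-dimensional Hausdorff measure in its usual normalization (equal to area on planes):
Mathlib's `μH[2]` is built from `diam²`, without the factor `π / 4`. -/
noncomputable def area (n : ℕ) : Measure (Euc n) :=
  ENNReal.ofReal (Real.pi / 4) • (μH[2] : Measure (Euc n))

/-- Countably two-dimensional rectifiable sets. -/
def IsCountablyRectifiable {n : ℕ} (A : Set (Euc n)) : Prop :=
  ∃ (N : Set (Euc n)) (F : ℕ → Euc 2 → Euc n), area n N = 0 ∧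
    (∀ j, ∃ K, LipschitzWith K (F j)) ∧ A ⊆ N ∪ ⋃ j, range (F j)

/-- `T` is the approximate tangent plane of the measure `μ` at `x`, with multiplicity `θ`: the
rescalings of `μ` at `x` converge weakly to `θ` times the area of `T`. -/
def IsApproxTangentPlane {n : ℕ} (μ : Measure (Euc n)) (θ : ℝ) (x : Euc n)
    (T : Submodule ℝ (Euc n)) : Prop :=
  Module.finrank ℝ T = 2 ∧
  ∀ φ : Euc n → ℝ, Continuous φ → HasCompactSupport φ →
    Tendsto (fun r : ℝ => (r ^ 2)⁻¹ * ∫ y, φ (r⁻¹ • (y - x)) ∂μ) (𝓝[>] 0)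
      (𝓝 (θ * ∫ y in (T : Set (Euc n)), φ y ∂(area n)))

/-- The measure `θ ℋ²` restricted to `A`. -/
noncomputable def weightMeasure {n : ℕ} (A : Set (Euc n)) (θ : Euc n → ℕ) : Measure (Euc n) :=
  ((area n).restrict A).withDensity fun x => (θ x : ENNReal)

/-- `V` is a two-dimensional integer multiplicity rectifiable varifold in `ℝⁿ`: there are a
countably rectifiable set `A` and a positive integer-valued, locally integrable multiplicity `θ`
on `A` such that `V` is the image of `θ ℋ²` on `A` under `x ↦ (x, T x)`, where `T x` is the
approximate tangent plane at almost every `x`. -/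
def IsIntegerRectifiableVarifold {n : ℕ} (V : Measure (Euc n × (Euc n →L[ℝ] Euc n))) : Prop :=
  ∃ (A : Set (Euc n)) (θ : Euc n → ℕ) (T : Euc n → Submodule ℝ (Euc n)),
    MeasurableSet A ∧ IsCountablyRectifiable A ∧ Measurable θ ∧ (∀ x ∈ A, 1 ≤ θ x) ∧
    IsFiniteMeasureOnCompacts (weightMeasure A θ) ∧
    (∀ᵐ x ∂(weightMeasure A θ), IsApproxTangentPlane (weightMeasure A θ) (θ x) x (T x)) ∧
    AEMeasurable (fun x => (x, (T x).starProjection)) (weightMeasure A θ) ∧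
    V = (weightMeasure A θ).map fun x => (x, (T x).starProjection)

/-- `V` is a varifold in the closed ball: its weight is carried by the ball. -/
def IsInBall {n : ℕ} (V : Measure (Euc n × (Euc n →L[ℝ] Euc n))) : Prop :=
  ∀ᵐ p ∂V, p.1 ∈ unitBall n

/-- The first variation `δV(X) = ∫ div_S X(x) dV(x, S)`, where `div_S X = tr (S ∘ DX)` is the sum of
`⟨D_e X, e⟩` over an orthonormal basis of the plane `S`. -/
noncomputable def firstVariation {n : ℕ} (V : Measure (Euc n × (Euc n →L[ℝ] Euc n)))
    (X : Euc n → Euc n) : ℝ :=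
  ∫ p, LinearMap.trace ℝ (Euc n) (p.2 ∘L fderiv ℝ X p.1).toLinearMap ∂V

/-- `V` is stationary for deformations which preserve the ball: the first variation vanishes on
the smooth vector fields whose flow preserves the ball, that is, which are tangent to the sphere
along the sphere. -/
def IsStationaryInBall {n : ℕ} (V : Measure (Euc n × (Euc n →L[ℝ] Euc n))) : Prop :=
  ∀ X : Euc n → Euc n, ContDiff ℝ ∞ X → (∀ x ∈ unitSphere n, inner ℝ (X x) x = 0) →
    firstVariation V X = 0

/-- `σ` is the boundary (length) measure of `V`: a finite measure on the sphere for which the first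
variation formula `δV(X) = ∫_{∂V} X · x ds` holds. -/
def IsBoundaryMeasure {n : ℕ} (V : Measure (Euc n × (Euc n →L[ℝ] Euc n)))
    (σ : Measure (Euc n)) : Prop :=
  IsFiniteMeasure σ ∧ σ (unitSphere n)ᶜ = 0 ∧
  ∀ X : Euc n → Euc n, ContDiff ℝ ∞ X → firstVariation V X = ∫ x, inner ℝ (X x) x ∂σ

/-- The length `∫ u dσ` of the image under `f` of a boundary with length measure `σ`, where
`u = |Df|` is the length magnification factor of `f`. -/
noncomputable def imageLength {n : ℕ} (f : Euc n → Euc n) (σ : Measure (Euc n)) : ENNReal :=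
  ∫⁻ x, ‖ballDeriv f x‖ₑ ∂σ

end FreeBoundary

/-!
Let `u = |Df|` be the length magnification factor of the conformal transformation `f`. The proof
tests the first variation formula with the vector field `X = -∇ log u` (`confField`).

* The metric `u²δ = f^*δ` is flat. The Gauss equation in a plane `S` therefore reads
  `Δ_S log u = -|∇^⊥ log u|² ≤ 0`, where `∇^⊥` is the part of the gradient normal to `S`; in other
  words, `div_S X ≥ 0` for every plane `S` (`confField_div_nonneg`).
* As `f` maps the unit sphere to itself, the conformal change of its mean curvature gives
  `∂u/∂ν = u² - u`, that is, `X · x = 1 - u` on the sphere (`inner_confField`).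

If `σ` is the boundary measure of a stationary varifold, or of a free boundary minimal surface, it
follows that `∫ (1 - u) dσ = ∫ div_S X ≥ 0`, which is the claim (`imageLength_le_of_flux_nonneg`;
since `X` is smooth only on the closed ball, it is replaced there by its dilations). It remains to
establish the first variation formula in the two situations.

For a stationary varifold `V`, the first variation `δV(X)` depends only on the normal component of
`X` along the sphere. The functional `φ ↦ δV(φ x)` is positive: if `φ ≥ 0`, then `δV(φ x)` equals
`δV(φ |x|^{2k} x)` for all `k`, and in the limit `k → ∞` the only term that may be negative
disappears, since at almost every point of the sphere the approximate tangent plane is tangent to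
the sphere (`firstVariation_radial_nonneg`). The measure `σ` comes from the extension theorem of
M. Riesz and the Riesz representation theorem.

For an immersed surface, the formula is the divergence theorem on the half-plane, applied in charts
to the fields `√(det g) ∇zⁱ`, whose divergence vanishes on a minimal surface
(`sum_deriv_coordConormal`), and summed with a partition of unity (`integral_inner_nonneg`). Lengths
counted with multiplicity are turned into integrals over the boundary curves by the area formula
(`lintegral_encard_eq_lintegral_enorm_deriv`).
-/

namespace FreeBoundary

/-! ### Conformal maps of the ball: flatness of `u²δ` -/

section

variable {n : ℕ} {f : Euc n → Euc n}

theorem uniqueDiffOn_unitBall (n : ℕ) : UniqueDiffOn ℝ (unitBall n) :=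
  uniqueDiffOn_convex (convex_closedBall 0 1)
    ⟨0, mem_interior_iff_mem_nhds.2 (Metric.closedBall_mem_nhds 0 one_pos)⟩

theorem mem_closure_interior_unitBall {x : Euc n} (hx : x ∈ unitBall n) :
    x ∈ closure (interior (unitBall n)) := by
  rw [(convex_closedBall (0 : Euc n) 1).closure_interior_eq_closure_of_nonempty_interior
    ⟨0, mem_interior_iff_mem_nhds.2 (Metric.closedBall_mem_nhds 0 one_pos)⟩]
  exact subset_closure hx

/-- The square `u²` of the length magnification factor. -/
noncomputable def magSq (f : Euc n → Euc n) (x : Euc n) : ℝ := ‖ballDeriv f x‖ ^ 2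

theorem exists_norm_eq_one (hn : 1 ≤ n) : ∃ e : Euc n, ‖e‖ = 1 :=
  ⟨EuclideanSpace.single ⟨0, hn⟩ 1, by simp⟩

theorem exists_unit_orthogonal (hn : 2 ≤ n) (x : Euc n) :
    ∃ e : Euc n, ‖e‖ = 1 ∧ inner ℝ x e = 0 := by
  have h : 0 < Module.finrank ℝ (ℝ ∙ x)ᗮ := by
    have h1 := Submodule.finrank_add_finrank_orthogonal (ℝ ∙ x)
    have h2 : Module.finrank ℝ (ℝ ∙ x) ≤ 1 :=
      (finrank_span_le_card ({x} : Set (Euc n))).trans (by simp)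
    rw [finrank_euclideanSpace_fin] at h1
    omega
  obtain ⟨v, hv⟩ := Module.finrank_pos_iff_exists_ne_zero.1 h
  have hv' : (v : Euc n) ≠ 0 := by simpa using hv
  refine ⟨‖(v : Euc n)‖⁻¹ • (v : Euc n), by simp [norm_smul, hv'], ?_⟩
  rw [inner_smul_right, Submodule.mem_orthogonal_singleton_iff_inner_right.1 v.2, mul_zero]

/-- Conformality in terms of inner products. In dimension zero both sides vanish, although the
operator norm of the differential is then `0`. -/
theorem IsConformalTransformation.inner_ballDeriv (hf : IsConformalTransformation f) {x : Euc n}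
    (hx : x ∈ unitBall n) (v w : Euc n) :
    inner ℝ (ballDeriv f x v) (ballDeriv f x w) = magSq f x * inner ℝ v w := by
  obtain ⟨c, hc, li, h⟩ := hf.conformal x hx
  rcases subsingleton_or_nontrivial (Euc n) with hs | hs
  · rw [Subsingleton.elim v 0]; simp
  · have h1 : ‖ballDeriv f x‖ = |c| := by
      rw [h, norm_smul, LinearIsometry.norm_toContinuousLinearMap, Real.norm_eq_abs, mul_one]
    rw [magSq, h1, h]
    simp only [smul_apply, LinearIsometry.coe_toContinuousLinearMap,
      inner_smul_left, inner_smul_right, LinearIsometry.inner_map_map, sq_abs]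
    simp only [conj_trivial]; ring

theorem IsConformalTransformation.magSq_pos (hf : IsConformalTransformation f) (hn : 1 ≤ n)
    {x : Euc n} (hx : x ∈ unitBall n) : 0 < magSq f x := by
  obtain ⟨e, he⟩ := exists_norm_eq_one hn
  obtain ⟨c, hc, h⟩ := (isConformalMap_iff _).1 (hf.conformal x hx)
  have h1 := h e e
  rw [hf.inner_ballDeriv hx, real_inner_self_eq_norm_sq, he] at h1
  linarith

theorem IsConformalTransformation.surjective_ballDeriv (hf : IsConformalTransformation f)
    {x : Euc n} (hx : x ∈ unitBall n) : Function.Surjective (ballDeriv f x) := by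
  have h : Function.Injective (ballDeriv f x).toLinearMap := (hf.conformal x hx).injective
  exact LinearMap.injective_iff_surjective.1 h

theorem IsConformalTransformation.contDiffOn_ballDeriv (hf : IsConformalTransformation f) :
    ContDiffOn ℝ ∞ (ballDeriv f) (unitBall n) :=
  hf.smooth.fderivWithin (uniqueDiffOn_unitBall n) (by simp)

theorem IsConformalTransformation.magSq_eq (hf : IsConformalTransformation f)
    {e : Euc n} (he : ‖e‖ = 1) {x : Euc n} (hx : x ∈ unitBall n) :
    magSq f x = inner ℝ (ballDeriv f x e) (ballDeriv f x e) := by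
  rw [hf.inner_ballDeriv hx, real_inner_self_eq_norm_sq, he]; ring

theorem IsConformalTransformation.contDiffOn_magSq (hf : IsConformalTransformation f)
    (hn : 1 ≤ n) : ContDiffOn ℝ ∞ (magSq f) (unitBall n) := by
  obtain ⟨e, he⟩ := exists_norm_eq_one hn
  have h : ContDiffOn ℝ ∞ (fun x => ballDeriv f x e) (unitBall n) :=
    hf.contDiffOn_ballDeriv.clm_apply contDiffOn_const
  exact (h.inner ℝ h).congr fun x hx => hf.magSq_eq he hx

/-- The second differential of a map of the closed ball. -/
noncomputable def ballDeriv2 (f : Euc n → Euc n) (x : Euc n) : Euc n →L[ℝ] Euc n →L[ℝ] Euc n :=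
  fderivWithin ℝ (ballDeriv f) (unitBall n) x

/-- The differential of `u²`. -/
noncomputable def magSqDeriv (f : Euc n → Euc n) (x : Euc n) : Euc n →L[ℝ] ℝ :=
  fderivWithin ℝ (magSq f) (unitBall n) x

/-- The Hessian of `u²`. -/
noncomputable def magSqHess (f : Euc n → Euc n) (x : Euc n) : Euc n →L[ℝ] Euc n →L[ℝ] ℝ :=
  fderivWithin ℝ (magSqDeriv f) (unitBall n) x

theorem hasFDerivWithinAt_of_contDiffOn {E F : Type*} [NormedAddCommGroup E] [NormedSpace ℝ E]
    [NormedAddCommGroup F] [NormedSpace ℝ F] {g : E → F} {s : Set E} (hg : ContDiffOn ℝ ∞ g s)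
    {x : E} (hx : x ∈ s) : HasFDerivWithinAt g (fderivWithin ℝ g s x) s x :=
  ((hg x hx).differentiableWithinAt (by simp)).hasFDerivWithinAt

theorem hasFDerivWithinAt_apply_const {E F G : Type*} [NormedAddCommGroup E] [NormedSpace ℝ E]
    [NormedAddCommGroup F] [NormedSpace ℝ F] [NormedAddCommGroup G] [NormedSpace ℝ G]
    {c : E → F →L[ℝ] G} {c' : E →L[ℝ] F →L[ℝ] G} {s : Set E} {x : E}
    (hc : HasFDerivWithinAt c c' s x) (v : F) :
    HasFDerivWithinAt (fun y => c y v) (c'.flip v) s x :=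
  (hc.clm_apply (hasFDerivWithinAt_const v x s)).congr_fderiv (by ext; simp)

/-- Uniqueness of one-sided derivatives of functions that agree on the ball. -/
theorem fderivWithin_unique {F : Type*} [NormedAddCommGroup F] [NormedSpace ℝ F]
    {g h : Euc n → F} {g' h' : Euc n →L[ℝ] F} {x : Euc n} (hx : x ∈ unitBall n)
    (hg : HasFDerivWithinAt g g' (unitBall n) x) (hh : HasFDerivWithinAt h h' (unitBall n) x)
    (heq : ∀ y ∈ unitBall n, g y = h y) (v : Euc n) : g' v = h' v := by
  have := (uniqueDiffOn_unitBall n x hx).eq hg (hh.congr heq (heq x hx))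
  rw [this]

theorem minSmoothness_two_le : minSmoothness ℝ 2 ≤ (∞ : WithTop ℕ∞) := by
  rw [minSmoothness_of_isRCLikeNormedField]
  exact WithTop.coe_le_coe.2 (show (2 : ℕ∞) ≤ ⊤ from le_top)

namespace IsConformalTransformation

theorem hasFDerivWithinAt (hf : IsConformalTransformation f) {x : Euc n} (hx : x ∈ unitBall n) :
    HasFDerivWithinAt f (ballDeriv f x) (unitBall n) x :=
  hasFDerivWithinAt_of_contDiffOn hf.smooth hx

theorem contDiffOn_ballDeriv2 (hf : IsConformalTransformation f) :
    ContDiffOn ℝ ∞ (ballDeriv2 f) (unitBall n) :=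
  hf.contDiffOn_ballDeriv.fderivWithin (uniqueDiffOn_unitBall n) (by simp)

theorem contDiffOn_magSqDeriv (hf : IsConformalTransformation f) (hn : 1 ≤ n) :
    ContDiffOn ℝ ∞ (magSqDeriv f) (unitBall n) :=
  (hf.contDiffOn_magSq hn).fderivWithin (uniqueDiffOn_unitBall n) (by simp)

theorem ballDeriv2_symm (hf : IsConformalTransformation f) {x : Euc n} (hx : x ∈ unitBall n)
    (v w : Euc n) : ballDeriv2 f x v w = ballDeriv2 f x w v :=
  (hf.smooth x hx).isSymmSndFDerivWithinAt minSmoothness_two_le (uniqueDiffOn_unitBall n)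
    (mem_closure_interior_unitBall hx) hx v w

theorem hasFDerivWithinAt_ballDeriv_apply (hf : IsConformalTransformation f) {x : Euc n}
    (hx : x ∈ unitBall n) (v : Euc n) :
    HasFDerivWithinAt (fun y => ballDeriv f y v) ((ballDeriv2 f x).flip v) (unitBall n) x :=
  hasFDerivWithinAt_apply_const (hasFDerivWithinAt_of_contDiffOn hf.contDiffOn_ballDeriv hx) v

theorem hasFDerivWithinAt_ballDeriv2_apply (hf : IsConformalTransformation f) {x : Euc n}
    (hx : x ∈ unitBall n) (v w : Euc n) :
    HasFDerivWithinAt (fun y => ballDeriv2 f y v w)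
      (((fderivWithin ℝ (ballDeriv2 f) (unitBall n) x).flip v).flip w) (unitBall n) x :=
  hasFDerivWithinAt_apply_const
    (hasFDerivWithinAt_apply_const (hasFDerivWithinAt_of_contDiffOn hf.contDiffOn_ballDeriv2 hx) v) w

theorem hasFDerivWithinAt_magSqDeriv_apply (hf : IsConformalTransformation f) (hn : 1 ≤ n)
    {x : Euc n} (hx : x ∈ unitBall n) (v : Euc n) :
    HasFDerivWithinAt (fun y => magSqDeriv f y v) ((magSqHess f x).flip v) (unitBall n) x :=
  hasFDerivWithinAt_apply_const (hasFDerivWithinAt_of_contDiffOn (hf.contDiffOn_magSqDeriv hn) hx) v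

/-- The derivative of the identity `⟨Df v, Df w⟩ = u² ⟨v, w⟩`. -/
theorem deriv_inner (hf : IsConformalTransformation f) (hn : 1 ≤ n) {x : Euc n}
    (hx : x ∈ unitBall n) (a v w : Euc n) :
    inner ℝ (ballDeriv f x v) (ballDeriv2 f x a w) + inner ℝ (ballDeriv2 f x a v) (ballDeriv f x w)
      = magSqDeriv f x a * inner ℝ v w := by
  have h1 := (hf.hasFDerivWithinAt_ballDeriv_apply hx v).inner ℝ
    (hf.hasFDerivWithinAt_ballDeriv_apply hx w)
  have h2 := (hasFDerivWithinAt_of_contDiffOn (hf.contDiffOn_magSq hn) hx).mul_const (inner ℝ v w)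
  have := fderivWithin_unique hx h1 h2 (fun y hy => hf.inner_ballDeriv hy v w) a
  simpa [magSqDeriv, mul_comm] using this

/-- The second differential of a conformal map is determined by `d(u²)`: the Koszul formula. -/
theorem koszul (hf : IsConformalTransformation f) (hn : 1 ≤ n) {x : Euc n}
    (hx : x ∈ unitBall n) (v w z : Euc n) :
    2 * inner ℝ (ballDeriv2 f x v w) (ballDeriv f x z) =
      magSqDeriv f x v * inner ℝ w z + magSqDeriv f x w * inner ℝ v z
        - magSqDeriv f x z * inner ℝ v w := by
  have h1 := hf.deriv_inner hn hx v w z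
  have h2 := hf.deriv_inner hn hx w v z
  have h3 := hf.deriv_inner hn hx z v w
  rw [hf.ballDeriv2_symm hx v z] at h1
  rw [hf.ballDeriv2_symm hx w v, hf.ballDeriv2_symm hx w z] at h2
  rw [real_inner_comm (ballDeriv f x w) (ballDeriv2 f x z v)] at h3
  linarith

/-- The Gauss equation, expressing that `u²δ` is flat. -/
theorem gauss (hf : IsConformalTransformation f) (hn : 1 ≤ n) {x : Euc n}
    (hx : x ∈ unitBall n) {e₁ e₂ : Euc n} (h1 : ‖e₁‖ = 1) (h2 : ‖e₂‖ = 1)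
    (h12 : inner ℝ e₁ e₂ = 0) :
    magSqHess f x e₁ e₁ + magSqHess f x e₂ e₂ =
      2 * (inner ℝ (ballDeriv2 f x e₁ e₂) (ballDeriv2 f x e₁ e₂)
        - inner ℝ (ballDeriv2 f x e₁ e₁) (ballDeriv2 f x e₂ e₂)) := by
  have h21 : inner ℝ e₂ e₁ = 0 := by rw [real_inner_comm, h12]
  have n1 : inner ℝ e₁ e₁ = (1 : ℝ) := by rw [real_inner_self_eq_norm_sq, h1]; norm_num
  have n2 : inner ℝ e₂ e₂ = (1 : ℝ) := by rw [real_inner_self_eq_norm_sq, h2]; norm_num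
  -- Two of the relations given by the Koszul formula are differentiated once more; the third
  -- derivatives of `f` then cancel by symmetry.
  set D3 := fderivWithin ℝ (ballDeriv2 f) (unitBall n) x with hD3
  have A := fderivWithin_unique hx ((hf.hasFDerivWithinAt_ballDeriv2_apply hx e₁ e₁).inner ℝ
    (hf.hasFDerivWithinAt_ballDeriv_apply hx e₂))
    ((hf.hasFDerivWithinAt_magSqDeriv_apply hn hx e₂).const_mul (-(1 / 2)))
    (fun y hy => by have := hf.koszul hn hy e₁ e₁ e₂; rw [h12, n1] at this; linarith) e₂
  have B := fderivWithin_unique hx ((hf.hasFDerivWithinAt_ballDeriv2_apply hx e₁ e₂).inner ℝ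
    (hf.hasFDerivWithinAt_ballDeriv_apply hx e₂))
    ((hf.hasFDerivWithinAt_magSqDeriv_apply hn hx e₁).const_mul (1 / 2))
    (fun y hy => by have := hf.koszul hn hy e₁ e₂ e₂; rw [h12, n2] at this; linarith) e₁
  have s1 : D3 e₂ e₁ = D3 e₁ e₂ :=
    (hf.contDiffOn_ballDeriv x hx).isSymmSndFDerivWithinAt minSmoothness_two_le
      (uniqueDiffOn_unitBall n) (mem_closure_interior_unitBall hx) hx e₂ e₁
  have s2 : D3 e₁ e₂ e₁ = D3 e₁ e₁ e₂ :=
    fderivWithin_unique hx (hf.hasFDerivWithinAt_ballDeriv2_apply hx e₂ e₁)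
      (hf.hasFDerivWithinAt_ballDeriv2_apply hx e₁ e₂) (fun y hy => hf.ballDeriv2_symm hy e₂ e₁) e₁
  simp [← hD3] at A B
  rw [s1, s2] at A
  rw [real_inner_self_eq_norm_sq]
  linarith

end IsConformalTransformation

end

/-! ### The field `-∇ log u` -/

section

variable {n : ℕ} {f : Euc n → Euc n}

/-- The gradient of `u²`. -/
noncomputable def magSqGrad (f : Euc n → Euc n) (x : Euc n) : Euc n :=
  (InnerProductSpace.toDual ℝ (Euc n)).symm (magSqDeriv f x)

theorem inner_magSqGrad (f : Euc n → Euc n) (x v : Euc n) :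
    inner ℝ (magSqGrad f x) v = magSqDeriv f x v :=
  InnerProductSpace.toDual_symm_apply

/-- The vector field `-∇ log u = -∇(u²) / (2u²)`. -/
noncomputable def confField (f : Euc n → Euc n) (x : Euc n) : Euc n :=
  (-(2 * magSq f x)⁻¹) • magSqGrad f x

theorem sq_inner_add_sq_inner_le {E : Type*} [NormedAddCommGroup E] [InnerProductSpace ℝ E]
    (a : E) {e₁ e₂ : E} (h1 : ‖e₁‖ = 1) (h2 : ‖e₂‖ = 1) (h12 : inner ℝ e₁ e₂ = 0) :
    (inner ℝ a e₁) ^ 2 + (inner ℝ a e₂) ^ 2 ≤ ‖a‖ ^ 2 := by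
  have h21 : inner ℝ e₂ e₁ = 0 := by rw [real_inner_comm, h12]
  have h := real_inner_self_nonneg (x := a - inner ℝ a e₁ • e₁ - inner ℝ a e₂ • e₂)
  simp only [inner_sub_left, inner_sub_right, inner_smul_left, inner_smul_right,
    real_inner_self_eq_norm_sq, h1, h2, h12, h21, conj_trivial, real_inner_comm a e₁,
    real_inner_comm a e₂] at h
  nlinarith [h]

namespace IsConformalTransformation

/-- The Koszul formula solved for the second differential; this is possible because `Df` is
surjective. -/
theorem ballDeriv2_eq (hf : IsConformalTransformation f) (hn : 1 ≤ n) {x : Euc n}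
    (hx : x ∈ unitBall n) (v w : Euc n) :
    ballDeriv2 f x v w = (2 * magSq f x)⁻¹ • ballDeriv f x
      (magSqDeriv f x v • w + magSqDeriv f x w • v - (inner ℝ v w : ℝ) • magSqGrad f x) := by
  have hU := hf.magSq_pos hn hx
  rw [← sub_eq_zero, ← inner_self_eq_zero (𝕜 := ℝ)]
  obtain ⟨z, hz⟩ := hf.surjective_ballDeriv hx (ballDeriv2 f x v w -
    (2 * magSq f x)⁻¹ • ballDeriv f x
      (magSqDeriv f x v • w + magSqDeriv f x w • v - (inner ℝ v w : ℝ) • magSqGrad f x))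
  nth_rw 2 [← hz]
  rw [inner_sub_left, inner_smul_left, hf.inner_ballDeriv hx, inner_sub_left, inner_add_left,
    inner_smul_left, inner_smul_left, inner_smul_left, inner_magSqGrad]
  have := hf.koszul hn hx v w z
  simp only [conj_trivial]
  field_simp
  linarith

/-- The inequality `Δ_S log u ≤ 0`, in terms of `u²`, for the plane `S` spanned by two orthonormal
vectors. Flatness of `u²δ` gives `Δ_S log u = -|∇^⊥ log u|²`, with the component of the gradient
normal to `S`. -/
theorem magSqHess_le (hf : IsConformalTransformation f) (hn : 1 ≤ n) {x : Euc n}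
    (hx : x ∈ unitBall n) {e₁ e₂ : Euc n} (h1 : ‖e₁‖ = 1) (h2 : ‖e₂‖ = 1)
    (h12 : inner ℝ e₁ e₂ = 0) :
    magSq f x * (magSqHess f x e₁ e₁ + magSqHess f x e₂ e₂) ≤
      magSqDeriv f x e₁ ^ 2 + magSqDeriv f x e₂ ^ 2 := by
  have hU := hf.magSq_pos hn hx
  have h21 : inner ℝ e₂ e₁ = 0 := by rw [real_inner_comm, h12]
  have hb := sq_inner_add_sq_inner_le (magSqGrad f x) h1 h2 h12
  rw [inner_magSqGrad, inner_magSqGrad] at hb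
  rw [hf.gauss hn hx h1 h2 h12]
  simp only [hf.ballDeriv2_eq hn hx, inner_smul_left, inner_smul_right, hf.inner_ballDeriv hx,
    inner_sub_left, inner_sub_right, inner_add_left, inner_add_right, inner_magSqGrad,
    real_inner_comm (magSqGrad f x), real_inner_self_eq_norm_sq, h1, h2, h12, h21, conj_trivial]
  have h1' := inner_magSqGrad f x e₁
  have h2' := inner_magSqGrad f x e₂
  field_simp
  nlinarith [hb]

theorem contDiffOn_confField (hf : IsConformalTransformation f) (hn : 1 ≤ n) :
    ContDiffOn ℝ ∞ (confField f) (unitBall n) := by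
  have h1 : ContDiffOn ℝ ∞ (magSqGrad f) (unitBall n) :=
    (InnerProductSpace.toDual ℝ (Euc n)).symm.toContinuousLinearEquiv.contDiff.comp_contDiffOn
      (hf.contDiffOn_magSqDeriv hn)
  exact (((contDiffOn_const.mul (hf.contDiffOn_magSq hn)).inv
    fun x hx => mul_ne_zero two_ne_zero (hf.magSq_pos hn hx).ne').neg).smul h1

/-- The quadratic form of the differential of `-∇ log u`, which is minus the Hessian of `log u`. -/
theorem inner_fderivWithin_confField (hf : IsConformalTransformation f) (hn : 1 ≤ n) {x : Euc n}
    (hx : x ∈ unitBall n) (v : Euc n) :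
    inner ℝ (fderivWithin ℝ (confField f) (unitBall n) x v) v =
      (2 * magSq f x ^ 2)⁻¹ * (magSqDeriv f x v ^ 2 - magSq f x * magSqHess f x v v) := by
  have hU := hf.magSq_pos hn hx
  have hUd := (hasFDerivWithinAt_of_contDiffOn (hf.contDiffOn_magSq hn) hx)
  have A := (hasFDerivWithinAt_of_contDiffOn (hf.contDiffOn_confField hn) hx).inner ℝ
    (hasFDerivWithinAt_const v x (unitBall n))
  have B := (hf.hasFDerivWithinAt_magSqDeriv_apply hn hx v).neg
  have key : ∀ y ∈ unitBall n,
      2 * magSq f y * inner ℝ (confField f y) v = -(magSqDeriv f y v) := fun y hy => by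
    have := hf.magSq_pos hn hy
    simp only [confField, inner_smul_left, inner_magSqGrad, conj_trivial]
    field_simp
  have := fderivWithin_unique hx ((hUd.const_mul 2).mul A) B key v
  have hx' := key x hx
  simp at this
  rw [show fderivWithin ℝ (magSq f) (unitBall n) x = magSqDeriv f x from rfl] at this
  have e : inner ℝ (confField f x) v = -(magSqDeriv f x v) / (2 * magSq f x) := by
    field_simp; linarith
  rw [e] at this
  field_simp at this ⊢
  linarith

/-- The divergence of `-∇ log u` along every plane is nonnegative. -/
theorem confField_div_nonneg (hf : IsConformalTransformation f) (hn : 1 ≤ n) {x : Euc n}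
    (hx : x ∈ unitBall n) {e₁ e₂ : Euc n} (h1 : ‖e₁‖ = 1) (h2 : ‖e₂‖ = 1)
    (h12 : inner ℝ e₁ e₂ = 0) :
    0 ≤ inner ℝ (fderivWithin ℝ (confField f) (unitBall n) x e₁) e₁ +
      inner ℝ (fderivWithin ℝ (confField f) (unitBall n) x e₂) e₂ := by
  rw [hf.inner_fderivWithin_confField hn hx, hf.inner_fderivWithin_confField hn hx, ← mul_add]
  have := hf.magSqHess_le hn hx h1 h2 h12
  have hU := hf.magSq_pos hn hx
  apply mul_nonneg (by positivity)
  linarith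

end IsConformalTransformation

end

/-! ### Boundary values of `-∇ log u` -/

section

variable {n : ℕ} {f : Euc n → Euc n}

theorem unitSphere_subset_unitBall (n : ℕ) : unitSphere n ⊆ unitBall n :=
  Metric.sphere_subset_closedBall

namespace IsConformalTransformation

/-- The ball is compact and `f` is injective on it, so convergence of the values of `f` forces
convergence of the points. -/
theorem tendsto_of_tendsto_image (hf : IsConformalTransformation f) {x : Euc n}
    (hx : x ∈ unitBall n) {ι : Type*} {l : Filter ι} {g : ι → Euc n}
    (hg : ∀ᶠ i in l, g i ∈ unitBall n) (h : Tendsto (fun i => f (g i)) l (𝓝 (f x))) :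
    Tendsto g l (𝓝 x) := by
  have hle : map g l ≤ 𝓟 (unitBall n) := by
    rw [le_principal_iff]; exact hg
  refine (isCompact_closedBall (0 : Euc n) 1).le_nhds_of_unique_clusterPt
    (le_principal_iff.1 hle) fun y hy hcl => ?_
  refine hf.bijective.injOn hy hx ?_
  have h2 : (𝓝[unitBall n] y ⊓ map g l).NeBot := by
    have h1 : ClusterPt y (map g l ⊓ 𝓟 (unitBall n)) := by rwa [inf_eq_left.2 hle]
    rw [ClusterPt] at h1
    rwa [nhdsWithin, inf_assoc, inf_comm (𝓟 _)]
  have h3 : Tendsto f (𝓝[unitBall n] y ⊓ map g l) (𝓝 (f y)) :=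
    (hf.smooth.continuousOn y hy).mono_left inf_le_left
  have h4 : Tendsto f (𝓝[unitBall n] y ⊓ map g l) (𝓝 (f x)) :=
    (tendsto_map'_iff.2 h).mono_left inf_le_right
  exact tendsto_nhds_unique h3 h4

/-- The sphere is mapped into the sphere. This is not assumed in the definition of a conformal
transformation. -/
theorem norm_apply_eq_one (hf : IsConformalTransformation f) (hn : 1 ≤ n) {x : Euc n}
    (hx : x ∈ unitSphere n) : ‖f x‖ = 1 := by
  have hx1 : ‖x‖ = 1 := by simpa using hx
  have hxB : x ∈ unitBall n := unitSphere_subset_unitBall n hx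
  have hfx : ‖f x‖ ≤ 1 := by simpa using hf.bijective.mapsTo hxB
  by_contra hne
  have hlt : ‖f x‖ < 1 := lt_of_le_of_ne hfx hne
  -- the points `f x + t • Df x` with `t → 0⁺` have preimages, which would have to leave the ball
  set L := ballDeriv f x with hL
  have htend : Tendsto (fun t : ℝ => f x + t • L x) (𝓝[>] 0) (𝓝 (f x)) := by
    have : Tendsto (fun t : ℝ => f x + t • L x) (𝓝 0) (𝓝 (f x + (0 : ℝ) • L x)) :=
      (by fun_prop : Continuous fun t : ℝ => f x + t • L x).tendsto 0
    rw [zero_smul, add_zero] at this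
    exact this.mono_left nhdsWithin_le_nhds
  have hnhds : ∀ᶠ t in 𝓝[>] (0 : ℝ), f x + t • L x ∈ unitBall n :=
    htend (Metric.closedBall_mem_nhds_of_mem (by simpa using hlt))
  have hpre : ∀ t : ℝ, ∃ y, f x + t • L x ∈ unitBall n → y ∈ unitBall n ∧ f y = f x + t • L x := by
    intro t
    by_cases h : f x + t • L x ∈ unitBall n
    · obtain ⟨y, hy, hfy⟩ := hf.bijective.surjOn h
      exact ⟨y, fun _ => ⟨hy, hfy⟩⟩
    · exact ⟨0, fun h' => absurd h' h⟩
  choose g hg using hpre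
  have hgB : ∀ᶠ t in 𝓝[>] (0 : ℝ), g t ∈ unitBall n := hnhds.mono fun t ht => (hg t ht).1
  have hgx : Tendsto g (𝓝[>] 0) (𝓝 x) := by
    refine hf.tendsto_of_tendsto_image hxB hgB (htend.congr' ?_)
    exact hnhds.mono fun t ht => (hg t ht).2.symm
  have hgx' : Tendsto g (𝓝[>] 0) (𝓝[unitBall n] x) := tendsto_nhdsWithin_iff.2 ⟨hgx, hgB⟩
  have hU := hf.magSq_pos hn hxB
  have hu : 0 < ‖L‖ := by
    rw [magSq] at hU
    exact lt_of_le_of_ne (norm_nonneg _) fun h => by rw [← h] at hU; simp at hU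
  have hlit := (hf.hasFDerivWithinAt hxB).isLittleO.def (c := ‖L‖ / 2) (by positivity)
  have hev := hgx'.eventually hlit
  obtain ⟨t, ht, htB, hto⟩ := (hev.and (hnhds.and self_mem_nhdsWithin)).exists
  obtain ⟨hyB, hfy⟩ := hg t htB
  have hto : 0 < t := hto
  set w := g t - x with hw
  have e1 : f (g t) - f x - L w = L (t • x - w) := by
    rw [hfy, map_sub L (t • x), map_smul]; abel
  rw [e1] at ht
  have hLn : ∀ v, ‖L v‖ ^ 2 = ‖L‖ ^ 2 * ‖v‖ ^ 2 := fun v => by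
    have := hf.inner_ballDeriv hxB v v
    rwa [real_inner_self_eq_norm_sq, real_inner_self_eq_norm_sq] at this
  have h2 : ‖L‖ ^ 2 * ‖t • x - w‖ ^ 2 ≤ (‖L‖ / 2 * ‖w‖) ^ 2 := by
    rw [← hLn]; gcongr
  have h3 : ‖t • x - w‖ ^ 2 ≤ ‖w‖ ^ 2 / 4 := by
    have : 0 < ‖L‖ ^ 2 := by positivity
    nlinarith
  have h4 : ‖x + w‖ ≤ 1 := by
    have : ‖g t‖ ≤ 1 := by simpa using hyB
    rwa [hw, add_sub_cancel]
  have h5 : ‖x + w‖ ^ 2 ≤ 1 := by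
    have := norm_nonneg (x + w); nlinarith
  rw [norm_add_sq_real, hx1] at h5
  rw [norm_sub_sq_real, norm_smul, hx1, inner_smul_left, Real.norm_of_nonneg hto.le] at h3
  simp only [conj_trivial] at h3
  nlinarith [sq_nonneg ‖w‖, mul_pos hto hto]

theorem ballDeriv_norm_pos (hf : IsConformalTransformation f) (hn : 1 ≤ n) {x : Euc n}
    (hx : x ∈ unitBall n) : 0 < ‖ballDeriv f x‖ := by
  have hU := hf.magSq_pos hn hx
  rw [magSq] at hU
  exact lt_of_le_of_ne (norm_nonneg _) fun h => by rw [← h] at hU; simp at hU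

/-- On the sphere `Df` maps the normal `x` to `u` times the normal `f x`. -/
theorem ballDeriv_normal (hf : IsConformalTransformation f) (hn : 1 ≤ n) {x : Euc n}
    (hx : x ∈ unitSphere n) : ballDeriv f x x = ‖ballDeriv f x‖ • f x := by
  have hx1 : ‖x‖ = 1 := by simpa using hx
  have hxB : x ∈ unitBall n := unitSphere_subset_unitBall n hx
  have hfx := hf.norm_apply_eq_one hn hx
  set L := ballDeriv f x with hL
  have hu : 0 < ‖L‖ := hf.ballDeriv_norm_pos hn hxB
  have hmax : IsLocalMaxOn (fun y => inner ℝ (f y) (f y)) (unitBall n) x := by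
    refine IsMaxOn.localize fun y hy => ?_
    have : ‖f y‖ ≤ 1 := by simpa using hf.bijective.mapsTo hy
    have h0 := norm_nonneg (f y)
    simp only [mem_ofPred_eq, real_inner_self_eq_norm_sq, hfx]
    nlinarith
  have hder := (hf.hasFDerivWithinAt hxB).inner ℝ (hf.hasFDerivWithinAt hxB)
  obtain ⟨w, hw⟩ := hf.surjective_ballDeriv hxB (f x)
  have hLi : ∀ v, inner ℝ (L w) (L v) = ‖L‖ ^ 2 * inner ℝ w v := fun v =>
    hf.inner_ballDeriv hxB w v
  have hineq : ∀ y ∈ unitBall n, inner ℝ w (y - x) ≤ 0 := by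
    intro y hy
    have h := hmax.hasFDerivWithinAt_nonpos hder
      (sub_mem_posTangentConeAt_of_segment_subset ((convex_closedBall 0 1).segment_subset hxB
        (by simpa using hy)))
    simp only [fderivInnerCLM_apply, ContinuousLinearMap.comp_apply,
      ContinuousLinearMap.prod_apply, ← hL, ← hw,
      real_inner_comm (L w) (L (y - x))] at h
    rw [hLi] at h
    have : 0 < ‖L‖ ^ 2 := by positivity
    nlinarith
  have hwn : ‖L‖ * ‖w‖ = 1 := by
    have h := hLi w
    rw [hw, real_inner_self_eq_norm_sq, real_inner_self_eq_norm_sq, hfx] at h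
    have : (‖L‖ * ‖w‖) ^ 2 = 1 := by rw [mul_pow]; linarith
    exact (pow_eq_one_iff_of_nonneg (by positivity) two_ne_zero).1 this
  have hw0 : 0 < ‖w‖ := by
    rcases (norm_nonneg w).eq_or_lt with h | h
    · rw [← h] at hwn; simp at hwn
    · exact h
  have h1 := hineq (‖w‖⁻¹ • w) (by simp [norm_smul, hw0.ne'])
  rw [inner_sub_right, inner_smul_right, real_inner_self_eq_norm_sq] at h1
  have h1' : ‖w‖ ≤ inner ℝ w x := by
    have : ‖w‖⁻¹ * ‖w‖ ^ 2 = ‖w‖ := by field_simp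
    linarith
  have h2 : w = ‖w‖ • x := by
    rw [← sub_eq_zero, ← norm_eq_zero, ← sq_eq_zero_iff]
    refine le_antisymm ?_ (sq_nonneg _)
    rw [norm_sub_sq_real, inner_smul_right, norm_smul, hx1, norm_norm]
    nlinarith
  rw [← hw, h2, map_smul, smul_smul, hwn, one_smul]

/-- The conformal change of the mean curvature of the sphere: `∂u/∂ν = u² - u`, in terms
of `u²`. -/
theorem magSqDeriv_normal (hf : IsConformalTransformation f) (hn : 2 ≤ n) {x : Euc n}
    (hx : x ∈ unitSphere n) :
    magSqDeriv f x x = 2 * ‖ballDeriv f x‖ * (‖ballDeriv f x‖ ^ 2 - ‖ballDeriv f x‖) := by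
  have hn1 : 1 ≤ n := by omega
  have hx1 : ‖x‖ = 1 := by simpa using hx
  have hxB : x ∈ unitBall n := unitSphere_subset_unitBall n hx
  obtain ⟨τ, hτ, hxτ⟩ := exists_unit_orthogonal hn x
  have hτx : inner ℝ τ x = 0 := by rw [real_inner_comm, hxτ]
  set u := ‖ballDeriv f x‖ with hu
  have hu0 : 0 < u := hf.ballDeriv_norm_pos hn1 hxB
  -- differentiate `⟨f γ, Df γ'⟩ = 0` along the great circle `γ`
  let γ : ℝ → Euc n := fun t => Real.cos t • x + Real.sin t • τ
  let γ' : ℝ → Euc n := fun t => (-Real.sin t) • x + Real.cos t • τ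
  have hγ : ∀ t, HasDerivAt γ (γ' t) t := fun t =>
    ((Real.hasDerivAt_cos t).smul_const x).add ((Real.hasDerivAt_sin t).smul_const τ)
  have hγ' : HasDerivAt γ' (-x) 0 := by
    have := ((Real.hasDerivAt_sin 0).neg.smul_const x).add
      ((Real.hasDerivAt_cos 0).smul_const τ)
    simp only [Real.cos_zero, Real.sin_zero, neg_smul, one_smul, neg_zero, zero_smul,
      add_zero] at this
    exact this
  have hγS : ∀ t, γ t ∈ unitSphere n := fun t => by
    have : ‖γ t‖ ^ 2 = 1 := by
      simp only [γ]
      rw [norm_add_sq_real, inner_smul_left, inner_smul_right, hxτ, norm_smul, norm_smul, hx1, hτ]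
      simp [mul_one]
    simpa using (pow_eq_one_iff_of_nonneg (norm_nonneg (γ t)) two_ne_zero).1 this
  have hγB : ∀ t, γ t ∈ unitBall n := fun t => unitSphere_subset_unitBall n (hγS t)
  have hγ0 : γ 0 = x := by simp [γ]
  have hγ'0 : γ' 0 = τ := by simp [γ']
  have hzero : ∀ t, inner ℝ (f (γ t)) (ballDeriv f (γ t) (γ' t)) = 0 := fun t => by
    have h1 := hf.ballDeriv_normal hn1 (hγS t)
    have h2 := hf.inner_ballDeriv (hγB t) (γ t) (γ' t)
    have h3 : inner ℝ (γ t) (γ' t) = 0 := by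
      simp only [γ, γ', inner_add_left, inner_add_right, inner_smul_left, inner_smul_right, hxτ,
        hτx, real_inner_self_eq_norm_sq, hx1, hτ, conj_trivial]
      ring
    rw [h1, h3, inner_smul_left, mul_zero] at h2
    simpa [(hf.ballDeriv_norm_pos hn1 (hγB t)).ne'] using h2
  have hd1 : HasDerivAt (fun t => f (γ t)) (ballDeriv f x τ) 0 := by
    have : HasFDerivWithinAt f (ballDeriv f x) (unitBall n) (γ 0) := by
      rw [hγ0]; exact hf.hasFDerivWithinAt hxB
    have h := this.comp_hasDerivWithinAt 0 (hγ 0).hasDerivWithinAt (s := univ) (fun t _ => hγB t)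
    rw [hγ'0] at h
    exact hasDerivWithinAt_univ.1 h
  have hd2 : HasDerivAt (fun t => ballDeriv f (γ t)) (ballDeriv2 f x τ) 0 := by
    have : HasFDerivWithinAt (ballDeriv f) (ballDeriv2 f x) (unitBall n) (γ 0) := by
      rw [hγ0]; exact hasFDerivWithinAt_of_contDiffOn hf.contDiffOn_ballDeriv hxB
    have h := this.comp_hasDerivWithinAt 0 (hγ 0).hasDerivWithinAt (s := univ) (fun t _ => hγB t)
    rw [hγ'0] at h
    exact hasDerivWithinAt_univ.1 h
  have hd3 := hd1.inner ℝ (hd2.clm_apply hγ')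
  have hd4 : HasDerivAt (fun t => inner ℝ (f (γ t)) (ballDeriv f (γ t) (γ' t))) 0 0 := by
    simp only [hzero]; exact hasDerivAt_const _ _
  have key := hd3.unique hd4
  rw [hγ0, hγ'0, inner_add_right, hf.inner_ballDeriv hxB, real_inner_self_eq_norm_sq, hτ] at key
  have hk := hf.koszul hn1 hxB τ τ x
  rw [hτx, real_inner_self_eq_norm_sq, hτ, hf.ballDeriv_normal hn1 hx, inner_smul_right,
    real_inner_comm (f x)] at hk
  rw [map_neg, inner_neg_right, hf.ballDeriv_normal hn1 hx, inner_smul_right,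
    real_inner_self_eq_norm_sq, hf.norm_apply_eq_one hn1 hx, magSq, ← hu] at key
  rw [← hu] at hk
  have e : inner ℝ (f x) (ballDeriv2 f x τ τ) = u - u ^ 2 := by linarith
  rw [e] at hk
  linarith

/-- The boundary value of the normal component of `-∇ log u` is `1 - u`. -/
theorem inner_confField (hf : IsConformalTransformation f) (hn : 2 ≤ n) {x : Euc n}
    (hx : x ∈ unitSphere n) : inner ℝ (confField f x) x = 1 - ‖ballDeriv f x‖ := by
  have hu := hf.ballDeriv_norm_pos (by omega) (unitSphere_subset_unitBall n hx)
  rw [confField, inner_smul_left, inner_magSqGrad, hf.magSqDeriv_normal hn hx, magSq]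
  simp only [conj_trivial]
  field_simp
  ring

end IsConformalTransformation

end

/-! ### The length inequality for boundaries of nonnegative flux -/

section

variable {n : ℕ} {f : Euc n → Euc n}

/-- A field that is smooth on the closed ball is, after a dilation `x ↦ r x` with `r < 1`, the
restriction to the ball of a smooth field on `ℝⁿ`. -/
theorem exists_contDiff_eq_dilation {X : Euc n → Euc n} (hX : ContDiffOn ℝ ∞ X (unitBall n))
    {r : ℝ} (h0 : 0 < r) (h1 : r < 1) :
    ∃ Y : Euc n → Euc n, ContDiff ℝ ∞ Y ∧ (∀ x ∈ unitBall n, Y x = X (r • x)) ∧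
      ∀ x ∈ unitBall n, ∀ v, fderiv ℝ Y x v = r • fderivWithin ℝ X (unitBall n) (r • x) v := by
  have hinv : 1 < r⁻¹ := (one_lt_inv₀ h0).2 h1
  let χ : ContDiffBump (0 : Euc n) :=
    { rIn := (1 + (1 + r⁻¹) / 2) / 2, rOut := (1 + r⁻¹) / 2,
      rIn_pos := by positivity, rIn_lt_rOut := by linarith }
  let ψ : Euc n → Euc n := fun x => (r * χ x) • x
  have hψ : ContDiff ℝ ∞ ψ := (contDiff_const.mul χ.contDiff).smul contDiff_id
  have hψB : ∀ x, ψ x ∈ Metric.ball (0 : Euc n) 1 := fun x => by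
    rw [mem_ball_zero_iff, norm_smul, Real.norm_of_nonneg (mul_nonneg h0.le χ.nonneg)]
    by_cases hx : x ∈ Metric.ball (0 : Euc n) χ.rOut
    · have hx' : ‖x‖ < (1 + r⁻¹) / 2 := by simpa using hx
      calc r * χ x * ‖x‖ ≤ r * 1 * ‖x‖ := by gcongr; exact χ.le_one
        _ ≤ r * 1 * ((1 + r⁻¹) / 2) := by gcongr
        _ = (r + 1) / 2 := by field_simp
        _ < 1 := by linarith
    · rw [χ.zero_of_le_dist (by simpa using hx)]; simp
  have hnh : ∀ x, unitBall n ∈ 𝓝 (ψ x) := fun x =>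
    Metric.closedBall_mem_nhds_of_mem (hψB x)
  have hev : ∀ x ∈ unitBall n, ψ =ᶠ[𝓝 x] fun y => r • y := fun x hx => by
    have : Metric.ball (0 : Euc n) χ.rIn ∈ 𝓝 x := by
      refine Metric.isOpen_ball.mem_nhds ?_
      have hx' : ‖x‖ ≤ 1 := by simpa using hx
      rw [mem_ball_zero_iff]
      change ‖x‖ < (1 + (1 + r⁻¹) / 2) / 2
      linarith
    filter_upwards [this] with y hy
    simp only [ψ, χ.one_of_mem_closedBall (Metric.ball_subset_closedBall hy), mul_one]
  refine ⟨X ∘ ψ, contDiff_iff_contDiffAt.2 fun x =>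
    (hX.contDiffAt (hnh x)).comp x hψ.contDiffAt, fun x hx => ?_, fun x hx v => ?_⟩
  · simp only [Function.comp, (hev x hx).self_of_nhds]
  · have hψx := (hev x hx).self_of_nhds
    have d1 : HasFDerivAt X (fderivWithin ℝ X (unitBall n) (ψ x)) (ψ x) :=
      (hasFDerivWithinAt_of_contDiffOn hX (mem_of_mem_nhds (hnh x))).hasFDerivAt (hnh x)
    have d2 : HasFDerivAt ψ (r • ContinuousLinearMap.id ℝ (Euc n)) x :=
      ((hasFDerivAt_id x).const_smul r).congr_of_eventuallyEq (hev x hx)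
    rw [(d1.comp x d2).fderiv, hψx]
    simp

/-- If the flux `∫ X · x dσ` through the sphere is nonnegative for all smooth fields `X` whose
divergence along every plane is nonnegative in the ball, the conformal transformations of the ball
do not increase the total mass of `σ`. The field used is `-∇ log u`. -/
theorem imageLength_le_of_flux_nonneg (hf : IsConformalTransformation f) (hn : 2 ≤ n)
    (σ : Measure (Euc n)) [IsFiniteMeasure σ] (hσ : σ (unitSphere n)ᶜ = 0)
    (hpos : ∀ X : Euc n → Euc n, ContDiff ℝ ∞ X →
      (∀ x ∈ unitBall n, ∀ e₁ e₂ : Euc n, ‖e₁‖ = 1 → ‖e₂‖ = 1 → inner ℝ e₁ e₂ = 0 →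
        0 ≤ inner ℝ (fderiv ℝ X x e₁) e₁ + inner ℝ (fderiv ℝ X x e₂) e₂) →
      0 ≤ ∫ x, inner ℝ (X x) x ∂σ) :
    imageLength f σ ≤ σ univ := by
  have hn1 : 1 ≤ n := by omega
  have hae : ∀ᵐ x ∂σ, x ∈ unitSphere n := hσ
  have hrestr : σ.restrict (unitSphere n) = σ := Measure.restrict_eq_self_of_ae_mem hae
  have hmeas : MeasurableSet (unitSphere n) := Metric.isClosed_sphere.measurableSet
  have hXc := hf.contDiffOn_confField hn1
  -- The field `-∇ log u` is smooth only on the closed ball. Its dilations extend smoothly to `ℝⁿ`.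
  have hr : ∀ k : ℕ, 0 ≤ ∫ x, inner ℝ (confField f ((1 - 1 / ((k : ℝ) + 2)) • x)) x ∂σ := by
    intro k
    have h0 : 0 < 1 - 1 / ((k : ℝ) + 2) := by
      rw [sub_pos, div_lt_one (by positivity)]; linarith [(Nat.cast_nonneg k : (0 : ℝ) ≤ k)]
    have h1 : 1 - 1 / ((k : ℝ) + 2) < 1 := sub_lt_self _ (by positivity)
    obtain ⟨Y, hY, hYe, hYd⟩ := exists_contDiff_eq_dilation hXc h0 h1
    have := hpos Y hY fun x hx e₁ e₂ he₁ he₂ he => by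
      have hrx : (1 - 1 / ((k : ℝ) + 2)) • x ∈ unitBall n := by
        have hx' : ‖x‖ ≤ 1 := by simpa using hx
        rw [mem_closedBall_zero_iff, norm_smul, Real.norm_of_nonneg h0.le]
        nlinarith [norm_nonneg x]
      rw [hYd x hx, hYd x hx, inner_smul_left, inner_smul_left, ← mul_add]
      exact mul_nonneg (by simpa using h0.le) (hf.confField_div_nonneg hn1 hrx he₁ he₂ he)
    refine this.trans_eq (integral_congr_ae ?_)
    filter_upwards [hae] with x hx
    rw [hYe x (unitSphere_subset_unitBall n hx)]
  -- As the dilation factor tends to one, the fluxes tend to `∫ (1 - u) dσ`.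
  obtain ⟨C, hC⟩ := (isCompact_closedBall (0 : Euc n) 1).exists_bound_of_continuousOn
    hXc.continuousOn
  have hmem : ∀ k : ℕ, ∀ x ∈ unitBall n, (1 - 1 / ((k : ℝ) + 2)) • x ∈ unitBall n := by
    intro k x hx
    have h0 : 0 ≤ 1 - 1 / ((k : ℝ) + 2) := by
      rw [sub_nonneg, div_le_one (by positivity)]; linarith [(Nat.cast_nonneg k : (0 : ℝ) ≤ k)]
    have h1 : 1 - 1 / ((k : ℝ) + 2) < 1 := sub_lt_self _ (by positivity)
    have hx' : ‖x‖ ≤ 1 := by simpa using hx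
    rw [mem_closedBall_zero_iff, norm_smul, Real.norm_of_nonneg h0]
    nlinarith [norm_nonneg x]
  have hrlim : Tendsto (fun k : ℕ => 1 - 1 / ((k : ℝ) + 2)) atTop (𝓝 1) := by
    have := (tendsto_const_div_atTop_nhds_zero_nat (1 : ℝ)).comp (tendsto_add_atTop_nat 2)
    simpa using (tendsto_const_nhds (x := (1 : ℝ))).sub this
  have hlim : Tendsto (fun k : ℕ => ∫ x, inner ℝ (confField f ((1 - 1 / ((k : ℝ) + 2)) • x)) x ∂σ)
      atTop (𝓝 (∫ x, (1 - ‖ballDeriv f x‖) ∂σ)) := by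
    refine tendsto_integral_of_dominated_convergence (fun _ => C) (fun k => ?_)
      (integrable_const C) (fun k => ?_) ?_
    · rw [← hrestr]
      refine ContinuousOn.aestronglyMeasurable ?_ hmeas
      refine ContinuousOn.inner (𝕜 := ℝ)
        (hXc.continuousOn.comp (continuous_const_smul _).continuousOn ?_) continuousOn_id
      exact fun x hx => hmem k x (unitSphere_subset_unitBall n hx)
    · filter_upwards [hae] with x hx
      have hx1 : ‖x‖ = 1 := by simpa using hx
      refine (norm_inner_le_norm _ _).trans ?_
      rw [hx1, mul_one]
      exact hC _ (hmem k x (unitSphere_subset_unitBall n hx))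
    · filter_upwards [hae] with x hx
      have hxB := unitSphere_subset_unitBall n hx
      rw [← hf.inner_confField hn hx]
      refine Tendsto.inner ?_ tendsto_const_nhds
      refine (hXc.continuousOn x hxB).tendsto.comp
        (tendsto_nhdsWithin_iff.2 ⟨?_, .of_forall fun k => hmem k x hxB⟩)
      simpa using hrlim.smul_const x
  have hge : 0 ≤ ∫ x, (1 - ‖ballDeriv f x‖) ∂σ := ge_of_tendsto' hlim hr
  have hint : Integrable (fun x => ballDeriv f x) σ := by
    obtain ⟨K, hK⟩ := (isCompact_closedBall (0 : Euc n) 1).exists_bound_of_continuousOn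
      hf.contDiffOn_ballDeriv.continuousOn
    refine Integrable.of_bound ?_ K (hae.mono fun x hx => hK x (unitSphere_subset_unitBall n hx))
    rw [← hrestr]
    exact (hf.contDiffOn_ballDeriv.continuousOn.mono
      (unitSphere_subset_unitBall n)).aestronglyMeasurable hmeas
  rw [integral_sub (integrable_const _) hint.norm, integral_const, smul_eq_mul, mul_one,
    sub_nonneg] at hge
  rw [imageLength, ← ofReal_integral_norm_eq_lintegral_enorm hint]
  refine (ENNReal.ofReal_le_ofReal hge).trans_eq ?_
  rw [Measure.real, ENNReal.ofReal_toReal (measure_ne_top σ _)]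

end

/-! ### Varifolds in the ball and their first variation -/

section

variable {n : ℕ}

/-- The divergence along a plane in terms of an orthonormal basis of the plane. -/
theorem exists_orthonormal_trace_eq (T : Submodule ℝ (Euc n)) (hT : Module.finrank ℝ T = 2) :
    ∃ e₁ e₂ : Euc n, ‖e₁‖ = 1 ∧ ‖e₂‖ = 1 ∧ inner ℝ e₁ e₂ = 0 ∧ e₁ ∈ T ∧ e₂ ∈ T ∧
      ∀ L : Euc n →L[ℝ] Euc n, LinearMap.trace ℝ (Euc n) (T.starProjection ∘L L).toLinearMap =
        inner ℝ (L e₁) e₁ + inner ℝ (L e₂) e₂ := by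
  let b := (stdOrthonormalBasis ℝ T).reindex (finCongr hT)
  have hb := b.orthonormal
  refine ⟨b 0, b 1, hb.1 0, hb.1 1, hb.2 (by decide), (b 0).2, (b 1).2, fun L => ?_⟩
  have h1 : (T.starProjection ∘L L).toLinearMap =
      T.subtype ∘ₗ (T.orthogonalProjectionOnto.toLinearMap ∘ₗ L.toLinearMap) := rfl
  rw [h1, LinearMap.trace_comp_comm', LinearMap.trace_eq_sum_inner _ b, Fin.sum_univ_two]
  have h2 : ∀ i, inner ℝ (b i) (((T.orthogonalProjectionOnto.toLinearMap ∘ₗ L.toLinearMap) ∘ₗ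
      T.subtype) (b i)) = inner ℝ (L (b i)) (b i) := fun i => by
    simp only [LinearMap.comp_apply, Submodule.subtype_apply, ContinuousLinearMap.coe_coe]
    rw [real_inner_comm, Submodule.inner_orthogonalProjectionOnto_eq_of_mem_right]
  rw [h2, h2]

/-- The trace as a continuous linear functional. -/
noncomputable def traceCLM (n : ℕ) : (Euc n →L[ℝ] Euc n) →L[ℝ] ℝ :=
  LinearMap.toContinuousLinearMap
    ((LinearMap.trace ℝ (Euc n)) ∘ₗ ContinuousLinearMap.coeLM ℝ)

theorem traceCLM_apply (L : Euc n →L[ℝ] Euc n) :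
    traceCLM n L = LinearMap.trace ℝ (Euc n) L.toLinearMap := rfl

/-- The weight measure `μ` and the field of planes `T` of a two-dimensional varifold in the ball,
with the only consequence of rectifiability that matters: at almost every point of the sphere the
plane is tangent to the sphere. -/
structure IsBallVarifold (V : Measure (Euc n × (Euc n →L[ℝ] Euc n))) (μ : Measure (Euc n))
    (T : Euc n → Submodule ℝ (Euc n)) : Prop where
  finite : IsFiniteMeasure μ
  mem_ball : ∀ᵐ x ∂μ, x ∈ unitBall n
  finrank : ∀ᵐ x ∂μ, Module.finrank ℝ (T x) = 2
  tangent : ∀ᵐ x ∂μ, x ∈ unitSphere n → ∀ v ∈ T x, inner ℝ v x = 0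
  measurable : AEMeasurable (fun x => (x, (T x).starProjection)) μ
  eq_map : V = μ.map fun x => (x, (T x).starProjection)

/-- A continuous nonnegative function with compact support has positive integral over a plane
on which it does not vanish. -/
theorem setIntegral_area_pos {T : Submodule ℝ (Euc n)} (hT : Module.finrank ℝ T = 2)
    {φ : Euc n → ℝ} (hc : Continuous φ) (hs : HasCompactSupport φ) (h0 : ∀ y, 0 ≤ φ y)
    {v : Euc n} (hv : v ∈ T) (hφv : φ v ≠ 0) : 0 < ∫ y in (T : Set (Euc n)), φ y ∂(area n) := by
  have hiso : Isometry (Subtype.val : T → Euc n) := isometry_subtype_coe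
  have hemb : IsClosedEmbedding (Subtype.val : T → Euc n) := hiso.isClosedEmbedding
  have h1 := hiso.map_hausdorffMeasure (d := 2) (Or.inl (by norm_num))
  have h2 : (μH[2] : Measure T) = μH[(Module.finrank ℝ T : ℝ)] := by rw [hT]; norm_num
  rw [area, Measure.restrict_smul, integral_smul_measure,
    show (T : Set (Euc n)) = range (Subtype.val : T → Euc n) by simp, ← h1,
    hemb.measurableEmbedding.integral_map]
  have h3 : 0 < ∫ y : T, φ y ∂μH[2] := by
    rw [h2]
    exact (hc.comp continuous_subtype_val).integral_pos_of_hasCompactSupport_nonneg_nonzero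
      (hs.comp_isClosedEmbedding hemb) (fun y => h0 y) (x := ⟨v, hv⟩) hφv
  rw [ENNReal.toReal_ofReal (by positivity), smul_eq_mul]
  have := Real.pi_pos
  positivity

/-- The approximate tangent plane of a measure carried by the ball is tangent to the sphere at the
points of the sphere, since the blow-ups of the measure live in a half-space. -/
theorem IsApproxTangentPlane.inner_eq_zero {μ : Measure (Euc n)} {θ : ℝ} (hθ : 0 < θ) {x : Euc n}
    {T : Submodule ℝ (Euc n)} (h : IsApproxTangentPlane μ θ x T)
    (hμ : ∀ᵐ y ∂μ, y ∈ unitBall n) (hx : x ∈ unitSphere n) {v : Euc n} (hv : v ∈ T) :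
    inner ℝ v x = 0 := by
  have hx1 : ‖x‖ = 1 := by simpa using hx
  -- it suffices to exclude vectors pointing out of the ball
  suffices H : ∀ v ∈ T, inner ℝ v x ≤ 0 by
    have h1 := H v hv
    have h2 := H (-v) (T.neg_mem hv)
    rw [inner_neg_left] at h2
    linarith
  intro v hv
  by_contra! hpos
  set δ : ℝ := inner ℝ v x with hδ
  let φ : Euc n → ℝ := fun y => max 0 (δ - dist y v)
  have hφc : Continuous φ := by fun_prop
  have hφ0 : ∀ y, inner ℝ y x ≤ 0 → φ y = 0 := fun y hy => by
    refine max_eq_left ?_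
    have h1 : inner ℝ (v - y) x ≤ ‖v - y‖ * ‖x‖ := real_inner_le_norm _ _
    rw [inner_sub_left, hx1, mul_one, ← dist_eq_norm, dist_comm] at h1
    linarith
  have hφs : HasCompactSupport φ := by
    refine HasCompactSupport.of_support_subset_isCompact (isCompact_closedBall v δ) fun y hy => ?_
    by_contra hn
    refine hy (max_eq_left ?_)
    rw [Metric.mem_closedBall, not_le] at hn
    linarith
  have hlim := h.2 φ hφc hφs
  have hzero : ∀ᶠ r in 𝓝[>] (0 : ℝ), (r ^ 2)⁻¹ * ∫ y, φ (r⁻¹ • (y - x)) ∂μ = 0 := by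
    filter_upwards [self_mem_nhdsWithin] with r hr
    have hr : 0 < r := hr
    have : ∫ y, φ (r⁻¹ • (y - x)) ∂μ = 0 := by
      rw [← integral_zero (Euc n) ℝ (μ := μ)]
      refine integral_congr_ae (hμ.mono fun y hy => hφ0 _ ?_)
      have hy1 : ‖y‖ ≤ 1 := by simpa using hy
      have h1 : inner ℝ y x ≤ ‖y‖ * ‖x‖ := real_inner_le_norm _ _
      rw [inner_smul_left, inner_sub_left, real_inner_self_eq_norm_sq, hx1]
      rw [hx1] at h1
      refine mul_nonpos_of_nonneg_of_nonpos (by simpa using hr.le) ?_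
      linarith
    rw [this, mul_zero]
  have hI : 0 < ∫ y in (T : Set (Euc n)), φ y ∂(area n) :=
    setIntegral_area_pos h.1 hφc hφs (fun y => le_max_left _ _) hv (by simp [φ, hpos.ne', hpos.le])
  have := tendsto_nhds_unique hlim ((tendsto_congr' hzero).2 tendsto_const_nhds)
  have := mul_pos hθ hI
  linarith

theorem IsIntegerRectifiableVarifold.exists_isBallVarifold
    {V : Measure (Euc n × (Euc n →L[ℝ] Euc n))} (hV : IsIntegerRectifiableVarifold V)
    (hB : IsInBall V) : ∃ μ T, IsBallVarifold V μ T := by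
  obtain ⟨A, θ, T, hA, -, -, hθ1, hfin, hT, hmeas, hVeq⟩ := hV
  generalize hμ : weightMeasure A θ = μ at *
  have hμA : μ ≪ (area n).restrict A := hμ ▸ withDensity_absolutelyContinuous _ _
  have hball : ∀ᵐ x ∂μ, x ∈ unitBall n := ae_of_ae_map hmeas (hVeq ▸ hB)
  have hmemA : ∀ᵐ x ∂μ, x ∈ A :=
    hμA.ae_le (ae_restrict_mem hA)
  have hfinite : IsFiniteMeasure μ := by
    refine ⟨?_⟩
    rw [← Measure.restrict_eq_self_of_ae_mem hball, Measure.restrict_apply_univ]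
    exact (isCompact_closedBall (0 : Euc n) 1).measure_lt_top
  have htan : ∀ᵐ x ∂μ, x ∈ unitSphere n → ∀ v ∈ T x, inner ℝ v x = 0 := by
    filter_upwards [hT, hmemA] with x hx hxA hxS v hv
    have hθ : (0 : ℝ) < θ x := Nat.cast_pos.2 (hθ1 x hxA)
    exact hx.inner_eq_zero hθ hball hxS hv
  exact ⟨μ, T, hfinite, hball, hT.mono fun x hx => hx.1, htan, hmeas, hVeq⟩

namespace IsBallVarifold

variable {V : Measure (Euc n × (Euc n →L[ℝ] Euc n))} {μ : Measure (Euc n)}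
  {T : Euc n → Submodule ℝ (Euc n)}

theorem continuous_integrand {L : Euc n → Euc n →L[ℝ] Euc n} (hL : Continuous L) :
    Continuous fun p : Euc n × (Euc n →L[ℝ] Euc n) => traceCLM n (p.2 ∘L L p.1) :=
  (traceCLM n).continuous.comp (continuous_snd.clm_comp (hL.comp continuous_fst))

theorem firstVariation_eq (h : IsBallVarifold V μ T) {X : Euc n → Euc n} (hX : ContDiff ℝ ∞ X) :
    firstVariation V X = ∫ x, traceCLM n ((T x).starProjection ∘L fderiv ℝ X x) ∂μ := by
  have := h.eq_map
  subst this
  exact integral_map h.measurable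
    (continuous_integrand (hX.continuous_fderiv (by simp))).aestronglyMeasurable

theorem integrable_trace (h : IsBallVarifold V μ T) {L : Euc n → Euc n →L[ℝ] Euc n}
    (hL : Continuous L) : Integrable (fun x => traceCLM n ((T x).starProjection ∘L L x)) μ := by
  have := h.finite
  obtain ⟨C, hC⟩ := (isCompact_closedBall (0 : Euc n) 1).exists_bound_of_continuousOn
    hL.continuousOn
  have hb : ∀ x ∈ unitBall n,
      ‖traceCLM n ((T x).starProjection ∘L L x)‖ ≤ ‖traceCLM n‖ * C := fun x hx => by
    have h1 : ‖(T x).starProjection‖ ≤ 1 := Submodule.starProjection_norm_le _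
    have h2 := hC x hx
    have h3 := ContinuousLinearMap.opNorm_comp_le (T x).starProjection (L x)
    have h4 : ‖(T x).starProjection‖ * ‖L x‖ ≤ 1 * C :=
      mul_le_mul h1 h2 (norm_nonneg _) zero_le_one
    refine ((traceCLM n).le_opNorm _).trans (mul_le_mul_of_nonneg_left ?_ (norm_nonneg _))
    linarith
  have hm : AEStronglyMeasurable (fun x => traceCLM n ((T x).starProjection ∘L L x)) μ :=
    (continuous_integrand hL).measurable.comp_aemeasurable h.measurable |>.aestronglyMeasurable
  exact Integrable.of_bound hm _ (h.mem_ball.mono hb)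

theorem integrable (h : IsBallVarifold V μ T) {X : Euc n → Euc n} (hX : ContDiff ℝ ∞ X) :
    Integrable (fun x => traceCLM n ((T x).starProjection ∘L fderiv ℝ X x)) μ :=
  h.integrable_trace (hX.continuous_fderiv (by simp))

theorem firstVariation_add (h : IsBallVarifold V μ T) {X Y : Euc n → Euc n}
    (hX : ContDiff ℝ ∞ X) (hY : ContDiff ℝ ∞ Y) :
    firstVariation V (fun x => X x + Y x) = firstVariation V X + firstVariation V Y := by
  rw [h.firstVariation_eq (hX.add hY), h.firstVariation_eq hX, h.firstVariation_eq hY,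
    ← integral_add (h.integrable hX) (h.integrable hY)]
  congr 1; ext x
  rw [fderiv_fun_add ((hX.differentiable (by simp)) x) ((hY.differentiable (by simp)) x),
    ContinuousLinearMap.comp_add, map_add]

theorem firstVariation_smul (h : IsBallVarifold V μ T) {X : Euc n → Euc n}
    (hX : ContDiff ℝ ∞ X) (c : ℝ) :
    firstVariation V (fun x => c • X x) = c * firstVariation V X := by
  rw [h.firstVariation_eq (ContDiff.const_smul _ hX), h.firstVariation_eq hX,
    ← integral_const_mul]
  congr 1; ext x
  rw [fderiv_fun_const_smul ((hX.differentiable (by simp)) x),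
    ContinuousLinearMap.comp_smul, map_smul, smul_eq_mul]

theorem firstVariation_nonneg (h : IsBallVarifold V μ T) {X : Euc n → Euc n}
    (hX : ContDiff ℝ ∞ X)
    (hdiv : ∀ x ∈ unitBall n, ∀ e₁ e₂ : Euc n, ‖e₁‖ = 1 → ‖e₂‖ = 1 → inner ℝ e₁ e₂ = 0 →
      0 ≤ inner ℝ (fderiv ℝ X x e₁) e₁ + inner ℝ (fderiv ℝ X x e₂) e₂) :
    0 ≤ firstVariation V X := by
  rw [h.firstVariation_eq hX]
  refine integral_nonneg_of_ae ?_
  filter_upwards [h.mem_ball, h.finrank] with x hx hT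
  obtain ⟨e₁, e₂, h1, h2, h12, -, -, htr⟩ := exists_orthonormal_trace_eq (T x) hT
  rw [traceCLM_apply, htr]
  exact hdiv x hx e₁ e₂ h1 h2 h12

/-- The first variation of a stationary varifold depends only on the normal component of the
field along the sphere. -/
theorem firstVariation_congr (h : IsBallVarifold V μ T) (hst : IsStationaryInBall V)
    {X Y : Euc n → Euc n} (hX : ContDiff ℝ ∞ X) (hY : ContDiff ℝ ∞ Y)
    (hXY : ∀ x ∈ unitSphere n, inner ℝ (X x) x = inner ℝ (Y x) x) :
    firstVariation V X = firstVariation V Y := by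
  have h1 := hst (fun x => X x + (-1 : ℝ) • Y x) (hX.add (ContDiff.const_smul _ hY)) fun x hx => by
    rw [inner_add_left, inner_smul_left, hXY x hx]; simp
  rw [h.firstVariation_add hX (ContDiff.const_smul _ hY), h.firstVariation_smul hY] at h1
  linarith

end IsBallVarifold

end

/-! ### Positivity of the first variation on radial fields -/

section

variable {n : ℕ}

theorem contDiff_smul_self {φ : Euc n → ℝ} (hφ : ContDiff ℝ ∞ φ) :
    ContDiff ℝ ∞ fun x : Euc n => φ x • x := hφ.smul contDiff_id

theorem contDiff_radial {φ : Euc n → ℝ} (hφ : ContDiff ℝ ∞ φ) (k : ℕ) :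
    ContDiff ℝ ∞ fun x : Euc n => (φ x * (‖x‖ ^ 2) ^ k) • x :=
  (hφ.mul ((contDiff_norm_sq ℝ).pow k)).smul contDiff_id

namespace IsBallVarifold

variable {V : Measure (Euc n × (Euc n →L[ℝ] Euc n))} {μ : Measure (Euc n)}
  {T : Euc n → Submodule ℝ (Euc n)}

/-- The first variation of a radial field `φ x` is nonnegative if `φ ≥ 0` on the ball: compare it
with the fields `φ |x|^{2k} x`, which have the same values on the sphere, as `k → ∞`. -/
theorem firstVariation_radial_nonneg_of_ball (h : IsBallVarifold V μ T)
    (hst : IsStationaryInBall V) {φ : Euc n → ℝ} (hφ : ContDiff ℝ ∞ φ)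
    (h0 : ∀ x ∈ unitBall n, 0 ≤ φ x) : 0 ≤ firstVariation V fun x => φ x • x := by
  have := h.finite
  let L : Euc n → Euc n →L[ℝ] Euc n := fun x => (fderiv ℝ φ x).smulRight x
  have hL : Continuous L :=
    ((ContinuousLinearMap.smulRightL ℝ (Euc n) (Euc n)).continuous.comp
      (hφ.continuous_fderiv (by simp))).clm_apply continuous_id
  have hG := h.integrable_trace hL
  set G : Euc n → ℝ := fun x => traceCLM n ((T x).starProjection ∘L L x) with hGdef
  have hGk : ∀ k : ℕ, Integrable (fun x => (‖x‖ ^ 2) ^ k * G x) μ := fun k => by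
    refine hG.bdd_mul (c := 1) (by fun_prop) (h.mem_ball.mono fun x hx => ?_)
    have hx : ‖x‖ ≤ 1 := by simpa using hx
    rw [Real.norm_of_nonneg (by positivity)]
    exact pow_le_one₀ (by positivity) (pow_le_one₀ (norm_nonneg x) hx)
  have hk : ∀ k : ℕ, ∫ x, (‖x‖ ^ 2) ^ k * G x ∂μ ≤ firstVariation V fun x => φ x • x := by
    intro k
    have hXk := contDiff_radial hφ k
    rw [h.firstVariation_congr hst (contDiff_smul_self hφ) hXk fun x hx => by
      have hx1 : ‖x‖ = 1 := by simpa using hx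
      simp [hx1], h.firstVariation_eq hXk]
    refine integral_mono_ae (hGk k) (h.integrable hXk) ?_
    filter_upwards [h.mem_ball, h.finrank] with x hx hT
    obtain ⟨e₁, e₂, h1, h2, -, -, -, htr⟩ := exists_orthonormal_trace_eq (T x) hT
    have hd : ∀ v, ‖v‖ = 1 → inner ℝ (fderiv ℝ (fun x : Euc n => (φ x * (‖x‖ ^ 2) ^ k) • x) x v) v
        = (‖x‖ ^ 2) ^ k * (fderiv ℝ φ x v * inner ℝ x v) +
          φ x * (k * (‖x‖ ^ 2) ^ (k - 1) * 2 * inner ℝ x v ^ 2 + (‖x‖ ^ 2) ^ k) := by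
      intro v hv
      have d1 : HasFDerivAt φ (fderiv ℝ φ x) x := ((hφ.differentiable (by simp)) x).hasFDerivAt
      have d2 : HasFDerivAt (fun y : Euc n => ‖y‖ ^ 2) (2 • innerSL ℝ x) x :=
        (hasStrictFDerivAt_norm_sq x).hasFDerivAt
      have d3 := (d1.mul (d2.pow k)).smul (hasFDerivAt_id x)
      rw [show (fun x : Euc n => (φ x * (‖x‖ ^ 2) ^ k) • x) =
        (φ * fun y : Euc n => (‖y‖ ^ 2) ^ k) • id from rfl, d3.fderiv]
      simp [inner_add_left, inner_smul_left, hv]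
      ring
    simp only [hGdef, traceCLM_apply, htr, hd e₁ h1, hd e₂ h2]
    have hn := h0 x hx
    have e : ∀ v, inner ℝ (L x v) v = fderiv ℝ φ x v * inner ℝ x v := fun v => by
      simp [L, inner_smul_left]
    rw [e, e]
    have p1 : 0 ≤ φ x * (k * (‖x‖ ^ 2) ^ (k - 1) * 2 * inner ℝ x e₁ ^ 2 + (‖x‖ ^ 2) ^ k) := by
      positivity
    have p2 : 0 ≤ φ x * (k * (‖x‖ ^ 2) ^ (k - 1) * 2 * inner ℝ x e₂ ^ 2 + (‖x‖ ^ 2) ^ k) := by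
      positivity
    linarith
  have hlim : Tendsto (fun k : ℕ => ∫ x, (‖x‖ ^ 2) ^ k * G x ∂μ) atTop (𝓝 (∫ _, (0 : ℝ) ∂μ)) := by
    refine tendsto_integral_of_dominated_convergence (fun x => ‖G x‖)
      (fun k => (hGk k).aestronglyMeasurable) hG.norm (fun k => ?_) ?_
    · filter_upwards [h.mem_ball] with x hx
      have hx : ‖x‖ ≤ 1 := by simpa using hx
      rw [norm_mul, Real.norm_of_nonneg (by positivity)]
      exact mul_le_of_le_one_left (norm_nonneg _)
        (pow_le_one₀ (by positivity) (pow_le_one₀ (norm_nonneg x) hx))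
    · filter_upwards [h.mem_ball, h.finrank, h.tangent] with x hx hT htan
      have hx : ‖x‖ ≤ 1 := by simpa using hx
      rcases hx.lt_or_eq with hx1 | hx1
      · have := (tendsto_pow_atTop_nhds_zero_of_lt_one (by positivity : (0 : ℝ) ≤ ‖x‖ ^ 2)
          (pow_lt_one₀ (norm_nonneg x) hx1 two_ne_zero)).mul_const (G x)
        simpa using this
      · obtain ⟨e₁, e₂, -, -, -, m1, m2, htr⟩ := exists_orthonormal_trace_eq (T x) hT
        have hxS : x ∈ unitSphere n := by simpa using hx1
        have : G x = 0 := by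
          have t1 : inner ℝ x e₁ = 0 := by rw [real_inner_comm, htan hxS e₁ m1]
          have t2 : inner ℝ x e₂ = 0 := by rw [real_inner_comm, htan hxS e₂ m2]
          simp only [hGdef, traceCLM_apply, htr]
          simp [L, inner_smul_left, t1, t2]
        simp [this]
  rw [integral_zero] at hlim
  exact le_of_tendsto' hlim hk

/-- The first variation of a radial field `φ x` is nonnegative if `φ ≥ 0` on the sphere: the outer
conormal of a stationary varifold in the ball points outwards. -/
theorem firstVariation_radial_nonneg (hn : 1 ≤ n) (h : IsBallVarifold V μ T)
    (hst : IsStationaryInBall V) {φ : Euc n → ℝ} (hφ : ContDiff ℝ ∞ φ)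
    (h0 : ∀ x ∈ unitSphere n, 0 ≤ φ x) : 0 ≤ firstVariation V fun x => φ x • x := by
  obtain ⟨C, hC⟩ := (isCompact_closedBall (0 : Euc n) 1).exists_bound_of_continuousOn
    (hφ.continuous_fderiv (by simp)).continuousOn
  have hC0 : 0 ≤ C := (norm_nonneg _).trans (hC 0 (by simp))
  -- adding a multiple of `1 - |x|²` makes `φ` nonnegative in the ball
  have hψ : ContDiff ℝ ∞ fun x : Euc n => φ x + C * (1 - ‖x‖ ^ 2) :=
    hφ.add (contDiff_const.mul (contDiff_const.sub (contDiff_norm_sq ℝ)))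
  rw [h.firstVariation_congr hst (contDiff_smul_self hφ) (contDiff_smul_self hψ) fun x hx => by
    have hx1 : ‖x‖ = 1 := by simpa using hx
    simp [hx1]]
  refine h.firstVariation_radial_nonneg_of_ball hst hψ fun x hx => ?_
  have hx1 : ‖x‖ ≤ 1 := by simpa using hx
  obtain ⟨y, hy, hxy⟩ : ∃ y : Euc n, ‖y‖ = 1 ∧ x = ‖x‖ • y := by
    by_cases hx0 : x = 0
    · obtain ⟨e, he⟩ := exists_norm_eq_one hn
      exact ⟨e, he, by simp [hx0]⟩
    · exact ⟨‖x‖⁻¹ • x, by simp [norm_smul, hx0], by simp [smul_smul, hx0]⟩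
  have hd := Convex.norm_image_sub_le_of_norm_fderiv_le (𝕜 := ℝ) (f := φ) (s := unitBall n)
    (fun z _ => (hφ.differentiable (by simp)) z) hC (convex_closedBall 0 1) hx
    (show y ∈ unitBall n by simp [hy])
  have hyx : ‖y - x‖ = 1 - ‖x‖ := by
    have : y - x = (1 - ‖x‖) • y := by rw [sub_smul, one_smul, ← hxy]
    rw [this, norm_smul, hy, mul_one, Real.norm_of_nonneg (by linarith)]
  rw [hyx, Real.norm_eq_abs] at hd
  have h1 := (abs_le.1 hd).2
  have h2 := h0 y (by simp [hy])
  nlinarith [norm_nonneg x, mul_nonneg hC0 (norm_nonneg x),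
    mul_nonneg (mul_nonneg hC0 (norm_nonneg x)) (sub_nonneg.2 hx1)]

end IsBallVarifold

end

/-! ### The boundary measure of a stationary varifold -/

section

variable {n : ℕ}

/-- Functions on the sphere which extend to smooth functions on `ℝⁿ`. -/
def smoothOnSphere (n : ℕ) : Submodule ℝ C(unitSphere n, ℝ) where
  carrier := {g | ∃ φ : Euc n → ℝ, ContDiff ℝ ∞ φ ∧ ∀ x, g x = φ x}
  add_mem' := by
    rintro g h ⟨φ, hφ, hg⟩ ⟨ψ, hψ, hh⟩
    exact ⟨_, hφ.add hψ, fun x => by simp [hg, hh]⟩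
  zero_mem' := ⟨fun _ => 0, contDiff_const, fun x => rfl⟩
  smul_mem' := by
    rintro c g ⟨φ, hφ, hg⟩
    exact ⟨_, hφ.const_smul c, fun x => by simp [hg]⟩

/-- A positive linear functional on the smooth functions on the sphere is given by a measure: it
extends to a positive functional on continuous functions. -/
theorem exists_measure_of_nonneg (Λ : (Euc n → ℝ) → ℝ)
    (hadd : ∀ φ ψ, ContDiff ℝ ∞ φ → ContDiff ℝ ∞ ψ → Λ (fun x => φ x + ψ x) = Λ φ + Λ ψ)
    (hsmul : ∀ (c : ℝ) φ, ContDiff ℝ ∞ φ → Λ (fun x => c * φ x) = c * Λ φ)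
    (hpos : ∀ φ, ContDiff ℝ ∞ φ → (∀ x ∈ unitSphere n, 0 ≤ φ x) → 0 ≤ Λ φ) :
    ∃ σ : Measure (Euc n), IsFiniteMeasure σ ∧ σ (unitSphere n)ᶜ = 0 ∧
      ∀ φ, ContDiff ℝ ∞ φ → Λ φ = ∫ x, φ x ∂σ := by
  have hcongr : ∀ φ ψ, ContDiff ℝ ∞ φ → ContDiff ℝ ∞ ψ → (∀ x ∈ unitSphere n, φ x = ψ x) →
      Λ φ = Λ ψ := by
    have key : ∀ φ ψ, ContDiff ℝ ∞ φ → ContDiff ℝ ∞ ψ → (∀ x ∈ unitSphere n, φ x = ψ x) →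
        Λ ψ ≤ Λ φ := fun φ ψ hφ hψ h => by
      have h1 := hpos (fun x => φ x + (-1) * ψ x) (hφ.add (contDiff_const.mul hψ))
        fun x hx => by rw [h x hx]; simp
      rw [hadd φ _ hφ (contDiff_const.mul hψ), hsmul _ ψ hψ] at h1
      linarith
    exact fun φ ψ hφ hψ h =>
      le_antisymm (key ψ φ hψ hφ fun x hx => (h x hx).symm) (key φ ψ hφ hψ h)
  let D := smoothOnSphere n
  let ext : D → Euc n → ℝ := fun g => g.2.choose
  have hext : ∀ g : D, ContDiff ℝ ∞ (ext g) := fun g => g.2.choose_spec.1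
  have hext' : ∀ (g : D) x (hx : x ∈ unitSphere n), ext g x = g.1 ⟨x, hx⟩ :=
    fun g x hx => (g.2.choose_spec.2 ⟨x, hx⟩).symm
  let F : C(unitSphere n, ℝ) →ₗ.[ℝ] ℝ :=
    { domain := D
      toFun :=
        { toFun := fun g => Λ (ext g)
          map_add' := fun g h => by
            rw [← hadd _ _ (hext g) (hext h)]
            refine hcongr _ _ (hext _) ((hext g).add (hext h)) fun x hx => ?_
            rw [hext' _ x hx, hext' _ x hx, hext' _ x hx]; rfl
          map_smul' := fun c g => by
            rw [RingHom.id_apply, smul_eq_mul, ← hsmul c _ (hext g)]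
            refine hcongr _ _ (hext _) (contDiff_const.mul (hext g)) fun x hx => ?_
            rw [hext' _ x hx, hext' _ x hx]; rfl } }
  -- The M. Riesz extension theorem applies because the constants dominate all functions.
  obtain ⟨G, hG, hGpos⟩ := riesz_extension (PointedCone.positive ℝ C(unitSphere n, ℝ)) F
    (fun g hg => hpos _ (hext g) fun x hx => by
      rw [hext' g x hx]
      exact hg ⟨x, hx⟩)
    (fun g => by
      refine ⟨⟨ContinuousMap.const _ ‖g‖, fun _ => ‖g‖, contDiff_const, fun x => rfl⟩, ?_⟩
      rw [PointedCone.mem_positive, ContinuousMap.le_def]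
      intro x
      have := (abs_le.1 (g.norm_coe_le_norm x)).1
      simp only [ContinuousMap.zero_apply, ContinuousMap.add_apply, ContinuousMap.const_apply]
      linarith)
  let P : CompactlySupportedContinuousMap (unitSphere n) ℝ →ₚ[ℝ] ℝ :=
    PositiveLinearMap.mk₀
      { toFun := fun g => G g.toContinuousMap
        map_add' := fun g h => G.map_add g.toContinuousMap h.toContinuousMap
        map_smul' := fun c g => G.map_smul c g.toContinuousMap }
      (fun g hg => hGpos _ (by
        rw [PointedCone.mem_positive, ContinuousMap.le_def]
        exact fun x => hg x))
  have hemb : MeasurableEmbedding (Subtype.val : unitSphere n → Euc n) :=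
    MeasurableEmbedding.subtype_coe Metric.isClosed_sphere.measurableSet
  have hfin : IsFiniteMeasure (RealRMK.rieszMeasure P) := inferInstance
  refine ⟨(RealRMK.rieszMeasure P).map Subtype.val, inferInstance, ?_, fun φ hφ => ?_⟩
  · rw [hemb.map_apply]
    convert measure_empty (μ := RealRMK.rieszMeasure P)
    ext x; simp
  · rw [hemb.integral_map]
    let g : CompactlySupportedContinuousMap (unitSphere n) ℝ :=
      ⟨⟨fun x => φ x, hφ.continuous.comp continuous_subtype_val⟩,
        HasCompactSupport.of_compactSpace _⟩
    have h1 := RealRMK.integral_rieszMeasure P g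
    change _ = ∫ x, g x ∂_
    rw [h1]
    change _ = G g.toContinuousMap
    let g' : D := ⟨g.toContinuousMap, φ, hφ, fun x => rfl⟩
    rw [show G g.toContinuousMap = F g' from hG g']
    exact hcongr _ _ hφ (hext g') fun x hx => by rw [hext' g' x hx]; rfl

namespace IsBallVarifold

variable {V : Measure (Euc n × (Euc n →L[ℝ] Euc n))} {μ : Measure (Euc n)}
  {T : Euc n → Submodule ℝ (Euc n)}

/-- The boundary measure represents the positive functional `φ ↦ δV(φ x)`. -/
theorem exists_isBoundaryMeasure (hn : 1 ≤ n) (h : IsBallVarifold V μ T)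
    (hst : IsStationaryInBall V) : ∃ σ, IsBoundaryMeasure V σ := by
  obtain ⟨σ, hσ, hσS, hint⟩ := exists_measure_of_nonneg
    (fun φ => firstVariation V fun x => φ x • x)
    (fun φ ψ hφ hψ => by
      simp only [add_smul]
      exact h.firstVariation_add (contDiff_smul_self hφ) (contDiff_smul_self hψ))
    (fun c φ hφ => by
      simp only [mul_smul]
      exact h.firstVariation_smul (contDiff_smul_self hφ) c)
    (fun φ hφ h0 => h.firstVariation_radial_nonneg hn hst hφ h0)
  refine ⟨σ, hσ, hσS, fun X hX => ?_⟩
  have hφ : ContDiff ℝ ∞ fun x => (inner ℝ (X x) x : ℝ) := hX.inner ℝ contDiff_id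
  rw [← hint _ hφ]
  refine h.firstVariation_congr hst hX (contDiff_smul_self hφ) fun x hx => ?_
  have hx1 : ‖x‖ = 1 := by simpa using hx
  rw [inner_smul_left, real_inner_self_eq_norm_sq, hx1]
  simp

end IsBallVarifold

theorem IsBoundaryMeasure.integral_eq {V : Measure (Euc n × (Euc n →L[ℝ] Euc n))}
    {σ : Measure (Euc n)} (h : IsBoundaryMeasure V σ) {φ : Euc n → ℝ} (hφ : ContDiff ℝ ∞ φ) :
    firstVariation V (fun x => φ x • x) = ∫ x, φ x ∂σ := by
  rw [h.2.2 _ (contDiff_smul_self hφ)]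
  refine integral_congr_ae ?_
  have hae : ∀ᵐ x ∂σ, x ∈ unitSphere n := h.2.1
  filter_upwards [hae] with x hx
  have hx1 : ‖x‖ = 1 := by simpa using hx
  rw [inner_smul_left, real_inner_self_eq_norm_sq, hx1]
  simp

/-- The boundary measure is unique: its characteristic function is determined by `δV`. -/
theorem IsBoundaryMeasure.unique {V : Measure (Euc n × (Euc n →L[ℝ] Euc n))}
    {σ τ : Measure (Euc n)} (hσ : IsBoundaryMeasure V σ) (hτ : IsBoundaryMeasure V τ) : σ = τ := by
  have := hσ.1
  have := hτ.1
  have key : ∀ (ν : Measure (Euc n)), IsBoundaryMeasure V ν → ∀ t, charFun ν t =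
      ((firstVariation V fun x => Real.cos (inner ℝ x t) • x : ℝ) : ℂ) +
      ((firstVariation V fun x => Real.sin (inner ℝ x t) • x : ℝ) : ℂ) * Complex.I := by
    intro ν hν t
    have := hν.1
    have hi : ContDiff ℝ ∞ fun x : Euc n => (inner ℝ x t : ℝ) := contDiff_id.inner ℝ contDiff_const
    rw [hν.integral_eq hi.cos, hν.integral_eq hi.sin,
      charFun_apply, ← integral_complex_ofReal, ← integral_complex_ofReal, ← integral_mul_const,
      ← integral_add]
    · congr 1; ext x
      rw [Complex.exp_mul_I, ← Complex.ofReal_cos, ← Complex.ofReal_sin]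
    · refine Integrable.of_bound (by fun_prop) 1 (.of_forall fun x => ?_)
      rw [Complex.norm_real]; exact Real.abs_cos_le_one _
    · refine Integrable.of_bound (by fun_prop) 1 (.of_forall fun x => ?_)
      rw [norm_mul, Complex.norm_real, Complex.norm_I, mul_one]; exact Real.abs_sin_le_one _
  exact Measure.ext_of_charFun (funext fun t => by rw [key σ hσ t, key τ hτ t])

/-- Stationary varifolds have a unique boundary measure, and conformal transformations of the ball
do not increase it. -/
theorem varifold_boundary {f : Euc n → Euc n} (hf : IsConformalTransformation f)
    {V : Measure (Euc n × (Euc n →L[ℝ] Euc n))} (hV : IsIntegerRectifiableVarifold V)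
    (hB : IsInBall V) (hst : IsStationaryInBall V) :
    (∃! σ : Measure (Euc n), IsBoundaryMeasure V σ) ∧
      ∀ σ : Measure (Euc n), IsBoundaryMeasure V σ → imageLength f σ ≤ σ univ := by
  obtain ⟨μ, T, h⟩ := hV.exists_isBallVarifold hB
  rcases le_or_gt 2 n with hn | hn
  · obtain ⟨σ, hσ⟩ := h.exists_isBoundaryMeasure (by omega) hst
    refine ⟨⟨σ, hσ, fun τ hτ => hτ.unique hσ⟩, fun τ hτ => ?_⟩
    have := hτ.1
    refine imageLength_le_of_flux_nonneg hf hn τ hτ.2.1 fun X hX hdiv => ?_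
    rw [← hτ.2.2 X hX]
    exact h.firstVariation_nonneg hX hdiv
  · -- there are no planes in `ℝⁿ`, so that `V = 0`
    have hμ : μ = 0 := by
      rw [← ae_eq_bot, ← eventually_false_iff_eq_bot]
      filter_upwards [h.finrank] with x hx
      have := Submodule.finrank_le (T x)
      rw [hx, finrank_euclideanSpace_fin] at this
      omega
    have hV0 : ∀ X, firstVariation V X = 0 := fun X => by
      rw [firstVariation, h.eq_map, hμ]; simp
    have h0 : IsBoundaryMeasure V 0 := ⟨inferInstance, by simp, fun X _ => by simp [hV0 X]⟩
    refine ⟨⟨0, h0, fun τ hτ => hτ.unique h0⟩, fun τ hτ => ?_⟩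
    rw [hτ.unique h0]
    simp [imageLength]

end

/-! ### The area formula for curves -/

section

section ArcLength

variable {F : Type*} [NormedAddCommGroup F] [NormedSpace ℝ F]

/-- An immersed curve is locally bi-Lipschitz, with constants arbitrarily close to its speed. -/
theorem exists_bilipschitz_nhds {γ : ℝ → F} {O : Set ℝ} (hO : IsOpen O)
    (hγ : ContDiffOn ℝ 1 γ O) (h0 : ∀ t ∈ O, deriv γ t ≠ 0) {q : ℝ} (hq : 1 < q) {t : ℝ}
    (ht : t ∈ O) :
    ∃ W : Set ℝ, IsOpen W ∧ t ∈ W ∧ W ⊆ O ∧ ∃ k K : ℝ, 0 < k ∧ 0 < K ∧ K = q * k ∧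
      (∀ a ∈ W, ∀ b ∈ W, k * dist a b ≤ dist (γ a) (γ b) ∧ dist (γ a) (γ b) ≤ K * dist a b) ∧
      ∀ s ∈ W, k ≤ ‖deriv γ s‖ ∧ ‖deriv γ s‖ ≤ K := by
  have hm : 0 < ‖deriv γ t‖ := norm_pos_iff.2 (h0 t ht)
  set m := ‖deriv γ t‖ with hmdef
  -- With this choice of `c` the ratio of `m + c` and `m - c` is `q`.
  set c := m * (q - 1) / (q + 1) with hc
  have hc0 : 0 < c := by
    have : 0 < q - 1 := by linarith
    positivity
  have hk : m - c = 2 * m / (q + 1) := by rw [hc]; field_simp; ring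
  have hK : m + c = q * (m - c) := by rw [hk, hc]; field_simp; ring
  have hk0 : 0 < m - c := by rw [hk]; positivity
  have hs : HasStrictDerivAt γ (deriv γ t) t :=
    (hγ.contDiffAt (hO.mem_nhds ht)).hasStrictDerivAt (by simp)
  have hs' := hs.hasStrictFDerivAt.isLittleO.def hc0
  have hcont : ContinuousAt (fun s => ‖deriv γ s‖) t :=
    ((hγ.continuousOn_deriv_of_isOpen hO le_rfl).continuousAt (hO.mem_nhds ht)).norm
  have hs2 : ∀ᶠ s in 𝓝 t, ‖deriv γ s‖ ∈ Ioo (m - c) (m + c) :=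
    hcont (Ioo_mem_nhds (by linarith) (by linarith))
  rw [nhds_prod_eq] at hs'
  obtain ⟨W₁, hW₁, hW₁'⟩ := (eventually_prod_self_iff (r := fun a b =>
    ‖γ a - γ b - (ContinuousLinearMap.toSpanSingleton ℝ (deriv γ t)) (a - b)‖ ≤ c * ‖a - b‖)).1 hs'
  obtain ⟨W, hWsub, hWo, htW⟩ := mem_nhds_iff.1
    (inter_mem (inter_mem hW₁ hs2) (hO.mem_nhds ht))
  refine ⟨W, hWo, htW, fun s hs => (hWsub hs).2, m - c, m + c, hk0, by linarith, hK,
    fun a ha b hb => ?_, fun s hs => ⟨(hWsub hs).1.2.1.le, (hWsub hs).1.2.2.le⟩⟩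
  have h := hW₁' a (hWsub ha).1.1 b (hWsub hb).1.1
  simp only [ContinuousLinearMap.toSpanSingleton_apply] at h
  have e1 : ‖(a - b) • deriv γ t‖ = m * ‖a - b‖ := by rw [norm_smul, mul_comm]
  have e2 := norm_sub_norm_le (γ a - γ b) ((a - b) • deriv γ t)
  have e3 := norm_sub_norm_le ((a - b) • deriv γ t) (γ a - γ b)
  rw [norm_sub_rev ((a - b) • deriv γ t)] at e3
  rw [dist_eq_norm, dist_eq_norm]
  constructor <;> nlinarith

/-- Comparison of `ℋ¹` of the image with the length integral for a set on which the curve is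
bi-Lipschitz with constants close to its speed. -/
theorem hausdorffMeasure_image_bounds [MeasurableSpace F] [BorelSpace F] {γ : ℝ → F} {E : Set ℝ}
    (hE : MeasurableSet E) {q k K : ℝ} (hk : 0 < k) (hK : 0 < K) (hq : 1 < q) (hKk : K = q * k)
    (hlip : ∀ a ∈ E, ∀ b ∈ E, k * dist a b ≤ dist (γ a) (γ b) ∧ dist (γ a) (γ b) ≤ K * dist a b)
    (hsp : ∀ s ∈ E, k ≤ ‖deriv γ s‖ ∧ ‖deriv γ s‖ ≤ K) :
    μH[1] (γ '' E) ≤ ENNReal.ofReal q * ∫⁻ t in E, ‖deriv γ t‖ₑ ∧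
      ∫⁻ t in E, ‖deriv γ t‖ₑ ≤ ENNReal.ofReal q * μH[1] (γ '' E) := by
  have hq0 : 0 < q := by linarith
  have hup : ∫⁻ t in E, ‖deriv γ t‖ₑ ≤ ENNReal.ofReal K * volume E := by
    rw [← setLIntegral_const]
    refine setLIntegral_mono measurable_const fun t ht => ?_
    rw [← ofReal_norm]
    exact ENNReal.ofReal_le_ofReal (hsp t ht).2
  have hlow : ENNReal.ofReal k * volume E ≤ ∫⁻ t in E, ‖deriv γ t‖ₑ := by
    rw [← setLIntegral_const]
    refine setLIntegral_mono' hE fun t ht => ?_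
    rw [← ofReal_norm]
    exact ENNReal.ofReal_le_ofReal (hsp t ht).1
  have h1 : μH[1] (γ '' E) ≤ ENNReal.ofReal K * volume E := by
    have hL : LipschitzOnWith K.toNNReal γ E := LipschitzOnWith.of_dist_le_mul fun a ha b hb => by
      rw [Real.coe_toNNReal _ hK.le]; exact (hlip a ha b hb).2
    have := hL.hausdorffMeasure_image_le (d := 1) zero_le_one
    rwa [ENNReal.rpow_one, hausdorffMeasure_real] at this
  have h2 : ENNReal.ofReal k * volume E ≤ μH[1] (γ '' E) := by
    have hA : AntilipschitzWith (k⁻¹).toNNReal (fun x : E => γ x) :=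
      AntilipschitzWith.of_le_mul_dist fun a b => by
        rw [Real.coe_toNNReal _ (inv_nonneg.2 hk.le), ← div_eq_inv_mul, le_div_iff₀ hk, mul_comm]
        exact (hlip a a.2 b b.2).1
    have h3 := hA.le_hausdorffMeasure_image (d := 1) zero_le_one univ
    have h4 : μH[1] (univ : Set E) = volume E := by
      rw [← hausdorffMeasure_real, ← (isometry_subtype_coe (s := E)).hausdorffMeasure_image
        (Or.inl zero_le_one), image_univ, Subtype.range_coe]
    have h5 : (fun x : E => γ x) '' univ = γ '' E := by
      rw [image_univ]; ext; simp
    rw [h4, h5, ENNReal.rpow_one] at h3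
    calc ENNReal.ofReal k * volume E
        ≤ ENNReal.ofReal k * (ENNReal.ofReal k⁻¹ * μH[1] (γ '' E)) := by gcongr; exact h3
      _ = μH[1] (γ '' E) := by
        rw [← mul_assoc, ← ENNReal.ofReal_mul hk.le, mul_inv_cancel₀ hk.ne', ENNReal.ofReal_one,
          one_mul]
  have h6 : ENNReal.ofReal K * volume E = ENNReal.ofReal q * (ENNReal.ofReal k * volume E) := by
    rw [hKk, ENNReal.ofReal_mul hq0.le, mul_assoc]
  exact ⟨h1.trans (h6.trans_le (by gcongr)), hup.trans (h6.trans_le (by gcongr))⟩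

theorem le_of_forall_one_lt_le_mul_ennreal {a b : ENNReal}
    (h : ∀ q : ℝ, 1 < q → a ≤ ENNReal.ofReal q * b) : a ≤ b := by
  have h1 : Tendsto (fun q : ℝ => ENNReal.ofReal q * b) (𝓝[>] 1) (𝓝 (ENNReal.ofReal 1 * b)) :=
    (ENNReal.Tendsto.mul_const ((ENNReal.continuous_ofReal.tendsto 1).mono_left
      nhdsWithin_le_nhds) (Or.inl (by simp)))
  rw [ENNReal.ofReal_one, one_mul] at h1
  exact ge_of_tendsto h1 (eventually_nhdsWithin_of_forall fun q hq => h q hq)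

theorem encard_iUnion_of_disjoint {α : Type*} {s : ℕ → Set α}
    (hs : Pairwise (Function.onFun Disjoint s)) :
    ((⋃ i, s i).encard : ENNReal) = ∑' i, ((s i).encard : ENNReal) := by
  let _ : MeasurableSpace α := ⊤
  simp only [← Measure.count_apply MeasurableSpace.measurableSet_top]
  exact measure_iUnion hs fun _ => MeasurableSpace.measurableSet_top

/-- The area formula for immersed curves: the length integral counts the points of the image with
multiplicity. -/
theorem lintegral_encard_eq_lintegral_enorm_deriv [MeasurableSpace F] [BorelSpace F]
    [SecondCountableTopology F] [CompleteSpace F] {γ : ℝ → F} {O : Set ℝ} (hO : IsOpen O)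
    (hγ : ContDiffOn ℝ 1 γ O) (h0 : ∀ t ∈ O, deriv γ t ≠ 0) {E : Set ℝ} (hE : MeasurableSet E)
    (hEO : E ⊆ O) :
    Measurable (fun y => (({t | t ∈ E ∧ γ t = y}.encard : ℕ∞) : ENNReal)) ∧
    ∫⁻ y, (({t | t ∈ E ∧ γ t = y}.encard : ℕ∞) : ENNReal) ∂(μH[1] : Measure F) =
      ∫⁻ t in E, ‖deriv γ t‖ₑ := by
  -- cut `E` into countably many pieces on which `γ` is almost a similarity
  have key : ∀ q : ℝ, 1 < q → ∃ S : ℕ → Set ℝ, (∀ i, MeasurableSet (S i)) ∧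
      Pairwise (Function.onFun Disjoint S) ∧ (⋃ i, S i) = E ∧ (∀ i, InjOn γ (S i)) ∧
      ∀ i, μH[1] (γ '' S i) ≤ ENNReal.ofReal q * ∫⁻ t in S i, ‖deriv γ t‖ₑ ∧
      ∫⁻ t in S i, ‖deriv γ t‖ₑ ≤ ENNReal.ofReal q * μH[1] (γ '' S i) := by
    intro q hq
    choose! W hWo htW hWO k K hk hK hKk hlip hsp using
      fun t (ht : t ∈ O) => exists_bilipschitz_nhds hO hγ h0 hq ht
    obtain ⟨C, hCO, hC, hCE⟩ := TopologicalSpace.countable_cover_nhdsWithin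
      (f := W) (s := O) fun t ht => mem_nhdsWithin_of_mem_nhds ((hWo t ht).mem_nhds (htW t ht))
    rcases C.eq_empty_or_nonempty with rfl | hne
    · have : E = ∅ := by
        rw [eq_empty_iff_forall_notMem]
        intro t ht
        simpa using hCE (hEO ht)
      refine ⟨fun _ => ∅, by simp, fun i j _ => by simp [Function.onFun], by simp [this],
        by simp, by simp⟩
    · obtain ⟨g, hg⟩ := hC.exists_eq_range hne
      have hgO : ∀ i, g i ∈ O := fun i => hCO (hg ▸ mem_range_self i)
      have hsub : ∀ i, E ∩ disjointed (fun j => W (g j)) i ⊆ W (g i) := fun i =>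
        inter_subset_right.trans (disjointed_subset _ i)
      have hmeas : ∀ i, MeasurableSet (E ∩ disjointed (fun j => W (g j)) i) := fun i =>
        hE.inter (MeasurableSet.disjointed (fun j => (hWo _ (hgO j)).measurableSet) i)
      refine ⟨fun i => E ∩ disjointed (fun j => W (g j)) i, hmeas, ?_, ?_, ?_, fun i => ?_⟩
      · intro i j hij
        exact ((disjoint_disjointed fun j => W (g j)) hij).mono inter_subset_right
          inter_subset_right
      · rw [← inter_iUnion, iUnion_disjointed, inter_eq_left]
        intro t ht
        have := hCE (hEO ht)
        rw [hg, biUnion_range] at this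
        exact this
      · intro i a ha b hb hab
        have := (hlip _ (hgO i) a (hsub i ha) b (hsub i hb)).1
        rw [hab, dist_self] at this
        by_contra hne
        have := mul_pos (hk _ (hgO i)) (dist_pos.2 hne)
        linarith
      · exact hausdorffMeasure_image_bounds (hmeas i) (hk _ (hgO i)) (hK _ (hgO i)) hq
          (hKk _ (hgO i)) (fun a ha b hb => hlip _ (hgO i) a (hsub i ha) b (hsub i hb))
          (fun s hs => hsp _ (hgO i) s (hsub i hs))
  have hcount : ∀ S : ℕ → Set ℝ, (∀ i, MeasurableSet (S i)) →
      Pairwise (Function.onFun Disjoint S) → (⋃ i, S i) = E → (∀ i, InjOn γ (S i)) →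
      (∀ i, MeasurableSet (γ '' S i)) ∧
      (fun y => (({t | t ∈ E ∧ γ t = y}.encard : ℕ∞) : ENNReal)) =
        fun y => ∑' i, (γ '' S i).indicator 1 y := by
    intro S hS hd hU hinj
    refine ⟨fun i => (hS i).image_of_continuousOn_injOn
      (hγ.continuousOn.mono ((subset_iUnion S i).trans (hU.trans_subset hEO))) (hinj i), ?_⟩
    ext y
    have h1 : {t | t ∈ E ∧ γ t = y} = ⋃ i, {t | t ∈ S i ∧ γ t = y} := by
      ext t; simp [← hU]
    rw [h1, encard_iUnion_of_disjoint fun i j hij => (hd hij).mono (fun t ht => ht.1)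
      fun t ht => ht.1]
    congr 1; ext i
    by_cases hy : y ∈ γ '' S i
    · obtain ⟨t, ht, rfl⟩ := hy
      have h2 : {s | s ∈ S i ∧ γ s = γ t} = {t} := by
        ext s
        exact ⟨fun hs => hinj i hs.1 ht hs.2,
          fun hs => by rw [mem_singleton_iff.1 hs]; exact ⟨ht, rfl⟩⟩
      rw [h2, indicator_of_mem (mem_image_of_mem γ ht)]
      simp
    · have h2 : {s | s ∈ S i ∧ γ s = y} = ∅ := by
        rw [eq_empty_iff_forall_notMem]
        exact fun s hs => hy ⟨s, hs.1, hs.2⟩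
      rw [h2, indicator_of_notMem hy]
      simp
  have hsum : ∀ S : ℕ → Set ℝ, (∀ i, MeasurableSet (S i)) →
      Pairwise (Function.onFun Disjoint S) → (⋃ i, S i) = E → (∀ i, InjOn γ (S i)) →
      ∫⁻ y, (({t | t ∈ E ∧ γ t = y}.encard : ℕ∞) : ENNReal) ∂(μH[1] : Measure F) =
        ∑' i, μH[1] (γ '' S i) ∧ ∫⁻ t in E, ‖deriv γ t‖ₑ = ∑' i, ∫⁻ t in S i, ‖deriv γ t‖ₑ := by
    intro S hS hd hU hinj
    obtain ⟨h1, h2⟩ := hcount S hS hd hU hinj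
    constructor
    · rw [h2, lintegral_tsum fun i => (measurable_one.indicator (h1 i)).aemeasurable]
      congr 1; ext i
      rw [lintegral_indicator_one (h1 i)]
    · rw [← hU, lintegral_iUnion hS hd]
  constructor
  · obtain ⟨S, hS, hd, hU, hinj, -⟩ := key 2 (by norm_num)
    obtain ⟨h1, h2⟩ := hcount S hS hd hU hinj
    rw [h2]
    exact Measurable.tsum fun i => measurable_one.indicator (h1 i)
  · refine le_antisymm (le_of_forall_one_lt_le_mul_ennreal fun q hq => ?_)
      (le_of_forall_one_lt_le_mul_ennreal fun q hq => ?_)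
    · obtain ⟨S, hS, hd, hU, hinj, hb⟩ := key q hq
      obtain ⟨e1, e2⟩ := hsum S hS hd hU hinj
      rw [e1, e2, ← ENNReal.tsum_mul_left]
      exact ENNReal.tsum_le_tsum fun i => (hb i).1
    · obtain ⟨S, hS, hd, hU, hinj, hb⟩ := key q hq
      obtain ⟨e1, e2⟩ := hsum S hS hd hU hinj
      rw [e1, e2, ← ENNReal.tsum_mul_left]
      exact ENNReal.tsum_le_tsum fun i => (hb i).2

end ArcLength

end

/-! ### The divergence theorem on the half-plane -/

section

/-- The closed half-plane. -/
def halfPlane : Set (Euc 2) := {z | 0 ≤ z 0}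

/-- The coordinate vectors of the plane. -/
noncomputable abbrev bas (i : Fin 2) : Euc 2 := EuclideanSpace.single i 1

/-- The identification of `ℝ × ℝ` with the Euclidean plane. -/
noncomputable def planePt : ℝ × ℝ →L[ℝ] Euc 2 :=
  (ContinuousLinearMap.fst ℝ ℝ ℝ).smulRight (bas 0) +
    (ContinuousLinearMap.snd ℝ ℝ ℝ).smulRight (bas 1)

@[simp] theorem planePt_zero (p : ℝ × ℝ) : planePt p 0 = p.1 := by simp [planePt]

@[simp] theorem planePt_one (p : ℝ × ℝ) : planePt p 1 = p.2 := by simp [planePt]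

theorem planePt_coords (z : Euc 2) : planePt (z 0, z 1) = z := by
  ext i; fin_cases i <;> simp

theorem coords_expand (z : Euc 2) : z = z 0 • bas 0 + z 1 • bas 1 := by
  ext i; fin_cases i <;> simp

theorem isClosed_halfPlane : IsClosed halfPlane :=
  isClosed_le continuous_const (by fun_prop)

theorem convex_halfPlane : Convex ℝ halfPlane := by
  intro x hx y hy a b ha hb _
  have hx : 0 ≤ x 0 := hx
  have hy : 0 ≤ y 0 := hy
  show 0 ≤ (a • x + b • y) 0
  simp only [PiLp.add_apply, PiLp.smul_apply, smul_eq_mul]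
  positivity

theorem halfPlane_mem_nhds {z : Euc 2} (hz : 0 < z 0) : halfPlane ∈ 𝓝 z :=
  mem_of_superset
    ((isOpen_lt continuous_const (by fun_prop : Continuous fun z : Euc 2 => z 0)).mem_nhds hz)
    fun y (hy : 0 < y 0) => (le_of_lt hy : 0 ≤ y 0)

theorem uniqueDiffOn_halfPlane : UniqueDiffOn ℝ halfPlane :=
  uniqueDiffOn_convex convex_halfPlane
    ⟨bas 0, mem_interior_iff_mem_nhds.2 (halfPlane_mem_nhds (by simp))⟩

theorem mem_closure_interior_halfPlane {z : Euc 2} (hz : z ∈ halfPlane) :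
    z ∈ closure (interior halfPlane) := by
  rw [convex_halfPlane.closure_interior_eq_closure_of_nonempty_interior
    ⟨bas 0, mem_interior_iff_mem_nhds.2 (halfPlane_mem_nhds (by simp))⟩]
  exact subset_closure hz

theorem measurePreserving_planePt : MeasurePreserving planePt := by
  have h1 := (volume_preserving_finTwoArrow ℝ).symm
  have h2 := (PiLp.volume_preserving_toLp (Fin 2)).comp h1
  have e : (planePt : ℝ × ℝ → Euc 2) =
      WithLp.toLp 2 ∘ (MeasurableEquiv.finTwoArrow (α := ℝ)).symm := by
    refine funext fun p => ?_
    ext i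
    fin_cases i <;> simp [MeasurableEquiv.finTwoArrow]
  rw [e]
  exact h2

theorem measurableEmbedding_planePt : MeasurableEmbedding planePt := by
  have hinj : Function.Injective planePt := fun p q h => by
    have h0 := congrArg (fun z : Euc 2 => z 0) h
    have h1 := congrArg (fun z : Euc 2 => z 1) h
    simp only [planePt_zero, planePt_one] at h0 h1
    exact Prod.ext h0 h1
  exact planePt.continuous.measurableEmbedding hinj

/-- The divergence theorem on the half-plane, for compactly supported fields that are continuous up
to the boundary and differentiable in the interior. -/
theorem integral_divergence_halfPlane {w₀ w₁ d : Euc 2 → ℝ} {w₀' w₁' : Euc 2 → Euc 2 →L[ℝ] ℝ}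
    {K : Set (Euc 2)} (hK : IsCompact K) (hw₀ : ∀ z, z ∉ K → w₀ z = 0)
    (hw₁ : ∀ z, z ∉ K → w₁ z = 0)
    (hdK : ∀ z ∈ halfPlane, z ∉ K → d z = 0)
    (hc₀ : ContinuousOn w₀ halfPlane) (hc₁ : ContinuousOn w₁ halfPlane)
    (hd₀ : ∀ z, 0 < z 0 → HasFDerivAt w₀ (w₀' z) z) (hd₁ : ∀ z, 0 < z 0 → HasFDerivAt w₁ (w₁' z) z)
    (hdiv : ∀ z, 0 < z 0 → w₀' z (bas 0) + w₁' z (bas 1) = d z)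
    (hint : IntegrableOn d halfPlane) :
    ∫ z in halfPlane, d z = -∫ t, w₀ (planePt (0, t)) := by
  obtain ⟨R, hR0, hR⟩ : ∃ R : ℝ, 0 < R ∧ ∀ z ∈ K, |z 0| < R ∧ |z 1| < R := by
    obtain ⟨r, hr⟩ := hK.isBounded.exists_norm_le
    refine ⟨max r 0 + 1, by positivity, fun z hz => ?_⟩
    have h1 := (PiLp.norm_apply_le z 0).trans (hr z hz)
    have h2 := (PiLp.norm_apply_le z 1).trans (hr z hz)
    rw [Real.norm_eq_abs] at h1 h2
    have := le_max_left r 0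
    constructor <;> linarith
  have hout : ∀ p : ℝ × ℝ, R ≤ |p.1| ∨ R ≤ |p.2| → planePt p ∉ K := fun p hp hpK => by
    have := hR _ hpK
    rw [planePt_zero, planePt_one] at this
    rcases hp with h | h <;> linarith [this.1, this.2]
  have hpre : planePt ⁻¹' halfPlane = {p : ℝ × ℝ | 0 ≤ p.1} := by
    ext p; simp [halfPlane]
  have hlhs : ∫ z in halfPlane, d z = ∫ p in Icc ((0 : ℝ), -R) (R, R), d (planePt p) := by
    rw [← measurePreserving_planePt.setIntegral_preimage_emb measurableEmbedding_planePt, hpre]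
    refine setIntegral_eq_of_subset_of_forall_sdiff_eq_zero
      (measurableSet_le measurable_const measurable_fst) (fun p hp => hp.1.1) fun p hp => ?_
    refine hdK _ (by simpa [halfPlane] using hp.1) (hout p ?_)
    by_contra! hcon
    have h1 := abs_lt.1 hcon.1
    have h2 := abs_lt.1 hcon.2
    exact hp.2 ⟨⟨hp.1, h2.1.le⟩, ⟨h1.2.le, h2.2.le⟩⟩
  have hint' : IntegrableOn (fun p => d (planePt p)) (Icc ((0 : ℝ), -R) (R, R)) := by
    have := (measurePreserving_planePt.integrableOn_comp_preimage measurableEmbedding_planePt).2 hint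
    rw [hpre] at this
    exact this.mono_set fun p hp => hp.1.1
  have hmaps : MapsTo planePt (Icc ((0 : ℝ), -R) (R, R)) halfPlane := fun p hp => by
    show 0 ≤ planePt p 0
    rw [planePt_zero]; exact hp.1.1
  let F' : (Euc 2 → Euc 2 →L[ℝ] ℝ) → ℝ × ℝ → ℝ × ℝ →L[ℝ] ℝ := fun w p => (w (planePt p)) ∘L planePt
  have hnull : ∀ᵐ p : ℝ × ℝ ∂(volume.restrict (Icc ((0 : ℝ), -R) (R, R))), 0 < p.1 := by
    have h1 : ∀ᵐ p : ℝ × ℝ, p.1 ≠ 0 := by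
      have : volume ({0} ×ˢ univ : Set (ℝ × ℝ)) = 0 := by
        rw [Measure.volume_eq_prod, Measure.prod_prod]; simp
      refine measure_mono_null (fun p hp => ?_) this
      simpa using hp
    filter_upwards [ae_restrict_of_ae h1, ae_restrict_mem measurableSet_Icc] with p hp hp'
    exact lt_of_le_of_ne hp'.1.1 (Ne.symm hp)
  have hae : (fun p : ℝ × ℝ => F' w₀' p (1, 0) + F' w₁' p (0, 1))
      =ᵐ[volume.restrict (Icc ((0 : ℝ), -R) (R, R))] fun p => d (planePt p) := by
    filter_upwards [hnull] with p hp
    rw [← hdiv (planePt p) (by simpa using hp)]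
    simp [F', planePt]
  have key := integral_divergence_prod_Icc_of_hasFDerivAt_of_le (fun p => w₀ (planePt p))
    (fun p => w₁ (planePt p)) (F' w₀') (F' w₁') ((0 : ℝ), -R) (R, R) ⟨hR0.le, by simp; linarith⟩
    (hc₀.comp planePt.continuous.continuousOn hmaps) (hc₁.comp planePt.continuous.continuousOn hmaps)
    (fun p hp => (hd₀ (planePt p) (by simpa using hp.1.1)).comp p planePt.hasFDerivAt)
    (fun p hp => (hd₁ (planePt p) (by simpa using hp.1.1)).comp p planePt.hasFDerivAt)
    (hint'.congr hae.symm)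
  rw [integral_congr_ae hae] at key
  have z1 : ∀ x : ℝ, w₁ (planePt (x, R)) = 0 := fun x =>
    hw₁ _ (hout _ (Or.inr (le_abs_self R)))
  have z2 : ∀ x : ℝ, w₁ (planePt (x, -R)) = 0 := fun x =>
    hw₁ _ (hout _ (Or.inr (by simp [le_abs_self R])))
  have z3 : ∀ y : ℝ, w₀ (planePt (R, y)) = 0 := fun x =>
    hw₀ _ (hout _ (Or.inl (le_abs_self R)))
  simp only [z1, z2, z3, intervalIntegral.integral_zero, sub_self, zero_add, zero_sub] at key
  rw [hlhs, key, intervalIntegral.integral_of_le (by linarith),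
    setIntegral_eq_integral_of_forall_compl_eq_zero]
  intro y hy
  refine hw₀ _ (hout _ (Or.inr ?_))
  by_contra! hcon
  have := abs_lt.1 hcon
  exact hy ⟨this.1, this.2.le⟩

end

/-! ### Area density and conormals of a plane -/

section

variable {n : ℕ}

/-- The area of the parallelogram spanned by `p` and `q`. -/
noncomputable def parArea (p q : Euc n) : ℝ := √(‖p‖ ^ 2 * ‖q‖ ^ 2 - inner ℝ p q ^ 2)

/-- The vector in the plane of `p` and `q` which is orthogonal to `q` and whose inner product with
`p` is the area of the parallelogram of `p` and `q`. If `p` and `q` are the coordinate vectors of a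
parametrized surface with metric `g`, it is `√(det g) ∇z⁰`. -/
noncomputable def conormal (p q : Euc n) : Euc n :=
  (parArea p q)⁻¹ • (‖q‖ ^ 2 • p - (inner ℝ p q : ℝ) • q)

theorem parArea_nonneg (p q : Euc n) : 0 ≤ parArea p q := Real.sqrt_nonneg _

theorem parArea_comm (p q : Euc n) : parArea p q = parArea q p := by
  rw [parArea, parArea, real_inner_comm, mul_comm]

theorem parArea_sq (p q : Euc n) : parArea p q ^ 2 = ‖p‖ ^ 2 * ‖q‖ ^ 2 - inner ℝ p q ^ 2 := by
  refine Real.sq_sqrt ?_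
  have h1 := abs_le.1 (abs_real_inner_le_norm p q)
  rw [← mul_pow]
  exact sub_nonneg.2 (sq_le_sq' h1.1 h1.2)

theorem parArea_smul_conormal {p q : Euc n} (h : 0 < parArea p q) :
    parArea p q • conormal p q = ‖q‖ ^ 2 • p - (inner ℝ p q : ℝ) • q := by
  rw [conormal, smul_smul, mul_inv_cancel₀ h.ne', one_smul]

theorem inner_conormal_left {p q : Euc n} (h : 0 < parArea p q) :
    inner ℝ (conormal p q) p = parArea p q := by
  have h1 := parArea_sq p q
  rw [conormal, inner_smul_left, inner_sub_left, inner_smul_left, inner_smul_left,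
    real_inner_self_eq_norm_sq, real_inner_comm p q]
  simp only [conj_trivial]
  field_simp
  rw [h1]; ring

theorem inner_conormal_right (p q : Euc n) : inner ℝ (conormal p q) q = 0 := by
  rw [conormal, inner_smul_left, inner_sub_left, inner_smul_left, inner_smul_left,
    real_inner_self_eq_norm_sq]
  simp only [conj_trivial]
  ring

theorem norm_sq_conormal {p q : Euc n} (h : 0 < parArea p q) : ‖conormal p q‖ ^ 2 = ‖q‖ ^ 2 := by
  rw [← real_inner_self_eq_norm_sq]
  nth_rw 2 [conormal]
  rw [inner_smul_right, inner_sub_right, inner_smul_right, inner_smul_right,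
    inner_conormal_left h, inner_conormal_right]
  field_simp
  ring

theorem parArea_pos_of_injective {L : Euc 2 →L[ℝ] Euc n} (hL : Function.Injective L) :
    0 < parArea (L (bas 0)) (L (bas 1)) := by
  set p := L (bas 0) with hp
  set q := L (bas 1) with hq
  have hne : ∀ v, v ≠ 0 → L v ≠ 0 := fun v hv h => hv (hL (h.trans (map_zero L).symm))
  have hq0 : 0 < ‖q‖ ^ 2 := by
    have : q ≠ 0 := hne _ (by simp)
    positivity
  have hv : L (‖q‖ ^ 2 • bas 0 - (inner ℝ p q : ℝ) • bas 1) ≠ 0 := hne _ fun h => by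
    have := congrArg (fun z : Euc 2 => z 0) h
    simp at this
    rw [this] at hq0; simp at hq0
  rw [map_sub, map_smul, map_smul, ← hp, ← hq] at hv
  have h2 : 0 < ‖‖q‖ ^ 2 • p - (inner ℝ p q : ℝ) • q‖ ^ 2 := by positivity
  rw [norm_sub_sq_real, norm_smul, norm_smul, inner_smul_left, inner_smul_right] at h2
  simp only [conj_trivial, norm_pow, Real.norm_eq_abs] at h2
  refine Real.sqrt_pos.2 ?_
  by_contra! hcon
  simp only [mul_pow, sq_abs] at h2
  nlinarith

/-- The orthogonal projection onto the plane of an immersed surface, in terms of the coordinate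
vectors. -/
theorem starProjection_range {L : Euc 2 →L[ℝ] Euc n} (hL : Function.Injective L) (v : Euc n) :
    (LinearMap.range L.toLinearMap).starProjection v = (parArea (L (bas 0)) (L (bas 1)))⁻¹ •
      (inner ℝ (conormal (L (bas 0)) (L (bas 1))) v • L (bas 0) +
        inner ℝ (conormal (L (bas 1)) (L (bas 0))) v • L (bas 1)) := by
  have hJ := parArea_pos_of_injective hL
  set p := L (bas 0) with hp
  set q := L (bas 1) with hq
  have hJ' : 0 < parArea q p := by rwa [parArea_comm]
  refine Submodule.eq_starProjection_of_mem_of_inner_eq_zero ?_ ?_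
  · exact Submodule.smul_mem _ _ (Submodule.add_mem _ (Submodule.smul_mem _ _ ⟨bas 0, rfl⟩)
      (Submodule.smul_mem _ _ ⟨bas 1, rfl⟩))
  · rintro _ ⟨w, rfl⟩
    have hw : L w = w 0 • p + w 1 • q := by
      conv_lhs => rw [coords_expand w, map_add, map_smul, map_smul]
    have e1 := parArea_sq p q
    have c1 : inner ℝ (conormal p q) v =
        (parArea p q)⁻¹ * (‖q‖ ^ 2 * inner ℝ p v - inner ℝ p q * inner ℝ q v) := by
      rw [conormal, inner_smul_left, inner_sub_left, inner_smul_left, inner_smul_left]; simp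
    have c2 : inner ℝ (conormal q p) v =
        (parArea p q)⁻¹ * (‖p‖ ^ 2 * inner ℝ q v - inner ℝ p q * inner ℝ p v) := by
      rw [conormal, inner_smul_left, inner_sub_left, inner_smul_left, inner_smul_left,
        real_inner_comm q p, parArea_comm]; simp
    rw [ContinuousLinearMap.coe_coe, hw, inner_sub_left, inner_smul_left, inner_add_left,
      inner_smul_left, inner_smul_left, c1, c2]
    simp only [inner_add_right, inner_smul_right, real_inner_self_eq_norm_sq, conj_trivial,
      real_inner_comm p q, real_inner_comm v]
    have e2 : ‖p‖ ^ 2 * ‖q‖ ^ 2 = parArea p q ^ 2 + inner ℝ p q ^ 2 := by linarith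
    field_simp
    have hv1 : inner ℝ v p = inner ℝ p v := real_inner_comm _ _
    have hv2 : inner ℝ v q = inner ℝ q v := real_inner_comm _ _
    simp only [hv1, hv2]
    linear_combination (-(w 0 * inner ℝ p v) - (w 1 * inner ℝ q v)) * e2

theorem finrank_range_of_injective {L : Euc 2 →L[ℝ] Euc n} (hL : Function.Injective L) :
    Module.finrank ℝ (LinearMap.range L.toLinearMap) = 2 := by
  rw [LinearMap.finrank_range_of_inj hL]; simp

/-- The divergence along the plane of an immersed surface in terms of the coordinate vectors. -/
theorem traceCLM_starProjection_range {L : Euc 2 →L[ℝ] Euc n} (hL : Function.Injective L)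
    (A : Euc n →L[ℝ] Euc n) :
    parArea (L (bas 0)) (L (bas 1)) *
        traceCLM n ((LinearMap.range L.toLinearMap).starProjection ∘L A) =
      inner ℝ (conormal (L (bas 0)) (L (bas 1))) (A (L (bas 0))) +
        inner ℝ (conormal (L (bas 1)) (L (bas 0))) (A (L (bas 1))) := by
  have hJ := parArea_pos_of_injective hL
  have h : (LinearMap.range L.toLinearMap).starProjection ∘L A =
      (parArea (L (bas 0)) (L (bas 1)))⁻¹ •
        (((innerSL ℝ (conormal (L (bas 0)) (L (bas 1)))) ∘L A).smulRight (L (bas 0)) +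
          ((innerSL ℝ (conormal (L (bas 1)) (L (bas 0)))) ∘L A).smulRight (L (bas 1))) := by
    ext1 v
    rw [ContinuousLinearMap.comp_apply, starProjection_range hL]
    simp
  have ht : ∀ (ℓ : Euc n →L[ℝ] ℝ) (w : Euc n), traceCLM n (ℓ.smulRight w) = ℓ w := fun ℓ w => by
    rw [traceCLM_apply]
    exact LinearMap.trace_smulRight ℓ.toLinearMap w
  rw [h, map_smul, map_add, ht, ht, smul_eq_mul, ← mul_assoc, mul_inv_cancel₀ hJ.ne', one_mul]
  simp

/-- A linear change of coordinates multiplies the area density by the absolute value of its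
determinant. -/
theorem parArea_comp (L : Euc 2 →L[ℝ] Euc n) (A : Euc 2 →L[ℝ] Euc 2) :
    parArea ((L ∘L A) (bas 0)) ((L ∘L A) (bas 1)) =
      |A.det| * parArea (L (bas 0)) (L (bas 1)) := by
  have hdet : A.det = A (bas 0) 0 * A (bas 1) 1 - A (bas 1) 0 * A (bas 0) 1 := by
    have h := LinearMap.det_toMatrix (EuclideanSpace.basisFun (Fin 2) ℝ).toBasis A.toLinearMap
    rw [Matrix.det_fin_two] at h
    simp only [LinearMap.toMatrix_apply] at h
    simp at h
    rw [ContinuousLinearMap.det, ← h]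
  have hA : ∀ i, (L ∘L A) (bas i) = A (bas i) 0 • L (bas 0) + A (bas i) 1 • L (bas 1) := fun i => by
    rw [ContinuousLinearMap.comp_apply]
    conv_lhs => rw [coords_expand (A (bas i)), map_add, map_smul, map_smul]
  rw [← sq_eq_sq₀ (parArea_nonneg _ _) (mul_nonneg (abs_nonneg _) (parArea_nonneg _ _)), mul_pow,
    sq_abs, parArea_sq, parArea_sq, hA, hA, hdet]
  simp only [← real_inner_self_eq_norm_sq, inner_add_left, inner_add_right, inner_smul_left,
    inner_smul_right, conj_trivial, real_inner_comm (L (bas 0)) (L (bas 1))]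
  ring

end

/-! ### Free boundary minimal surfaces in coordinates -/

section

variable {n : ℕ}

/-- A free boundary minimal surface in the ball, parametrized by a relatively open subset `Ω` of
the half-plane. Differentials are taken within the half-plane, so that they are one-sided at the
boundary points. -/
structure IsLocalSurface (φ : Euc 2 → Euc n) (Ω : Set (Euc 2)) : Prop where
  subset : Ω ⊆ halfPlane
  mem_nhds : ∀ z ∈ Ω, Ω ∈ 𝓝[halfPlane] z
  smooth : ∀ z ∈ Ω, ContDiffWithinAt ℝ ∞ φ halfPlane z
  injective : ∀ z ∈ Ω, Function.Injective (fderivWithin ℝ φ halfPlane z)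
  mem_ball : ∀ z ∈ Ω, φ z ∈ unitBall n
  minimal : ∀ z ∈ Ω, meanCurvature φ halfPlane z = 0
  boundary : ∀ z ∈ Ω, z 0 = 0 → φ z ∈ unitSphere n
  orthogonal : ∀ z ∈ Ω, z 0 = 0 → ∃ v, fderivWithin ℝ φ halfPlane z v = φ z

/-- The coordinate vector `∂ᵢφ`. -/
noncomputable def coordVec (φ : Euc 2 → Euc n) (i : Fin 2) (z : Euc 2) : Euc n :=
  fderivWithin ℝ φ halfPlane z (bas i)

/-- The area density `√(det g)`. -/
noncomputable def areaDensity (φ : Euc 2 → Euc n) (z : Euc 2) : ℝ :=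
  parArea (coordVec φ 0 z) (coordVec φ 1 z)

/-- The vectors `√(det g) ∇zⁱ`. -/
noncomputable def coordConormal (φ : Euc 2 → Euc n) (i : Fin 2) (z : Euc 2) : Euc n :=
  conormal (coordVec φ i z) (coordVec φ (1 - i) z)

/-- The second differential. -/
noncomputable def secondDeriv (φ : Euc 2 → Euc n) (z : Euc 2) : Euc 2 →L[ℝ] Euc 2 →L[ℝ] Euc n :=
  fderivWithin ℝ (fderivWithin ℝ φ halfPlane) halfPlane z

theorem halfPlane_fderivWithin_unique {F : Type*} [NormedAddCommGroup F] [NormedSpace ℝ F]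
    {g h : Euc 2 → F} {g' h' : Euc 2 →L[ℝ] F} {z : Euc 2} (hz : z ∈ halfPlane)
    (hg : HasFDerivWithinAt g g' halfPlane z) (hh : HasFDerivWithinAt h h' halfPlane z)
    (heq : g =ᶠ[𝓝[halfPlane] z] h) : g' = h' :=
  (uniqueDiffOn_halfPlane z hz).eq hg (hh.congr_of_eventuallyEq heq (heq.eq_of_nhdsWithin hz))

theorem hasFDerivWithinAt_of_contDiffWithinAt {E F : Type*} [NormedAddCommGroup E]
    [NormedSpace ℝ E] [NormedAddCommGroup F] [NormedSpace ℝ F] {g : E → F} {s : Set E} {x : E}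
    (hg : ContDiffWithinAt ℝ ∞ g s x) : HasFDerivWithinAt g (fderivWithin ℝ g s x) s x :=
  (hg.differentiableWithinAt (by simp)).hasFDerivWithinAt

/-- The algebra behind `∑ ∂ᵢ(√(det g) ∇zⁱ) = √(det g) H`: here `P, Q` are the coordinate vectors,
`a, b, c` the second derivatives, `J = √(det g)` with derivatives `j₀, j₁`, and `N₀, N₁` the fields
`√(det g) ∇zⁱ`, with derivatives `A = ∂₀N₀` and `B = ∂₁N₁`. -/
theorem sum_eq_zero_of_frame {P Q N₀ N₁ A B a b c : Euc n} {J j₀ j₁ r₁ r₂ r₃ r₄ : ℝ}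
    (hJ : 0 < J)
    (i1 : inner ℝ N₀ a + inner ℝ A P = j₀) (i2 : inner ℝ N₀ b + inner ℝ A Q = 0)
    (i3 : inner ℝ N₁ c + inner ℝ B Q = j₁) (i4 : inner ℝ N₁ b + inner ℝ B P = 0)
    (n0 : J • N₀ = ‖Q‖ ^ 2 • P - (inner ℝ P Q : ℝ) • Q)
    (n1 : J • N₁ = ‖P‖ ^ 2 • Q - (inner ℝ P Q : ℝ) • P)
    (i6 : J • A + j₀ • N₀ = ‖Q‖ ^ 2 • a + r₁ • P - ((inner ℝ P Q : ℝ) • b + r₂ • Q))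
    (i7 : J • B + j₁ • N₁ = ‖P‖ ^ 2 • c + r₃ • Q - ((inner ℝ P Q : ℝ) • b + r₄ • P))
    (i50 : J * j₀ = ‖P‖ ^ 2 * inner ℝ b Q + ‖Q‖ ^ 2 * inner ℝ a P
      - inner ℝ P Q * (inner ℝ b P + inner ℝ a Q))
    (i51 : J * j₁ = ‖P‖ ^ 2 * inner ℝ c Q + ‖Q‖ ^ 2 * inner ℝ b P
      - inner ℝ P Q * (inner ℝ c P + inner ℝ b Q))
    (hm : ∀ w, inner ℝ w P = 0 → inner ℝ w Q = 0 → ‖Q‖ ^ 2 * inner ℝ a w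
      - 2 * inner ℝ P Q * inner ℝ b w + ‖P‖ ^ 2 * inner ℝ c w = 0) : A + B = 0 := by
  have m0 : ∀ v, J * inner ℝ N₀ v = ‖Q‖ ^ 2 * inner ℝ P v - inner ℝ P Q * inner ℝ Q v := fun v => by
    have := congrArg (fun w => inner ℝ w v) n0
    simpa [inner_sub_left, inner_smul_left] using this
  have m1 : ∀ v, J * inner ℝ N₁ v = ‖P‖ ^ 2 * inner ℝ Q v - inner ℝ P Q * inner ℝ P v := fun v => by
    have := congrArg (fun w => inner ℝ w v) n1
    simpa [inner_sub_left, inner_smul_left] using this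
  have comm : ∀ v w : Euc n, inner ℝ v w = inner ℝ w v := fun v w => real_inner_comm _ _
  have hP : inner ℝ (A + B) P = 0 := by
    have : J * inner ℝ (A + B) P = 0 := by
      rw [inner_add_left]
      have h1 := m0 a
      have h2 := m1 b
      rw [comm P a, comm Q a] at h1
      rw [comm P b, comm Q b] at h2
      linear_combination J * i1 + J * i4 + i50 - h1 - h2
    exact (mul_eq_zero.1 this).resolve_left hJ.ne'
  have hQ : inner ℝ (A + B) Q = 0 := by
    have : J * inner ℝ (A + B) Q = 0 := by
      rw [inner_add_left]
      have h1 := m0 b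
      have h2 := m1 c
      rw [comm P b, comm Q b] at h1
      rw [comm P c, comm Q c] at h2
      linear_combination J * i2 + J * i3 + i51 - h1 - h2
    exact (mul_eq_zero.1 this).resolve_left hJ.ne'
  have h0 := hm (A + B) hP hQ
  have h6 := congrArg (fun w => inner ℝ w (A + B)) i6
  have h7 := congrArg (fun w => inner ℝ w (A + B)) i7
  rw [comm] at hP hQ
  have z0 : inner ℝ N₀ (A + B) = 0 := by
    have := m0 (A + B)
    rw [hP, hQ] at this
    simpa [hJ.ne'] using this
  have z1 : inner ℝ N₁ (A + B) = 0 := by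
    have := m1 (A + B)
    rw [hP, hQ] at this
    simpa [hJ.ne'] using this
  simp only [inner_sub_left, inner_add_left, inner_smul_left, conj_trivial, hP, hQ, z0, z1,
    mul_zero, add_zero] at h6 h7
  have : J * inner ℝ (A + B) (A + B) = 0 := by
    rw [inner_add_left]
    linarith
  exact inner_self_eq_zero.1 ((mul_eq_zero.1 this).resolve_left hJ.ne')

namespace IsLocalSurface

variable {φ : Euc 2 → Euc n} {Ω : Set (Euc 2)} {z : Euc 2}

theorem areaDensity_pos (h : IsLocalSurface φ Ω) (hz : z ∈ Ω) : 0 < areaDensity φ z :=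
  parArea_pos_of_injective (h.injective z hz)

theorem contDiffWithinAt_fderivWithin (h : IsLocalSurface φ Ω) (hz : z ∈ Ω) :
    ContDiffWithinAt ℝ ∞ (fderivWithin ℝ φ halfPlane) halfPlane z :=
  (h.smooth z hz).fderivWithin_right uniqueDiffOn_halfPlane (by simp) (h.subset hz)

theorem contDiffWithinAt_coordVec (h : IsLocalSurface φ Ω) (hz : z ∈ Ω) (i : Fin 2) :
    ContDiffWithinAt ℝ ∞ (coordVec φ i) halfPlane z :=
  (h.contDiffWithinAt_fderivWithin hz).clm_apply contDiffWithinAt_const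

theorem hasFDerivWithinAt_coordVec (h : IsLocalSurface φ Ω) (hz : z ∈ Ω) (i : Fin 2) :
    HasFDerivWithinAt (coordVec φ i) ((secondDeriv φ z).flip (bas i)) halfPlane z :=
  hasFDerivWithinAt_apply_const
    (hasFDerivWithinAt_of_contDiffWithinAt (h.contDiffWithinAt_fderivWithin hz)) (bas i)

theorem secondDeriv_symm (h : IsLocalSurface φ Ω) (hz : z ∈ Ω) (v w : Euc 2) :
    secondDeriv φ z v w = secondDeriv φ z w v :=
  (h.smooth z hz).isSymmSndFDerivWithinAt minSmoothness_two_le uniqueDiffOn_halfPlane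
    (mem_closure_interior_halfPlane (h.subset hz)) (h.subset hz) v w

theorem contDiffWithinAt_areaDensity (h : IsLocalSurface φ Ω) (hz : z ∈ Ω) :
    ContDiffWithinAt ℝ ∞ (areaDensity φ) halfPlane z := by
  have h0 := h.contDiffWithinAt_coordVec hz 0
  have h1 := h.contDiffWithinAt_coordVec hz 1
  have hpos := h.areaDensity_pos hz
  refine ContDiffWithinAt.sqrt (((h0.norm_sq ℝ).mul (h1.norm_sq ℝ)).sub ((h0.inner ℝ h1).pow 2)) ?_
  exact (Real.sqrt_pos.1 hpos).ne'

theorem contDiffWithinAt_coordConormal (h : IsLocalSurface φ Ω) (hz : z ∈ Ω) (i : Fin 2) :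
    ContDiffWithinAt ℝ ∞ (coordConormal φ i) halfPlane z := by
  have h0 := h.contDiffWithinAt_coordVec hz i
  have h1 := h.contDiffWithinAt_coordVec hz (1 - i)
  have hJ : ContDiffWithinAt ℝ ∞ (fun z => parArea (coordVec φ i z) (coordVec φ (1 - i) z))
      halfPlane z := by
    have := h.contDiffWithinAt_areaDensity hz
    fin_cases i
    · exact this
    · simp only [parArea_comm (coordVec φ _ _) (coordVec φ (1 - _) _)]; exact this
  have hpos : parArea (coordVec φ i z) (coordVec φ (1 - i) z) ≠ 0 := by
    have := h.areaDensity_pos hz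
    fin_cases i
    · exact this.ne'
    · rw [parArea_comm]; exact this.ne'
  exact (hJ.inv hpos).smul (((h1.norm_sq ℝ).smul h0).sub ((h0.inner ℝ h1).smul h1))

/-- Vanishing mean curvature in coordinates: the inverse of the metric is expanded by Cramer's
rule. -/
theorem inner_minimal (h : IsLocalSurface φ Ω) (hz : z ∈ Ω) {w : Euc n}
    (hw0 : inner ℝ w (coordVec φ 0 z) = 0) (hw1 : inner ℝ w (coordVec φ 1 z) = 0) :
    ‖coordVec φ 1 z‖ ^ 2 * inner ℝ (secondDeriv φ z (bas 0) (bas 0)) w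
      - 2 * inner ℝ (coordVec φ 0 z) (coordVec φ 1 z) *
        inner ℝ (secondDeriv φ z (bas 0) (bas 1)) w
      + ‖coordVec φ 0 z‖ ^ 2 * inner ℝ (secondDeriv φ z (bas 1) (bas 1)) w = 0 := by
  have hJ := h.areaDensity_pos hz
  have hJ2 : areaDensity φ z ^ 2 = _ := parArea_sq _ _
  have hT : w ∈ (LinearMap.range (fderivWithin ℝ φ halfPlane z).toLinearMap)ᗮ := by
    rw [Submodule.mem_orthogonal']
    rintro _ ⟨v, rfl⟩
    rw [ContinuousLinearMap.coe_coe, coords_expand v, map_add, map_smul, map_smul, inner_add_right,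
      inner_smul_right, inner_smul_right]
    rw [show fderivWithin ℝ φ halfPlane z (bas 0) = coordVec φ 0 z from rfl,
      show fderivWithin ℝ φ halfPlane z (bas 1) = coordVec φ 1 z from rfl, hw0, hw1]
    ring
  have hII : ∀ i j, inner ℝ (secondFundamentalForm φ halfPlane z (bas i) (bas j)) w =
      inner ℝ (secondDeriv φ z (bas i) (bas j)) w := fun i j => by
    rw [secondFundamentalForm, Submodule.inner_starProjection_left_eq_right,
      Submodule.starProjection_eq_self_iff.2 hT]
    rfl
  have hdet : (inducedMetric φ halfPlane z).det = areaDensity φ z ^ 2 := by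
    rw [hJ2, Matrix.det_fin_two]
    simp only [inducedMetric, Matrix.of_apply]
    rw [show fderivWithin ℝ φ halfPlane z (bas 0) = coordVec φ 0 z from rfl,
      show fderivWithin ℝ φ halfPlane z (bas 1) = coordVec φ 1 z from rfl,
      real_inner_comm (coordVec φ 0 z) (coordVec φ 1 z), real_inner_self_eq_norm_sq,
      real_inner_self_eq_norm_sq]
    ring
  have hm := congrArg (fun v => inner ℝ v w) (h.minimal z hz)
  simp only [meanCurvature, Fin.sum_univ_two, inner_add_left, inner_smul_left, conj_trivial,
    inner_zero_left, hII] at hm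
  rw [Matrix.inv_def, hdet, Matrix.adjugate_fin_two] at hm
  simp only [Ring.inverse_eq_inv', Matrix.smul_apply, smul_eq_mul, inducedMetric, Matrix.of_apply,
    Matrix.cons_val_zero, Matrix.cons_val_one, Matrix.cons_val', Matrix.cons_val_fin_one] at hm
  rw [show fderivWithin ℝ φ halfPlane z (bas 0) = coordVec φ 0 z from rfl,
      show fderivWithin ℝ φ halfPlane z (bas 1) = coordVec φ 1 z from rfl,
      real_inner_comm (coordVec φ 0 z) (coordVec φ 1 z), real_inner_self_eq_norm_sq,
      real_inner_self_eq_norm_sq, h.secondDeriv_symm hz (bas 1) (bas 0)] at hm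
  field_simp at hm
  linarith

/-- On a minimal surface the coordinate vector fields `√(det g) ∇zⁱ`, as fields in `ℝⁿ`, satisfy
`∑ ∂ᵢ(√(det g) ∇zⁱ) = √(det g) Δφ = 0`. -/
theorem sum_deriv_coordConormal (h : IsLocalSurface φ Ω) (hz : z ∈ Ω) :
    fderivWithin ℝ (coordConormal φ 0) halfPlane z (bas 0) +
      fderivWithin ℝ (coordConormal φ 1) halfPlane z (bas 1) = 0 := by
  have hzH := h.subset hz
  have hJ := h.areaDensity_pos hz
  have dP := h.hasFDerivWithinAt_coordVec hz 0
  have dQ := h.hasFDerivWithinAt_coordVec hz 1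
  have dN0 := hasFDerivWithinAt_of_contDiffWithinAt (h.contDiffWithinAt_coordConormal hz 0)
  have dN1 := hasFDerivWithinAt_of_contDiffWithinAt (h.contDiffWithinAt_coordConormal hz 1)
  have dJ := hasFDerivWithinAt_of_contDiffWithinAt (h.contDiffWithinAt_areaDensity hz)
  have hsym := h.secondDeriv_symm hz (bas 1) (bas 0)
  have hΩ : ∀ {p : Euc 2 → Prop}, (∀ y ∈ Ω, p y) → ∀ᶠ y in 𝓝[halfPlane] z, p y :=
    fun hp => mem_of_superset (h.mem_nhds z hz) hp
  have hJc : ∀ y, parArea (coordVec φ 1 y) (coordVec φ 0 y) = areaDensity φ y := fun y =>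
    parArea_comm _ _
  -- The defining relations of the fields `Nᵢ` and of `J`, differentiated.
  have i1 := congrArg (fun L : Euc 2 →L[ℝ] ℝ => L (bas 0)) <|
    halfPlane_fderivWithin_unique hzH (dN0.inner ℝ dP) dJ
      (hΩ fun y hy => inner_conormal_left (h.areaDensity_pos hy))
  have i2 := congrArg (fun L : Euc 2 →L[ℝ] ℝ => L (bas 0)) <|
    halfPlane_fderivWithin_unique hzH (dN0.inner ℝ dQ) (hasFDerivWithinAt_const 0 z halfPlane)
      (hΩ fun y hy => inner_conormal_right _ _)
  have i3 := congrArg (fun L : Euc 2 →L[ℝ] ℝ => L (bas 1)) <|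
    halfPlane_fderivWithin_unique hzH (dN1.inner ℝ dQ) dJ
      (hΩ fun y hy => (inner_conormal_left ((hJc y).symm ▸ h.areaDensity_pos hy)).trans (hJc y))
  have i4 := congrArg (fun L : Euc 2 →L[ℝ] ℝ => L (bas 1)) <|
    halfPlane_fderivWithin_unique hzH (dN1.inner ℝ dP) (hasFDerivWithinAt_const 0 z halfPlane)
      (hΩ fun y hy => inner_conormal_right _ _)
  have i5 := halfPlane_fderivWithin_unique hzH (dJ.mul dJ)
    (((dP.inner ℝ dP).mul (dQ.inner ℝ dQ)).sub ((dP.inner ℝ dQ).mul (dP.inner ℝ dQ)))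
    (hΩ fun y hy => by
      have : areaDensity φ y ^ 2 = _ := parArea_sq _ _
      simp only [Pi.mul_apply, Pi.sub_apply, real_inner_self_eq_norm_sq]
      rw [← sq, this]; ring)
  have i6 := congrArg (fun L : Euc 2 →L[ℝ] Euc n => L (bas 0)) <|
    halfPlane_fderivWithin_unique hzH (dJ.smul dN0)
      (((dQ.inner ℝ dQ).smul dP).sub ((dP.inner ℝ dQ).smul dQ))
    (hΩ fun y hy => by
      have : areaDensity φ y • coordConormal φ 0 y = _ :=
        parArea_smul_conormal (h.areaDensity_pos hy)
      simp only [Pi.smul_apply', Pi.sub_apply, real_inner_self_eq_norm_sq]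
      exact this)
  have i7 := congrArg (fun L : Euc 2 →L[ℝ] Euc n => L (bas 1)) <|
    halfPlane_fderivWithin_unique hzH (dJ.smul dN1)
      (((dP.inner ℝ dP).smul dQ).sub ((dP.inner ℝ dQ).smul dP))
    (hΩ fun y hy => by
      have : parArea (coordVec φ 1 y) (coordVec φ 0 y) • coordConormal φ 1 y = _ :=
        parArea_smul_conormal ((hJc y).symm ▸ h.areaDensity_pos hy)
      rw [hJc, real_inner_comm (coordVec φ 0 y)] at this
      simp only [Pi.smul_apply', Pi.sub_apply, real_inner_self_eq_norm_sq]
      exact this)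
  have i50 := congrArg (fun L : Euc 2 →L[ℝ] ℝ => L (bas 0)) i5
  have i51 := congrArg (fun L : Euc 2 →L[ℝ] ℝ => L (bas 1)) i5
  have n0 : areaDensity φ z • coordConormal φ 0 z = _ :=
    parArea_smul_conormal (h.areaDensity_pos hz)
  have n1 : parArea (coordVec φ 1 z) (coordVec φ 0 z) • coordConormal φ 1 z = _ :=
    parArea_smul_conormal ((hJc z).symm ▸ hJ)
  rw [hJc, real_inner_comm (coordVec φ 0 z)] at n1
  simp at i1 i2 i3 i4 i6 i7 i50 i51
  rw [hsym] at i4 i7 i51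
  have comm : ∀ v w : Euc n, inner ℝ v w = inner ℝ w v := fun v w => real_inner_comm _ _
  refine sum_eq_zero_of_frame hJ i1 i2 i3 i4 n0 n1 i6 i7 ?_ ?_ fun w hw0 hw1 => ?_
  · rw [comm (coordVec φ 1 z) (secondDeriv φ z (bas 0) (bas 1)),
      comm (coordVec φ 0 z) (secondDeriv φ z (bas 0) (bas 1)),
      comm (coordVec φ 0 z) (secondDeriv φ z (bas 0) (bas 0))] at i50
    linarith
  · rw [comm (coordVec φ 1 z) (secondDeriv φ z (bas 1) (bas 1)),
      comm (coordVec φ 0 z) (secondDeriv φ z (bas 0) (bas 1)),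
      comm (coordVec φ 0 z) (secondDeriv φ z (bas 1) (bas 1))] at i51
    linarith
  · have := h.inner_minimal hz hw0 hw1
    linarith

end IsLocalSurface

end

/-! ### The first variation formula in coordinates -/

section

variable {n : ℕ}

/-- The integrand `√(det g) div_S X` of the first variation in coordinates. -/
noncomputable def coordDiv (φ : Euc 2 → Euc n) (X : Euc n → Euc n) (z : Euc 2) : ℝ :=
  inner ℝ (coordConormal φ 0 z) (fderiv ℝ X (φ z) (coordVec φ 0 z)) +
    inner ℝ (coordConormal φ 1 z) (fderiv ℝ X (φ z) (coordVec φ 1 z))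

/-- The inner product of `√(det g) ∇η` and `X` in coordinates. -/
noncomputable def coordGrad (φ : Euc 2 → Euc n) (η : Euc 2 → ℝ) (X : Euc n → Euc n) (z : Euc 2) :
    ℝ :=
  fderivWithin ℝ η halfPlane z (bas 0) * inner ℝ (X (φ z)) (coordConormal φ 0 z) +
    fderivWithin ℝ η halfPlane z (bas 1) * inner ℝ (X (φ z)) (coordConormal φ 1 z)

theorem planePt_zero_mem_halfPlane (t : ℝ) : planePt (0, t) ∈ halfPlane := by simp [halfPlane]

theorem hasDerivAt_boundaryCurve {F : Type*} [NormedAddCommGroup F] [NormedSpace ℝ F]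
    {φ : Euc 2 → F} {t : ℝ} {φ' : Euc 2 →L[ℝ] F}
    (h : HasFDerivWithinAt φ φ' halfPlane (planePt (0, t))) :
    HasDerivAt (fun t => φ (planePt (0, t))) (φ' (bas 1)) t := by
  have h1 : HasDerivAt (fun t : ℝ => planePt (0, t)) (bas 1) t := by
    simpa [planePt] using (hasDerivAt_id t).smul_const (bas 1)
  exact hasDerivWithinAt_univ.1 <| h.comp_hasDerivWithinAt t (h1.hasDerivWithinAt (s := univ))
    fun t _ => planePt_zero_mem_halfPlane t

theorem integrableOn_halfPlane_of_eq_zero {g : Euc 2 → ℝ} {K : Set (Euc 2)} (hK : IsCompact K)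
    (hg : ContinuousOn g K) (h0 : ∀ z ∈ halfPlane, z ∉ K → g z = 0) : IntegrableOn g halfPlane :=
  (hg.integrableOn_compact hK).of_forall_sdiff_eq_zero isClosed_halfPlane.measurableSet
    fun z hz => h0 z hz.1 hz.2

namespace IsLocalSurface

variable {φ : Euc 2 → Euc n} {Ω : Set (Euc 2)} {z : Euc 2}

theorem hasFDerivWithinAt (h : IsLocalSurface φ Ω) (hz : z ∈ Ω) :
    HasFDerivWithinAt φ (fderivWithin ℝ φ halfPlane z) halfPlane z :=
  hasFDerivWithinAt_of_contDiffWithinAt (h.smooth z hz)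

/-- Along its boundary the surface leaves the ball orthogonally: the outer conormal is the position
vector. -/
theorem coordConormal_of_boundary (h : IsLocalSurface φ Ω) (hz : z ∈ Ω) (h0 : z 0 = 0) :
    coordConormal φ 0 z = -‖coordVec φ 1 z‖ • φ z := by
  have hx : ‖φ z‖ = 1 := by simpa using h.boundary z hz h0
  have hmax : IsLocalMaxOn (fun y => ‖φ y‖ ^ 2) halfPlane z := by
    filter_upwards [h.mem_nhds z hz] with y hy
    have := h.mem_ball y hy
    rw [mem_closedBall_zero_iff] at this
    rw [hx]
    exact pow_le_pow_left₀ (norm_nonneg _) this 2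
  have hd := (h.hasFDerivWithinAt hz).norm_sq
  have hzH := h.subset hz
  have cone : ∀ v : Euc 2, 0 ≤ v 0 → v ∈ posTangentConeAt halfPlane z := fun v hv => by
    refine mem_posTangentConeAt_of_segment_subset (convex_halfPlane.segment_subset hzH ?_)
    show 0 ≤ z 0 + v 0
    rw [h0]; simpa
  have hQ : inner ℝ (φ z) (coordVec φ 1 z) = 0 := by
    have := hmax.hasFDerivWithinAt_eq_zero hd (cone (bas 1) (by simp)) (cone (-bas 1) (by simp))
    simpa [coordVec] using this
  have hP : inner ℝ (φ z) (coordVec φ 0 z) ≤ 0 := by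
    have := hmax.hasFDerivWithinAt_nonpos hd (cone (bas 0) (by simp))
    simp only [smul_apply, ContinuousLinearMap.comp_apply, innerSL_apply_apply]
      at this
    change 2 • inner ℝ (φ z) (coordVec φ 0 z) ≤ 0 at this
    rw [two_nsmul] at this
    linarith
  obtain ⟨v, hv⟩ := h.orthogonal z hz h0
  rw [coords_expand v, map_add, map_smul, map_smul] at hv
  change v 0 • coordVec φ 0 z + v 1 • coordVec φ 1 z = φ z at hv
  have hJ : 0 < parArea (coordVec φ 0 z) (coordVec φ 1 z) := h.areaDensity_pos hz
  have hn2 := norm_sq_conormal hJ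
  have hNP := inner_conormal_left hJ
  have hNQ := inner_conormal_right (coordVec φ 0 z) (coordVec φ 1 z)
  have hJN := parArea_smul_conormal hJ
  change coordConormal φ 0 z = _
  change ‖coordConormal φ 0 z‖ ^ 2 = _ at hn2
  change inner ℝ (coordConormal φ 0 z) _ = _ at hNP
  change inner ℝ (coordConormal φ 0 z) _ = _ at hNQ
  change _ • coordConormal φ 0 z = _ at hJN
  generalize coordConormal φ 0 z = N at *
  generalize coordVec φ 0 z = P at *
  generalize coordVec φ 1 z = Q at *
  generalize φ z = x at *
  generalize parArea P Q = J at *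
  have hvx : v 0 * inner ℝ x P = 1 := by
    have := congrArg (fun w => inner ℝ x w) hv
    simpa [inner_add_right, inner_smul_right, hQ, hx] using this
  have hv0 : v 0 < 0 := by
    by_contra! hcon
    nlinarith [mul_nonneg hcon (neg_nonneg.2 hP)]
  have hNx : inner ℝ N x = v 0 * J := by
    rw [← hv, inner_add_right, inner_smul_right, inner_smul_right, hNP, hNQ]; ring
  -- The difference `w` is tangent and orthogonal to both `x` and `Q`, which span the tangent plane.
  have hw : N - inner ℝ N x • x = 0 := by
    set w := N - inner ℝ N x • x with hwdef
    have wx : inner ℝ w x = 0 := by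
      rw [hwdef, inner_sub_left, inner_smul_left, real_inner_self_eq_norm_sq, hx]; simp
    have wQ : inner ℝ w Q = 0 := by
      rw [hwdef, inner_sub_left, inner_smul_left, hNQ, hQ]; simp
    have wP : inner ℝ w P = 0 := by
      rw [← hv, inner_add_right, inner_smul_right, inner_smul_right, wQ] at wx
      have := mul_eq_zero.1 (by linarith : v 0 * inner ℝ w P = 0)
      exact this.resolve_left hv0.ne
    have wN : inner ℝ w N = 0 := by
      have := congrArg (fun y => inner ℝ w y) hJN
      simp only [inner_smul_right, inner_sub_right, wP, wQ, mul_zero, sub_zero] at this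
      exact (mul_eq_zero.1 this).resolve_left hJ.ne'
    have : inner ℝ w w = 0 := by
      nth_rw 2 [hwdef]
      rw [inner_sub_right, inner_smul_right, wN, wx]; simp
    exact inner_self_eq_zero.1 this
  have hN : N = inner ℝ N x • x := sub_eq_zero.1 hw
  have hsq : (inner ℝ N x : ℝ) ^ 2 = ‖Q‖ ^ 2 := by
    rw [← hn2, hN, norm_smul, hx, ← hN, mul_one, Real.norm_eq_abs, sq_abs]
  have hneg : inner ℝ N x = -‖Q‖ := by
    rw [hNx] at hsq ⊢
    have h2 : ‖Q‖ = -(v 0 * J) := by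
      rw [← sq_eq_sq₀ (norm_nonneg _) (by nlinarith), ← hsq]; ring
    linarith
  rw [hN, hneg]

theorem contDiffWithinAt_comp (h : IsLocalSurface φ Ω) (hz : z ∈ Ω) {F : Type*}
    [NormedAddCommGroup F] [NormedSpace ℝ F] {X : Euc n → F}
    (hX : ContDiff ℝ ∞ X) : ContDiffWithinAt ℝ ∞ (fun z => X (φ z)) halfPlane z :=
  hX.contDiffAt.comp_contDiffWithinAt z (h.smooth z hz)

theorem continuousWithinAt_coordDiv (h : IsLocalSurface φ Ω) (hz : z ∈ Ω) {X : Euc n → Euc n}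
    (hX : ContDiff ℝ ∞ X) : ContinuousWithinAt (coordDiv φ X) halfPlane z := by
  have hDX : ContDiff ℝ ∞ (fderiv ℝ X) := hX.fderiv_right (by simp)
  have hD := (h.contDiffWithinAt_comp hz hDX).continuousWithinAt
  have hN := fun i => (h.contDiffWithinAt_coordConormal hz i).continuousWithinAt
  have hP := fun i => (h.contDiffWithinAt_coordVec hz i).continuousWithinAt
  exact ((hN 0).inner (𝕜 := ℝ) (hD.clm_apply (hP 0))).add
    ((hN 1).inner (𝕜 := ℝ) (hD.clm_apply (hP 1)))

theorem continuousWithinAt_coordGrad (h : IsLocalSurface φ Ω) (hz : z ∈ Ω) {X : Euc n → Euc n}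
    (hX : ContDiff ℝ ∞ X) {η : Euc 2 → ℝ} (hη : ContDiffWithinAt ℝ ∞ η halfPlane z) :
    ContinuousWithinAt (coordGrad φ η X) halfPlane z := by
  have hX' := (h.contDiffWithinAt_comp hz hX).continuousWithinAt
  have hN := fun i => (h.contDiffWithinAt_coordConormal hz i).continuousWithinAt
  have hη' : ContDiffWithinAt ℝ ∞ (fderivWithin ℝ η halfPlane) halfPlane z :=
    hη.fderivWithin_right uniqueDiffOn_halfPlane (by simp) (h.subset hz)
  have hd := fun i : Fin 2 =>
    (hη'.clm_apply (contDiffWithinAt_const (c := bas i))).continuousWithinAt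
  exact ((hd 0).mul (hX'.inner (𝕜 := ℝ) (hN 0))).add ((hd 1).mul (hX'.inner (𝕜 := ℝ) (hN 1)))

end IsLocalSurface

theorem fderivWithin_eq_zero_of_eq_zero_off {η : Euc 2 → ℝ} {K : Set (Euc 2)} (hK : IsCompact K)
    (hη0 : ∀ z ∈ halfPlane, z ∉ K → η z = 0) {z : Euc 2} (hz : z ∈ halfPlane) (hzK : z ∉ K) :
    fderivWithin ℝ η halfPlane z = 0 := by
  have : η =ᶠ[𝓝[halfPlane] z] fun _ => 0 := by
    filter_upwards [self_mem_nhdsWithin, mem_nhdsWithin_of_mem_nhds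
      (hK.isClosed.isOpen_compl.mem_nhds hzK)] with y hy hyK using hη0 y hy hyK
  rw [this.fderivWithin_eq (hη0 z hz hzK)]
  simp

namespace IsLocalSurface

variable {φ : Euc 2 → Euc n} {Ω : Set (Euc 2)} {z : Euc 2}

theorem integrableOn_coordDiv (h : IsLocalSurface φ Ω) {X : Euc n → Euc n} (hX : ContDiff ℝ ∞ X)
    {η : Euc 2 → ℝ} {K : Set (Euc 2)} (hK : IsCompact K) (hKΩ : K ⊆ Ω)
    (hη : ∀ z ∈ Ω, ContDiffWithinAt ℝ ∞ η halfPlane z)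
    (hη0 : ∀ z ∈ halfPlane, z ∉ K → η z = 0) :
    IntegrableOn (fun z => η z * coordDiv φ X z) halfPlane :=
  integrableOn_halfPlane_of_eq_zero hK
    (fun z hz => ((hη z (hKΩ hz)).continuousWithinAt.mul
      (h.continuousWithinAt_coordDiv (hKΩ hz) hX)).mono (hKΩ.trans h.subset))
    fun z hz hzK => by simp [hη0 z hz hzK]

theorem integrableOn_coordGrad (h : IsLocalSurface φ Ω) {X : Euc n → Euc n} (hX : ContDiff ℝ ∞ X)
    {η : Euc 2 → ℝ} {K : Set (Euc 2)} (hK : IsCompact K) (hKΩ : K ⊆ Ω)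
    (hη : ∀ z ∈ Ω, ContDiffWithinAt ℝ ∞ η halfPlane z)
    (hη0 : ∀ z ∈ halfPlane, z ∉ K → η z = 0) :
    IntegrableOn (coordGrad φ η X) halfPlane :=
  integrableOn_halfPlane_of_eq_zero hK
    (fun z hz => (h.continuousWithinAt_coordGrad (hKΩ hz) hX (hη z (hKΩ hz))).mono
      (hKΩ.trans h.subset))
    fun z hz hzK => by simp [coordGrad, fderivWithin_eq_zero_of_eq_zero_off hK hη0 hz hzK]

/-- The first variation formula of a free boundary minimal surface, localized by a cutoff
function `η`. -/
theorem integral_coordDiv_add_coordGrad (h : IsLocalSurface φ Ω) {X : Euc n → Euc n}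
    (hX : ContDiff ℝ ∞ X) {η : Euc 2 → ℝ} {K : Set (Euc 2)} (hK : IsCompact K) (hKΩ : K ⊆ Ω)
    (hη : ∀ z ∈ Ω, ContDiffWithinAt ℝ ∞ η halfPlane z)
    (hη0 : ∀ z ∈ halfPlane, z ∉ K → η z = 0) :
    (∫ z in halfPlane, η z * coordDiv φ X z) + ∫ z in halfPlane, coordGrad φ η X z =
      ∫ t, η (planePt (0, t)) * inner ℝ (X (φ (planePt (0, t)))) (φ (planePt (0, t))) *
        ‖coordVec φ 1 (planePt (0, t))‖ := by
  classical
  -- The fields are cut off outside the half-plane as well, where `η` is arbitrary.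
  set w : Fin 2 → Euc 2 → ℝ := fun i =>
    K.indicator fun z => η z * inner ℝ (X (φ z)) (coordConormal φ i z) with hw
  have hwH : ∀ i, ∀ z ∈ halfPlane, w i z = η z * inner ℝ (X (φ z)) (coordConormal φ i z) :=
    fun i z hz => by
      by_cases hzK : z ∈ K
      · simp [hw, hzK]
      · simp [hw, hzK, hη0 z hz hzK]
  have hsmooth : ∀ i, ∀ z ∈ Ω, ContDiffWithinAt ℝ ∞
      (fun z => η z * inner ℝ (X (φ z)) (coordConormal φ i z)) halfPlane z := fun i z hz =>
    (hη z hz).mul ((h.contDiffWithinAt_comp hz hX).inner ℝ (h.contDiffWithinAt_coordConormal hz i))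
  have hev : ∀ i, ∀ z ∈ halfPlane, w i =ᶠ[𝓝[halfPlane] z]
      fun z => η z * inner ℝ (X (φ z)) (coordConormal φ i z) := fun i z hz =>
    mem_of_superset self_mem_nhdsWithin fun y hy => hwH i y hy
  have hoff : ∀ z ∈ halfPlane, z ∉ K → ∀ i, w i =ᶠ[𝓝[halfPlane] z] fun _ => 0 :=
    fun z hz hzK i => by
      filter_upwards [mem_nhdsWithin_of_mem_nhds
        (hK.isClosed.isOpen_compl.mem_nhds hzK)] with y hy
      exact indicator_of_notMem hy _
  have hcont : ∀ i, ContinuousOn (w i) halfPlane := fun i z hz => by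
    by_cases hzK : z ∈ K
    · exact (hsmooth i z (hKΩ hzK)).continuousWithinAt.congr_of_eventuallyEq (hev i z hz)
        (hwH i z hz)
    · exact continuousWithinAt_const.congr_of_eventuallyEq (hoff z hz hzK i)
        (indicator_of_notMem hzK _)
  have hdiff : ∀ i, ∀ z, 0 < z 0 → HasFDerivAt (w i) (fderivWithin ℝ (w i) halfPlane z) z :=
    fun i z hz => by
      have hzH : z ∈ halfPlane := le_of_lt hz
      refine HasFDerivWithinAt.hasFDerivAt ?_ (halfPlane_mem_nhds hz)
      refine DifferentiableWithinAt.hasFDerivWithinAt ?_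
      by_cases hzK : z ∈ K
      · exact ((hsmooth i z (hKΩ hzK)).differentiableWithinAt (by simp)).congr_of_eventuallyEq
          (hev i z hzH) (hwH i z hzH)
      · exact (differentiableWithinAt_const _).congr_of_eventuallyEq (hoff z hzH hzK i)
          (indicator_of_notMem hzK _)
  have hint1 := h.integrableOn_coordDiv hX hK hKΩ hη hη0
  have hint2 := h.integrableOn_coordGrad hX hK hKΩ hη hη0
  have hdiv : ∀ z ∈ halfPlane, fderivWithin ℝ (w 0) halfPlane z (bas 0) +
      fderivWithin ℝ (w 1) halfPlane z (bas 1) = η z * coordDiv φ X z + coordGrad φ η X z :=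
    fun z hz => by
      by_cases hzK : z ∈ K
      · have hzΩ := hKΩ hzK
        have hXd : HasFDerivWithinAt (fun z => X (φ z))
            (fderiv ℝ X (φ z) ∘L fderivWithin ℝ φ halfPlane z) halfPlane z :=
          ((hX.differentiable (by simp)) (φ z)).hasFDerivAt.comp_hasFDerivWithinAt z
            (h.hasFDerivWithinAt hzΩ)
        have key : ∀ i, fderivWithin ℝ (w i) halfPlane z (bas i) =
            η z * inner ℝ (coordConormal φ i z) (fderiv ℝ X (φ z) (coordVec φ i z)) +
            fderivWithin ℝ η halfPlane z (bas i) * inner ℝ (X (φ z)) (coordConormal φ i z) +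
            η z * inner ℝ (X (φ z))
              (fderivWithin ℝ (coordConormal φ i) halfPlane z (bas i)) := fun i => by
          have hd := (hasFDerivWithinAt_of_contDiffWithinAt (hη z hzΩ)).mul (hXd.inner ℝ
            (hasFDerivWithinAt_of_contDiffWithinAt (h.contDiffWithinAt_coordConormal hzΩ i)))
          have hd' := hd.congr_of_eventuallyEq (hev i z hz) (hwH i z hz)
          rw [hd'.fderivWithin (uniqueDiffOn_halfPlane z hz)]
          simp only [add_apply, smul_apply, smul_eq_mul,
            ContinuousLinearMap.comp_apply, ContinuousLinearMap.prod_apply, fderivInnerCLM_apply]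
          rw [real_inner_comm (coordConormal φ i z)]
          simp only [coordVec]
          ring
        have hmin := h.sum_deriv_coordConormal hzΩ
        have hmin' := congrArg (fun v => inner ℝ (X (φ z)) v) hmin
        simp only [inner_add_right, inner_zero_right] at hmin'
        rw [key, key, coordDiv, coordGrad]
        linear_combination η z * hmin'
      · rw [(hoff z hz hzK 0).fderivWithin_eq (indicator_of_notMem hzK _),
          (hoff z hz hzK 1).fderivWithin_eq (indicator_of_notMem hzK _), coordGrad,
          fderivWithin_eq_zero_of_eq_zero_off hK hη0 hz hzK, hη0 z hz hzK]
        simp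
  rw [← integral_add hint1 hint2]
  rw [integral_divergence_halfPlane hK (fun z hz => indicator_of_notMem hz _)
    (fun z hz => indicator_of_notMem hz _)
    (fun z hz hzK => by simp [hη0 z hz hzK, coordGrad,
      fderivWithin_eq_zero_of_eq_zero_off hK hη0 hz hzK]) (hcont 0) (hcont 1) (hdiff 0) (hdiff 1)
    (fun z hz => hdiv z (le_of_lt hz)) (hint1.add hint2), ← integral_neg]
  refine integral_congr_ae (Eventually.of_forall fun t => ?_)
  have hpt := planePt_zero_mem_halfPlane t
  by_cases hzK : planePt (0, t) ∈ K
  · change -w 0 (planePt (0, t)) = _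
    rw [hwH 0 _ hpt, h.coordConormal_of_boundary (hKΩ hzK) (by simp), inner_smul_right]
    ring
  · simp [hzK, hη0 _ hpt hzK]

end IsLocalSurface

end

/-! ### Charts of a surface with boundary -/

section

variable {n : ℕ} {M : Type*} [TopologicalSpace M] [ChartedSpace (EuclideanHalfSpace 2) M]

/-- The map `g` on the surface in the chart at `c`. -/
noncomputable abbrev inChart {F : Type*} (g : M → F) (c : M) : Euc 2 → F :=
  g ∘ (extChartAt (𝓡∂ 2) c).symm

/-- The image of the chart at `c`, a relatively open subset of the half-plane. -/
noncomputable abbrev chartDomain (c : M) : Set (Euc 2) := (extChartAt (𝓡∂ 2) c).target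

theorem range_modelWithCorners : range (𝓡∂ 2) = halfPlane :=
  range_modelWithCornersEuclideanHalfSpace 2

theorem chartDomain_subset (c : M) : chartDomain c ⊆ halfPlane :=
  range_modelWithCorners ▸ extChartAt_target_subset_range c

theorem chartDomain_mem_nhds {c : M} {z : Euc 2} (hz : z ∈ chartDomain c) :
    chartDomain c ∈ 𝓝[halfPlane] z :=
  range_modelWithCorners ▸ extChartAt_target_mem_nhdsWithin_of_mem hz

theorem interior_halfPlane : interior halfPlane = {z | 0 < z 0} := by
  rw [← closure_sdiff_frontier, isClosed_halfPlane.closure_eq, ← range_modelWithCorners,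
    frontier_range_modelWithCornersEuclideanHalfSpace, range_modelWithCorners]
  ext z
  exact ⟨fun h => lt_of_le_of_ne h.1 h.2, fun h => ⟨(le_of_lt h : (0 : ℝ) ≤ z 0), ne_of_lt h⟩⟩

theorem isEmpty_of_le_one {u : M → Euc n} (hu : IsFreeBoundaryMinimalSurface u) (hn : n ≤ 1) :
    IsEmpty M := by
  refine ⟨fun p => ?_⟩
  let L : Euc 2 →ₗ[ℝ] Euc n := (mfderiv (𝓡∂ 2) 𝓘(ℝ, Euc n) u p).toLinearMap
  have h := LinearMap.finrank_le_finrank_of_injective (f := L) (hu.immersion p)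
  rw [finrank_euclideanSpace_fin, finrank_euclideanSpace_fin] at h
  omega

variable [IsManifold (𝓡∂ 2) ∞ M]

theorem mem_boundary_iff {c : M} {z : Euc 2} (hz : z ∈ chartDomain c) :
    (extChartAt (𝓡∂ 2) c).symm z ∈ (𝓡∂ 2).boundary M ↔ z 0 = 0 := by
  have hs : (extChartAt (𝓡∂ 2) c).symm z ∈ (chartAt (EuclideanHalfSpace 2) c).source := by
    rw [← extChartAt_source (𝓡∂ 2)]
    exact (extChartAt (𝓡∂ 2) c).map_target hz
  have h := ModelWithCorners.isInteriorPoint_iff_of_mem_atlas (I := 𝓡∂ 2) (n := ∞) (by simp)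
    (chart_mem_atlas (EuclideanHalfSpace 2) c) hs
  change _ ↔ extChartAt (𝓡∂ 2) c _ ∈ interior (extChartAt (𝓡∂ 2) c).target at h
  rw [(extChartAt (𝓡∂ 2) c).right_inv hz] at h
  rw [show (extChartAt (𝓡∂ 2) c).symm z ∈ (𝓡∂ 2).boundary M ↔
    (𝓡∂ 2).IsBoundaryPoint ((extChartAt (𝓡∂ 2) c).symm z) from Iff.rfl,
    ModelWithCorners.isBoundaryPoint_iff_not_isInteriorPoint, h]
  have hz0 : 0 ≤ z 0 := chartDomain_subset c hz
  refine ⟨fun hn => ?_, fun h0 hi => ?_⟩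
  · refine le_antisymm (not_lt.1 fun hpos => hn ?_) hz0
    rw [mem_interior_iff_mem_nhds]
    have := chartDomain_mem_nhds hz
    rwa [nhdsWithin_eq_nhds.2 (halfPlane_mem_nhds hpos)] at this
  · have := interior_mono (chartDomain_subset c) hi
    rw [interior_halfPlane] at this
    exact (ne_of_gt this) h0

section

variable {F : Type*} [NormedAddCommGroup F] [NormedSpace ℝ F]

theorem contDiffWithinAt_inChart {g : M → F} (hg : ContMDiff (𝓡∂ 2) 𝓘(ℝ, F) ∞ g) {c : M}
    {z : Euc 2} (hz : z ∈ chartDomain c) : ContDiffWithinAt ℝ ∞ (inChart g c) halfPlane z := by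
  have h1 : ContMDiffWithinAt 𝓘(ℝ, Euc 2) (𝓡∂ 2) ∞ (extChartAt (𝓡∂ 2) c).symm (chartDomain c) z :=
    contMDiffOn_extChartAt_symm c z hz
  have h2 : ContDiffWithinAt ℝ ∞ (inChart g c) (chartDomain c) z :=
    contMDiffWithinAt_iff_contDiffWithinAt.1 (hg.contMDiffAt.comp_contMDiffWithinAt z h1)
  exact h2.mono_of_mem_nhdsWithin (chartDomain_mem_nhds hz)

/-- The differential of a function on the surface, as a map on the model space. -/
noncomputable def surfaceDeriv (g : M → F) (p : M) : Euc 2 →L[ℝ] F :=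
  mfderiv (𝓡∂ 2) 𝓘(ℝ, F) g p

/-- The differential of the inverse of the chart at `c`. -/
noncomputable def chartFrame (c : M) (z : Euc 2) : Euc 2 →L[ℝ] Euc 2 :=
  mfderivWithin 𝓘(ℝ, Euc 2) (𝓡∂ 2) (extChartAt (𝓡∂ 2) c).symm (range (𝓡∂ 2)) z

theorem bijective_chartFrame {c : M} {z : Euc 2} (hz : z ∈ chartDomain c) :
    Function.Bijective (chartFrame c z) := by
  have : IsManifold (𝓡∂ 2) 1 M := IsManifold.of_le (n := ∞) (by simp)
  obtain ⟨B, hB⟩ := isInvertible_mfderivWithin_extChartAt_symm (I := 𝓡∂ 2) hz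
  rw [chartFrame, ← hB]
  exact B.bijective

theorem fderivWithin_inChart {g : M → F} (hg : ContMDiff (𝓡∂ 2) 𝓘(ℝ, F) ∞ g) {c : M}
    {z : Euc 2} (hz : z ∈ chartDomain c) (v : Euc 2) :
    fderivWithin ℝ (inChart g c) halfPlane z v =
      surfaceDeriv g ((extChartAt (𝓡∂ 2) c).symm z) (chartFrame c z v) := by
  have h1 : MDifferentiableWithinAt 𝓘(ℝ, Euc 2) (𝓡∂ 2) (extChartAt (𝓡∂ 2) c).symm
      (range (𝓡∂ 2)) z :=
    (((contMDiffOn_extChartAt_symm (n := ∞) c z hz).mdifferentiableWithinAt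
      (by simp)).mono_of_mem_nhdsWithin (extChartAt_target_mem_nhdsWithin_of_mem hz))
  have h2 := mfderiv_comp_mfderivWithin (I'' := 𝓘(ℝ, F)) (g := g) z
    (hg.contMDiffAt.mdifferentiableAt (by simp)) h1
    (uniqueMDiffWithinAt_iff_uniqueDiffWithinAt.2
      ((𝓡∂ 2).uniqueDiffOn z (extChartAt_target_subset_range c hz)))
  rw [mfderivWithin_eq_fderivWithin] at h2
  rw [← range_modelWithCorners]
  exact congrArg (fun L : Euc 2 →L[ℝ] F => L v) h2

end

theorem IsFreeBoundaryMinimalSurface.isLocalSurface {u : M → Euc n}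
    (hu : IsFreeBoundaryMinimalSurface u) (c : M) :
    IsLocalSurface (inChart u c) (chartDomain c) where
  subset := chartDomain_subset c
  mem_nhds _ hz := chartDomain_mem_nhds hz
  smooth _ hz := contDiffWithinAt_inChart hu.smooth hz
  injective z hz := by
    rw [show ⇑(fderivWithin ℝ (inChart u c) halfPlane z) = _ from
      funext (fderivWithin_inChart hu.smooth hz)]
    exact (hu.immersion _).comp (bijective_chartFrame hz).1
  mem_ball _ _ := hu.mem_ball _
  minimal z hz := range_modelWithCorners ▸ hu.minimal c z hz
  boundary z hz h0 := hu.boundary _ ((mem_boundary_iff hz).2 h0)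
  orthogonal z hz h0 := by
    obtain ⟨v, hv⟩ := hu.orthogonal _ ((mem_boundary_iff hz).2 h0)
    obtain ⟨w, rfl⟩ := (bijective_chartFrame hz).2 v
    exact ⟨w, (fderivWithin_inChart hu.smooth hz w).trans hv⟩

end

/-! ### Change of charts -/

section

theorem measurableSet_inter_preimage_of_continuousOn {α β : Type*} [TopologicalSpace α]
    [MeasurableSpace α] [OpensMeasurableSpace α] [TopologicalSpace β] [MeasurableSpace β]
    [BorelSpace β] {f : α → β} {s : Set α} {S : Set β} (hs : MeasurableSet s) (hf : ContinuousOn f s)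
    (hS : MeasurableSet S) : MeasurableSet (s ∩ f ⁻¹' S) := by
  have h := (continuousOn_iff_continuous_domRestrict.1 hf).measurable hS
  have h2 := hs.subtype_image h
  convert h2 using 1
  ext x
  simp only [mem_inter_iff, mem_preimage, mem_image, domRestrict_apply, Subtype.exists,
    exists_and_right, exists_eq_right]
  exact ⟨fun h => ⟨h.1, h.2⟩, fun ⟨h, h'⟩ => ⟨h, h'⟩⟩

variable {n : ℕ} {M : Type*} [TopologicalSpace M] [ChartedSpace (EuclideanHalfSpace 2) M]

theorem measurableSet_chartDomain (c : M) : MeasurableSet (chartDomain c) := by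
  rw [chartDomain, extChartAt_target, range_modelWithCorners]
  exact (((chartAt _ c).open_target.preimage (𝓡∂ 2).continuous_symm).measurableSet).inter
    isClosed_halfPlane.measurableSet

/-- The tangent vector which the differential of `u` maps to the tangential part of the field `X`,
provided that `u` is an immersion. -/
noncomputable def tangentialPart (u : M → Euc n) (X : Euc n → Euc n) (p : M) : Euc 2 :=
  Function.invFun (surfaceDeriv u p)
    ((LinearMap.range (surfaceDeriv u p).toLinearMap).starProjection (X (u p)))

variable [IsManifold (𝓡∂ 2) ∞ M] {u : M → Euc n}

/-- The gradient term of the first variation formula does not depend on the chart. -/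
theorem coordGrad_inChart (hu : IsFreeBoundaryMinimalSurface u) (X : Euc n → Euc n) {η : M → ℝ}
    (hη : ContMDiff (𝓡∂ 2) 𝓘(ℝ, ℝ) ∞ η) {c : M} {z : Euc 2} (hz : z ∈ chartDomain c) :
    coordGrad (inChart u c) (inChart η c) X z = areaDensity (inChart u c) z *
      surfaceDeriv η ((extChartAt (𝓡∂ 2) c).symm z)
        (tangentialPart u X ((extChartAt (𝓡∂ 2) c).symm z)) := by
  have hloc := hu.isLocalSurface c
  set p := (extChartAt (𝓡∂ 2) c).symm z with hp
  set L := fderivWithin ℝ (inChart u c) halfPlane z with hL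
  have hinj := hloc.injective z hz
  have hJ := hloc.areaDensity_pos hz
  have hLp : ∀ v, L v = surfaceDeriv u p (chartFrame c z v) :=
    fderivWithin_inChart hu.smooth hz
  have hrange : LinearMap.range (surfaceDeriv u p).toLinearMap = LinearMap.range L.toLinearMap := by
    ext y
    constructor
    · rintro ⟨v, rfl⟩
      obtain ⟨w, rfl⟩ := (bijective_chartFrame hz).2 v
      exact ⟨w, hLp w⟩
    · rintro ⟨v, rfl⟩
      exact ⟨chartFrame c z v, (hLp v).symm⟩
  -- The tangential part in the coordinates of the chart.
  set w : Euc 2 := (areaDensity (inChart u c) z)⁻¹ •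
    ((inner ℝ (coordConormal (inChart u c) 0 z) (X (u p)) : ℝ) • bas 0 +
      (inner ℝ (coordConormal (inChart u c) 1 z) (X (u p)) : ℝ) • bas 1) with hw
  have hproj : (LinearMap.range L.toLinearMap).starProjection (X (u p)) = L w := by
    rw [starProjection_range hinj, hw, map_smul, map_add, map_smul, map_smul]
    rfl
  have hproj' : (LinearMap.range (surfaceDeriv u p).toLinearMap).starProjection (X (u p)) =
      surfaceDeriv u p (chartFrame c z w) := by
    simp only [hrange]
    rw [hproj, hLp]
  have hξ : tangentialPart u X p = chartFrame c z w := by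
    rw [tangentialPart, hproj']
    exact Function.leftInverse_invFun (hu.immersion p) _
  rw [hξ, ← fderivWithin_inChart hη hz, hw, map_smul, map_add, map_smul, map_smul, smul_eq_mul,
    ← mul_assoc, mul_inv_cancel₀ hJ.ne', one_mul]
  change _ * inner ℝ (X (u p)) _ + _ * inner ℝ (X (u p)) _ = _
  simp only [smul_eq_mul, real_inner_comm _ (X (u p))]
  ring

/-- Integrals with respect to the area of the surface do not depend on the chart. -/
theorem integral_areaDensity_eq (hu : IsFreeBoundaryMinimalSurface u) (c d : M) {G : M → ℝ}
    (hc : ∀ p ∉ (extChartAt (𝓡∂ 2) c).source, G p = 0)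
    (hd : ∀ p ∉ (extChartAt (𝓡∂ 2) d).source, G p = 0) :
    ∫ z in chartDomain c, areaDensity (inChart u c) z * inChart G c z =
      ∫ z in chartDomain d, areaDensity (inChart u d) z * inChart G d z := by
  -- The part of one chart domain which is covered by the other chart.
  set E : M → M → Set (Euc 2) := fun c d => chartDomain c ∩
    (extChartAt (𝓡∂ 2) c).symm ⁻¹' (extChartAt (𝓡∂ 2) d).source with hE
  set τ : Euc 2 → Euc 2 := extChartAt (𝓡∂ 2) d ∘ (extChartAt (𝓡∂ 2) c).symm with hτ
  have hmeas : MeasurableSet (E c d) := by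
    let _ : MeasurableSpace M := borel M
    have : BorelSpace M := ⟨rfl⟩
    exact measurableSet_inter_preimage_of_continuousOn (measurableSet_chartDomain c)
      (continuousOn_extChartAt_symm c) (isOpen_extChartAt_source d).measurableSet
  have hred : ∀ c d : M, (∀ p ∉ (extChartAt (𝓡∂ 2) d).source, G p = 0) →
      ∫ z in chartDomain c, areaDensity (inChart u c) z * inChart G c z =
        ∫ z in E c d, areaDensity (inChart u c) z * inChart G c z := fun c d hd => by
    refine setIntegral_eq_of_subset_of_forall_sdiff_eq_zero (measurableSet_chartDomain c)
      inter_subset_left fun z hz => ?_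
    change _ * G _ = 0
    rw [hd _ fun h => hz.2 ⟨hz.1, h⟩, mul_zero]
  have himage : τ '' E c d = E d c := by
    ext y
    constructor
    · rintro ⟨z, hz, rfl⟩
      refine ⟨(extChartAt (𝓡∂ 2) d).map_source hz.2, ?_⟩
      simp only [mem_preimage, hτ, Function.comp_apply]
      rw [(extChartAt (𝓡∂ 2) d).left_inv hz.2]
      exact (extChartAt (𝓡∂ 2) c).map_target hz.1
    · intro hy
      refine ⟨extChartAt (𝓡∂ 2) c ((extChartAt (𝓡∂ 2) d).symm y),
        ⟨(extChartAt (𝓡∂ 2) c).map_source hy.2, ?_⟩, ?_⟩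
      · simp only [mem_preimage]
        rw [(extChartAt (𝓡∂ 2) c).left_inv hy.2]
        exact (extChartAt (𝓡∂ 2) d).map_target hy.1
      · simp only [hτ, Function.comp_apply]
        rw [(extChartAt (𝓡∂ 2) c).left_inv hy.2, (extChartAt (𝓡∂ 2) d).right_inv hy.1]
  have hinj : InjOn τ (E c d) := fun y hy z hz h => by
    have := (extChartAt (𝓡∂ 2) d).injOn hy.2 hz.2 h
    rw [← (extChartAt (𝓡∂ 2) c).right_inv hy.1, this, (extChartAt (𝓡∂ 2) c).right_inv hz.1]
  have hderiv : ∀ z ∈ E c d, HasFDerivWithinAt τ (fderivWithin ℝ τ halfPlane z) halfPlane z :=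
    fun z hz => by
      have := contDiffWithinAt_ext_coord_change (n := ∞) (I := 𝓡∂ 2) d c (y := z) ⟨hz.1, hz.2⟩
      rw [range_modelWithCorners] at this
      exact hasFDerivWithinAt_of_contDiffWithinAt this
  rw [hred c d hd, hred d c hc, ← himage, integral_image_eq_integral_abs_det_fderiv_smul volume
    hmeas (fun z hz => (hderiv z hz).mono (inter_subset_left.trans (chartDomain_subset c))) hinj]
  refine setIntegral_congr_fun hmeas fun z hz => ?_
  have hτz : τ z ∈ chartDomain d := (extChartAt (𝓡∂ 2) d).map_source hz.2
  have hinv : ∀ {y}, y ∈ E c d →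
      (extChartAt (𝓡∂ 2) d).symm (τ y) = (extChartAt (𝓡∂ 2) c).symm y := fun hy =>
    (extChartAt (𝓡∂ 2) d).left_inv hy.2
  have hchain : fderivWithin ℝ (inChart u c) halfPlane z =
      (fderivWithin ℝ (inChart u d) halfPlane (τ z)) ∘L fderivWithin ℝ τ halfPlane z := by
    have hev : E c d ∈ 𝓝[halfPlane] z := by
      have h1 := chartDomain_mem_nhds hz.1
      refine inter_mem h1 ?_
      have h2 : ContinuousWithinAt (extChartAt (𝓡∂ 2) c).symm halfPlane z :=
        (continuousOn_extChartAt_symm c z hz.1).mono_of_mem_nhdsWithin h1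
      exact h2 ((isOpen_extChartAt_source d).mem_nhds hz.2)
    have h1 : HasFDerivWithinAt (inChart u d) (fderivWithin ℝ (inChart u d) halfPlane (τ z))
        (chartDomain d) (τ z) :=
      ((hu.isLocalSurface d).hasFDerivWithinAt hτz).mono (chartDomain_subset d)
    have h2 : HasFDerivWithinAt τ (fderivWithin ℝ τ halfPlane z) (E c d) z :=
      (hderiv z hz).mono (inter_subset_left.trans (chartDomain_subset c))
    have h3 := (h1.comp z h2 fun y hy => (extChartAt (𝓡∂ 2) d).map_source hy.2)
    refine halfPlane_fderivWithin_unique (chartDomain_subset c hz.1)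
      ((hu.isLocalSurface c).hasFDerivWithinAt hz.1) (h3.mono_of_mem_nhdsWithin hev) ?_
    filter_upwards [hev] with y hy
    exact congrArg u (hinv hy).symm
  have hJ : areaDensity (inChart u c) z =
      |(fderivWithin ℝ τ halfPlane z).det| * areaDensity (inChart u d) (τ z) := by
    have := parArea_comp (fderivWithin ℝ (inChart u d) halfPlane (τ z))
      (fderivWithin ℝ τ halfPlane z)
    rw [← hchain] at this
    exact this
  simp only [inChart, Function.comp_apply, smul_eq_mul, hinv hz] at hJ ⊢
  rw [hJ]
  ring

end

/-! ### Partition of the first variation formula over charts -/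

section

variable {n : ℕ} {M : Type*} [TopologicalSpace M] [ChartedSpace (EuclideanHalfSpace 2) M]

/-- The parametrization of the boundary of the surface by the boundary of the chart at `c`. -/
noncomputable def boundaryCurve (c : M) (t : ℝ) : M := (extChartAt (𝓡∂ 2) c).symm (planePt (0, t))

/-- The open set of parameters at which `boundaryCurve c` is meaningful. Elsewhere the inverse of
the chart takes arbitrary values. -/
def boundaryDomain (c : M) : Set ℝ := {t | planePt (0, t) ∈ chartDomain c}

theorem surfaceDeriv_eq_zero {g : M → ℝ} {T : Set M} (hT : IsClosed T) (h : ∀ p ∉ T, g p = 0)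
    {p : M} (hp : p ∉ T) : surfaceDeriv g p = 0 := by
  have : g =ᶠ[𝓝 p] fun _ => (0 : ℝ) := by
    filter_upwards [hT.isOpen_compl.mem_nhds hp] with q hq using h q hq
  rw [surfaceDeriv, this.mfderiv_eq]
  exact mfderiv_const

/-- The support hypothesis compensates for the fact that `g` may be unbounded near the edge of the
chart. -/
theorem integrableOn_chartDomain {c : M} {g : Euc 2 → ℝ} {T : Set M} (hT : IsCompact T)
    (hTc : T ⊆ (extChartAt (𝓡∂ 2) c).source) (hg : ContinuousOn g (chartDomain c))
    (h0 : ∀ z ∈ chartDomain c, (extChartAt (𝓡∂ 2) c).symm z ∉ T → g z = 0) :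
    IntegrableOn g (chartDomain c) := by
  have hK : IsCompact (extChartAt (𝓡∂ 2) c '' T) :=
    hT.image_of_continuousOn ((continuousOn_extChartAt c).mono hTc)
  have hKc : extChartAt (𝓡∂ 2) c '' T ⊆ chartDomain c := by
    rintro _ ⟨p, hp, rfl⟩
    exact (extChartAt (𝓡∂ 2) c).map_source (hTc hp)
  exact ((hg.mono hKc).integrableOn_compact hK).of_forall_sdiff_eq_zero
    (measurableSet_chartDomain c) fun z hz => h0 z hz.1 fun h =>
      hz.2 ⟨_, h, (extChartAt (𝓡∂ 2) c).right_inv hz.1⟩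

theorem continuousOn_inChart {η : M → ℝ} (hη : ContMDiff (𝓡∂ 2) 𝓘(ℝ, ℝ) ∞ η) (c : M) :
    ContinuousOn (inChart η c) (chartDomain c) :=
  hη.continuous.comp_continuousOn (continuousOn_extChartAt_symm c)

variable [IsManifold (𝓡∂ 2) ∞ M] {u : M → Euc n} {X : Euc n → Euc n}

theorem continuousOn_coordGrad_inChart (hu : IsFreeBoundaryMinimalSurface u)
    (hX : ContDiff ℝ ∞ X) {η : M → ℝ} (hη : ContMDiff (𝓡∂ 2) 𝓘(ℝ, ℝ) ∞ η) (c : M) :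
    ContinuousOn (coordGrad (inChart u c) (inChart η c) X) (chartDomain c) := fun _ hz =>
  ((hu.isLocalSurface c).continuousWithinAt_coordGrad hz hX (contDiffWithinAt_inChart hη hz)).mono
    (chartDomain_subset c)

/-- The gradient terms of the localized first variation formulas cancel when the cutoff functions
`ρ i` form a partition of unity: each term is distributed over the charts by `1 = ∑ ρ k`, and the
parts supported in one chart are collected. -/
theorem sum_integral_coordGrad_eq_zero (hu : IsFreeBoundaryMinimalSurface u)
    (hX : ContDiff ℝ ∞ X) {ι : Type*} [Fintype ι] {c : ι → M} {ρ : ι → M → ℝ} {T : ι → Set M}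
    (hρ : ∀ i, ContMDiff (𝓡∂ 2) 𝓘(ℝ, ℝ) ∞ (ρ i)) (hT : ∀ i, IsCompact (T i))
    (hTcl : ∀ i, IsClosed (T i)) (hTc : ∀ i, T i ⊆ (extChartAt (𝓡∂ 2) (c i)).source)
    (h0 : ∀ i, ∀ p ∉ T i, ρ i p = 0) (hsum : ∀ p, ∑ i, ρ i p = 1) :
    ∑ i, ∫ z in chartDomain (c i), coordGrad (inChart u (c i)) (inChart (ρ i) (c i)) X z = 0 := by
  set D : M → ι → ι → Euc 2 → ℝ := fun d i k z =>
    inChart (ρ k) d z * coordGrad (inChart u d) (inChart (ρ i) d) X z with hD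
  have hcont : ∀ d i k, ContinuousOn (D d i k) (chartDomain d) := fun d i k =>
    (continuousOn_inChart (hρ k) d).mul (continuousOn_coordGrad_inChart hu hX (hρ i) d)
  have hform : ∀ d i k, ∀ z ∈ chartDomain d, D d i k z = areaDensity (inChart u d) z *
      inChart (fun p => ρ k p * surfaceDeriv (ρ i) p (tangentialPart u X p)) d z :=
    fun d i k z hz => by
      simp only [hD, coordGrad_inChart hu X (hρ i) hz, Function.comp_apply]
      ring
  have hGi : ∀ i k, ∀ p ∉ T i, ρ k p * surfaceDeriv (ρ i) p (tangentialPart u X p) = 0 :=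
    fun i k p hp => by rw [surfaceDeriv_eq_zero (hTcl i) (h0 i) hp]; simp
  have hGk : ∀ i k, ∀ p ∉ T k, ρ k p * surfaceDeriv (ρ i) p (tangentialPart u X p) = 0 :=
    fun i k p hp => by rw [h0 k p hp, zero_mul]
  have hint1 : ∀ i k, IntegrableOn (D (c i) i k) (chartDomain (c i)) := fun i k =>
    integrableOn_chartDomain (hT i) (hTc i) (hcont _ _ _) fun z hz hzT =>
       (hform _ _ _ z hz).trans (mul_eq_zero_of_right _ (hGi i k _ hzT))
  have hint2 : ∀ i k, IntegrableOn (D (c k) i k) (chartDomain (c k)) := fun i k =>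
    integrableOn_chartDomain (hT k) (hTc k) (hcont _ _ _) fun z hz hzT =>
       (hform _ _ _ z hz).trans (mul_eq_zero_of_right _ (hGk i k _ hzT))
  have hchange : ∀ i k, ∫ z in chartDomain (c i), D (c i) i k z =
      ∫ z in chartDomain (c k), D (c k) i k z := fun i k => by
    rw [setIntegral_congr_fun (measurableSet_chartDomain _) (hform (c i) i k),
      setIntegral_congr_fun (measurableSet_chartDomain _) (hform (c k) i k)]
    exact integral_areaDensity_eq hu _ _ (fun p hp => hGi i k p fun h => hp (hTc i h))
      (fun p hp => hGk i k p fun h => hp (hTc k h))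
  have hsplit : ∀ i, ∫ z in chartDomain (c i),
      coordGrad (inChart u (c i)) (inChart (ρ i) (c i)) X z =
        ∑ k, ∫ z in chartDomain (c i), D (c i) i k z := fun i => by
    rw [← integral_finsetSum _ fun k _ => hint1 i k]
    refine integral_congr_ae (Eventually.of_forall fun z => ?_)
    simp only [hD, ← Finset.sum_mul, Function.comp_apply, hsum, one_mul]
  -- In a fixed chart the differentials of the cutoff functions add up to zero.
  have hzero : ∀ k, ∑ i, ∫ z in chartDomain (c k), D (c k) i k z = 0 := fun k => by
    rw [← integral_finsetSum _ fun i _ => hint2 i k]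
    rw [setIntegral_congr_fun (g := fun _ => (0 : ℝ)) (measurableSet_chartDomain _), integral_zero]
    intro z hz
    have hd : ∑ i, fderivWithin ℝ (inChart (ρ i) (c k)) halfPlane z = 0 := by
      rw [← fderivWithin_fun_sum (uniqueDiffOn_halfPlane z (chartDomain_subset _ hz))
        fun i _ => (contDiffWithinAt_inChart (hρ i) hz).differentiableWithinAt (by simp)]
      simp only [Function.comp_apply, hsum]
      simp
    have hd' := fun v => congrArg (fun L : Euc 2 →L[ℝ] ℝ => L v) hd
    simp only [sum_apply, zero_apply] at hd'
    simp only [hD, ← Finset.mul_sum, coordGrad, Finset.sum_add_distrib, ← Finset.sum_mul, hd']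
    simp
  rw [Finset.sum_congr rfl fun i _ => hsplit i, Finset.sum_comm]
  refine Finset.sum_eq_zero fun k _ => ?_
  rw [← hzero k]
  exact Finset.sum_congr rfl fun i _ => hchange i k

theorem hasDerivAt_comp_boundaryCurve {F : Type*} [NormedAddCommGroup F] [NormedSpace ℝ F]
    {g : M → F} (hg : ContMDiff (𝓡∂ 2) 𝓘(ℝ, F) ∞ g) {c : M} {t : ℝ} (ht : t ∈ boundaryDomain c) :
    HasDerivAt (fun t => g (boundaryCurve c t))
      (fderivWithin ℝ (inChart g c) halfPlane (planePt (0, t)) (bas 1)) t :=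
  hasDerivAt_boundaryCurve
    (hasFDerivWithinAt_of_contDiffWithinAt (contDiffWithinAt_inChart hg ht))

/-- The first variation formula on the surface, localized by a function `ρ` supported in a chart. -/
theorem integral_first_variation (hu : IsFreeBoundaryMinimalSurface u)
    (hX : ContDiff ℝ ∞ X) {c : M} {ρ : M → ℝ} {T : Set M} (hρ : ContMDiff (𝓡∂ 2) 𝓘(ℝ, ℝ) ∞ ρ)
    (hT : IsCompact T) (hTc : T ⊆ (extChartAt (𝓡∂ 2) c).source) (h0 : ∀ p ∉ T, ρ p = 0) :
    (∫ z in chartDomain c, inChart ρ c z * coordDiv (inChart u c) X z) +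
      (∫ z in chartDomain c, coordGrad (inChart u c) (inChart ρ c) X z) =
      ∫ t in boundaryDomain c, ρ (boundaryCurve c t) *
        inner ℝ (X (u (boundaryCurve c t))) (u (boundaryCurve c t)) *
        ‖deriv (fun t => u (boundaryCurve c t)) t‖ := by
  classical
  -- The inverse of the chart takes arbitrary values off the chart domain.
  set η : Euc 2 → ℝ := (chartDomain c).indicator (inChart ρ c) with hη
  set K := extChartAt (𝓡∂ 2) c '' T with hKdef
  have hK : IsCompact K := hT.image_of_continuousOn ((continuousOn_extChartAt c).mono hTc)
  have hKc : K ⊆ chartDomain c := by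
    rintro _ ⟨p, hp, rfl⟩
    exact (extChartAt (𝓡∂ 2) c).map_source (hTc hp)
  have hev : ∀ z ∈ chartDomain c, η =ᶠ[𝓝[halfPlane] z] inChart ρ c := fun z hz => by
    filter_upwards [chartDomain_mem_nhds hz] with y hy using indicator_of_mem hy _
  have hη0 : ∀ z ∈ halfPlane, z ∉ K → η z = 0 := fun z _ hzK => by
    by_cases hz : z ∈ chartDomain c
    · rw [hη, indicator_of_mem hz]
      exact h0 _ fun h => hzK ⟨_, h, (extChartAt (𝓡∂ 2) c).right_inv hz⟩
    · exact indicator_of_notMem hz _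
  have hηs : ∀ z ∈ chartDomain c, ContDiffWithinAt ℝ ∞ η halfPlane z := fun z hz =>
    (contDiffWithinAt_inChart hρ hz).congr_of_eventuallyEq (hev z hz) (indicator_of_mem hz _)
  have hloc := hu.isLocalSurface c
  have hm := measurableSet_chartDomain c
  have key := hloc.integral_coordDiv_add_coordGrad hX hK hKc hηs hη0
  rw [setIntegral_eq_of_subset_of_forall_sdiff_eq_zero isClosed_halfPlane.measurableSet
      (chartDomain_subset c) fun z hz => by rw [hη, indicator_of_notMem hz.2, zero_mul],
    setIntegral_eq_of_subset_of_forall_sdiff_eq_zero (f := coordGrad _ _ _)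
      isClosed_halfPlane.measurableSet (chartDomain_subset c) fun z hz => by
        rw [coordGrad, fderivWithin_eq_zero_of_eq_zero_off hK hη0 hz.1 fun h => hz.2 (hKc h)]
        simp,
    setIntegral_congr_fun (f := coordGrad _ _ _) (g := coordGrad _ (inChart ρ c) _) hm
      fun z hz => by
        simp only [coordGrad]
        rw [(hev z hz).fderivWithin_eq (indicator_of_mem hz _)],
    setIntegral_congr_fun (f := fun z => η z * _)
      (g := fun z => inChart ρ c z * coordDiv (inChart u c) X z) hm
      fun z hz => by simp only [hη, indicator_of_mem hz]] at key
  rw [key, ← setIntegral_eq_integral_of_forall_compl_eq_zero (s := boundaryDomain c) fun t ht => by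
    rw [hη, indicator_of_notMem (show planePt (0, t) ∉ chartDomain c from ht)]; simp]
  refine setIntegral_congr_fun ?_ fun t ht => ?_
  · exact hm.preimage (planePt.continuous.comp (by fun_prop)).measurable
  · simp only [hη]
    rw [indicator_of_mem (show planePt (0, t) ∈ chartDomain c from ht),
      (hasDerivAt_comp_boundaryCurve hu.smooth ht).deriv]
    rfl

/-- The divergence of `X` along the surface is nonnegative if that along every plane is. -/
theorem coordDiv_nonneg (hu : IsFreeBoundaryMinimalSurface u)
    (hpos : ∀ x ∈ unitBall n, ∀ e₁ e₂ : Euc n, ‖e₁‖ = 1 → ‖e₂‖ = 1 → inner ℝ e₁ e₂ = 0 →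
      0 ≤ inner ℝ (fderiv ℝ X x e₁) e₁ + inner ℝ (fderiv ℝ X x e₂) e₂)
    {c : M} {z : Euc 2} (hz : z ∈ chartDomain c) : 0 ≤ coordDiv (inChart u c) X z := by
  have hloc := hu.isLocalSurface c
  have hinj := hloc.injective z hz
  obtain ⟨e₁, e₂, h1, h2, h12, -, -, htr⟩ :=
    exists_orthonormal_trace_eq _ (finrank_range_of_injective hinj)
  have h := traceCLM_starProjection_range hinj (fderiv ℝ X (inChart u c z))
  rw [traceCLM_apply, htr] at h
  refine le_of_le_of_eq ?_ h
  exact mul_nonneg (parArea_nonneg _ _) (hpos _ (hloc.mem_ball z hz) e₁ e₂ h1 h2 h12)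

theorem exists_partition_subordinate_charts (M : Type*) [TopologicalSpace M]
    [ChartedSpace (EuclideanHalfSpace 2) M] [IsManifold (𝓡∂ 2) ∞ M] [CompactSpace M] [T2Space M] :
    ∃ (t : Finset M) (ρ : t → M → ℝ), (∀ i, ContMDiff (𝓡∂ 2) 𝓘(ℝ, ℝ) ∞ (ρ i)) ∧
      (∀ i : t, tsupport (ρ i) ⊆ (extChartAt (𝓡∂ 2) (i : M)).source) ∧ (∀ i p, 0 ≤ ρ i p) ∧
      ∀ p, ∑ i, ρ i p = 1 := by
  obtain ⟨t, -, ht⟩ := isCompact_univ.elim_nhds_subcover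
    (fun c : M => (extChartAt (𝓡∂ 2) c).source) fun c _ => extChartAt_source_mem_nhds c
  obtain ⟨f, hf⟩ := SmoothPartitionOfUnity.exists_isSubordinate (𝓡∂ 2) (isClosed_univ (X := M))
    (fun i : t => (extChartAt (𝓡∂ 2) (i : M)).source) (fun i => isOpen_extChartAt_source _)
    (ht.trans fun x hx => by simpa using hx)
  refine ⟨t, fun i => f i, fun i => (f i).contMDiff, fun i => hf i, fun i p => f.nonneg i p,
    fun p => ?_⟩
  rw [← finsum_eq_sum_of_fintype]
  exact f.sum_eq_one (mem_univ p)

end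

/-! ### Arc length on the boundary -/

section

variable {n : ℕ} {M : Type*} [TopologicalSpace M] [ChartedSpace (EuclideanHalfSpace 2) M]

theorem isOpen_boundaryDomain (c : M) : IsOpen (boundaryDomain c) := by
  refine isOpen_iff_mem_nhds.2 fun t ht => ?_
  have h1 : Tendsto (fun t : ℝ => planePt (0, t)) (𝓝 t) (𝓝[halfPlane] (planePt (0, t))) :=
    tendsto_nhdsWithin_iff.2 ⟨(planePt.continuous.comp (by fun_prop)).tendsto t,
      Eventually.of_forall planePt_zero_mem_halfPlane⟩
  exact h1 (chartDomain_mem_nhds ht)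

theorem continuousOn_boundaryCurve (c : M) : ContinuousOn (boundaryCurve c) (boundaryDomain c) :=
  (continuousOn_extChartAt_symm c).comp
    (planePt.continuous.comp (by fun_prop)).continuousOn fun _ ht => ht

theorem injOn_boundaryCurve (c : M) : InjOn (boundaryCurve c) (boundaryDomain c) :=
  fun s hs t ht h => by
    have := congrArg (fun z : Euc 2 => z 1) ((extChartAt (𝓡∂ 2) c).symm.injOn hs ht h)
    simpa using this

theorem boundaryCurve_mem_source {c : M} {t : ℝ} (ht : t ∈ boundaryDomain c) :
    boundaryCurve c t ∈ (extChartAt (𝓡∂ 2) c).source := (extChartAt (𝓡∂ 2) c).map_target ht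

section

variable [IsManifold (𝓡∂ 2) ∞ M]

theorem boundaryCurve_mem_boundary {c : M} {t : ℝ} (ht : t ∈ boundaryDomain c) :
    boundaryCurve c t ∈ (𝓡∂ 2).boundary M := (mem_boundary_iff ht).2 (by simp)

theorem exists_boundaryCurve_eq {c p : M} (hp : p ∈ (extChartAt (𝓡∂ 2) c).source)
    (hb : p ∈ (𝓡∂ 2).boundary M) : ∃ t ∈ boundaryDomain c, boundaryCurve c t = p := by
  have hz := (extChartAt (𝓡∂ 2) c).map_source hp
  rw [← (extChartAt (𝓡∂ 2) c).left_inv hp] at hb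
  have h0 := (mem_boundary_iff hz).1 hb
  have hpt : planePt (0, extChartAt (𝓡∂ 2) c p 1) = extChartAt (𝓡∂ 2) c p := by
    rw [← h0, planePt_coords]
  refine ⟨extChartAt (𝓡∂ 2) c p 1, ?_, ?_⟩
  · rw [boundaryDomain, mem_ofPred_eq, hpt]; exact hz
  · rw [boundaryCurve, hpt, (extChartAt (𝓡∂ 2) c).left_inv hp]

/-- The length, with multiplicity, of the part of the boundary in the subset `S` of a chart. -/
theorem lintegral_encard_boundary [MeasurableSpace M] [BorelSpace M] {c : M} {g : M → Euc n}
    (hg : ContDiffOn ℝ 1 (fun t => g (boundaryCurve c t)) (boundaryDomain c))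
    (hg0 : ∀ t ∈ boundaryDomain c, deriv (fun t => g (boundaryCurve c t)) t ≠ 0)
    {S : Set M} (hS : MeasurableSet S) (hSc : S ⊆ (extChartAt (𝓡∂ 2) c).source) :
    Measurable (fun y => (({p | p ∈ S ∩ (𝓡∂ 2).boundary M ∧ g p = y}.encard : ℕ∞) : ENNReal)) ∧
    ∫⁻ y, (({p | p ∈ S ∩ (𝓡∂ 2).boundary M ∧ g p = y}.encard : ℕ∞) : ENNReal)
        ∂(μH[1] : Measure (Euc n)) =
      ∫⁻ t in boundaryDomain c ∩ boundaryCurve c ⁻¹' S,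
        ‖deriv (fun t => g (boundaryCurve c t)) t‖ₑ := by
  have hO := isOpen_boundaryDomain c
  have hE := measurableSet_inter_preimage_of_continuousOn hO.measurableSet
    (continuousOn_boundaryCurve c) hS
  have h := lintegral_encard_eq_lintegral_enorm_deriv hO hg hg0 hE inter_subset_left
  have heq : ∀ y, {p | p ∈ S ∩ (𝓡∂ 2).boundary M ∧ g p = y}.encard =
      {t | t ∈ boundaryDomain c ∩ boundaryCurve c ⁻¹' S ∧ g (boundaryCurve c t) = y}.encard :=
    fun y => by
      rw [← InjOn.encard_image ((injOn_boundaryCurve c).mono fun t ht => ht.1.1)]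
      congr 1
      ext p
      constructor
      · rintro ⟨⟨hpS, hpb⟩, rfl⟩
        obtain ⟨t, ht, rfl⟩ := exists_boundaryCurve_eq (hSc hpS) hpb
        exact ⟨t, ⟨⟨ht, hpS⟩, rfl⟩, rfl⟩
      · rintro ⟨t, ⟨⟨ht, htS⟩, rfl⟩, rfl⟩
        exact ⟨⟨htS, boundaryCurve_mem_boundary ht⟩, rfl⟩
  simp only [heq]
  exact h

theorem boundaryLength_eq_tsum [MeasurableSpace M] [BorelSpace M] {c : ℕ → M} {D : ℕ → Set M}
    (hD : ∀ k, MeasurableSet (D k)) (hdisj : Pairwise (Function.onFun Disjoint D))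
    (hU : ⋃ k, D k = univ) (hDc : ∀ k, D k ⊆ (extChartAt (𝓡∂ 2) (c k)).source) {g : M → Euc n}
    (hg : ∀ c : M, ContDiffOn ℝ 1 (fun t => g (boundaryCurve c t)) (boundaryDomain c))
    (hg0 : ∀ c : M, ∀ t ∈ boundaryDomain c, deriv (fun t => g (boundaryCurve c t)) t ≠ 0) :
    boundaryLength g = ∑' k, ∫⁻ t in boundaryDomain (c k) ∩ boundaryCurve (c k) ⁻¹' D k,
      ‖deriv (fun t => g (boundaryCurve (c k) t)) t‖ₑ := by
  have h := fun k => lintegral_encard_boundary (hg (c k)) (hg0 (c k)) (hD k) (hDc k)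
  simp only [← fun k => (h k).2]
  rw [← lintegral_tsum fun k => (h k).1.aemeasurable, boundaryLength]
  refine lintegral_congr fun y => ?_
  rw [← encard_iUnion_of_disjoint]
  · congr 2
    ext p
    simp only [mem_ofPred_eq, mem_iUnion, mem_inter_iff]
    have : ∃ k, p ∈ D k := mem_iUnion.1 (hU ▸ mem_univ p)
    exact ⟨fun ⟨h1, h2⟩ => this.imp fun k hk => ⟨⟨hk, h1⟩, h2⟩, fun ⟨k, h1, h2⟩ => ⟨h1.2, h2⟩⟩
  · exact fun i j hij => (hdisj hij).mono (fun p hp => hp.1.1) fun p hp => hp.1.1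

end

/-- The arc length measure of the part of the boundary in the chart at `c`, for the metric induced
by `u`. -/
noncomputable def arcMeasure [MeasurableSpace M] (u : M → Euc n) (c : M) : Measure M :=
  ((volume.restrict (boundaryDomain c)).withDensity fun t =>
    ‖deriv (fun t => u (boundaryCurve c t)) t‖ₑ).map (boundaryCurve c)

theorem aemeasurable_boundaryCurve [MeasurableSpace M] [BorelSpace M]
    (c : M) (h : ℝ → ENNReal) :
    AEMeasurable (boundaryCurve c) ((volume.restrict (boundaryDomain c)).withDensity h) :=
  ((continuousOn_boundaryCurve c).aemeasurable
    (isOpen_boundaryDomain c).measurableSet).mono_ac (withDensity_absolutelyContinuous _ _)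

theorem ae_mem_arcMeasure [MeasurableSpace M] [BorelSpace M] {u : M → Euc n} {c : M}
    {S : Set M} (hS : MeasurableSet S)
    (h : ∀ t ∈ boundaryDomain c, boundaryCurve c t ∈ S) : ∀ᵐ p ∂arcMeasure u c, p ∈ S := by
  rw [arcMeasure, ae_map_iff (p := fun p => p ∈ S) (aemeasurable_boundaryCurve c _) hS]
  refine (withDensity_absolutelyContinuous _ _).ae_le ?_
  filter_upwards [ae_restrict_mem (isOpen_boundaryDomain c).measurableSet] with t ht using h t ht

section

variable [IsManifold (𝓡∂ 2) ∞ M] {u : M → Euc n}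

theorem contDiffOn_comp_boundaryCurve {F : Type*} [NormedAddCommGroup F] [NormedSpace ℝ F]
    {g : M → F} (hg : ContMDiff (𝓡∂ 2) 𝓘(ℝ, F) ∞ g) (c : M) :
    ContDiffOn ℝ ∞ (fun t => g (boundaryCurve c t)) (boundaryDomain c) := fun t ht =>
  ContDiffWithinAt.comp (g := inChart g c) (f := fun t : ℝ => planePt (0, t)) t
    (contDiffWithinAt_inChart hg ht)
    (planePt.contDiff.comp (contDiff_const.prodMk contDiff_id)).contDiffWithinAt
    fun s _ => planePt_zero_mem_halfPlane s

theorem deriv_boundaryCurve_ne_zero (hu : IsFreeBoundaryMinimalSurface u) {c : M} {t : ℝ}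
    (ht : t ∈ boundaryDomain c) : deriv (fun t => u (boundaryCurve c t)) t ≠ 0 := by
  rw [(hasDerivAt_comp_boundaryCurve hu.smooth ht).deriv]
  intro h
  have := (hu.isLocalSurface c).injective _ ht (h.trans (map_zero _).symm)
  have h1 := congrArg (fun z : Euc 2 => z 1) this
  simp at h1

theorem aemeasurable_enorm_deriv (hu : IsFreeBoundaryMinimalSurface u) (c : M) :
    AEMeasurable (fun t => ‖deriv (fun t => u (boundaryCurve c t)) t‖ₑ)
      (volume.restrict (boundaryDomain c)) :=
  (((contDiffOn_comp_boundaryCurve hu.smooth c).continuousOn_deriv_of_isOpen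
    (isOpen_boundaryDomain c) (by simp)).enorm).aemeasurable
    (isOpen_boundaryDomain c).measurableSet

variable [MeasurableSpace M] [BorelSpace M]

theorem setLIntegral_arcMeasure (hu : IsFreeBoundaryMinimalSurface u) (c : M) {S : Set M}
    (hS : MeasurableSet S) {h : M → ENNReal} (hh : Measurable h) :
    ∫⁻ p in S, h p ∂arcMeasure u c = ∫⁻ t in boundaryDomain c ∩ boundaryCurve c ⁻¹' S,
      ‖deriv (fun t => u (boundaryCurve c t)) t‖ₑ * h (boundaryCurve c t) := by
  have hm := aemeasurable_boundaryCurve c fun t => ‖deriv (fun t => u (boundaryCurve c t)) t‖ₑ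
  have hb : AEMeasurable (boundaryCurve c) (volume.restrict (boundaryDomain c)) :=
    (continuousOn_boundaryCurve c).aemeasurable (isOpen_boundaryDomain c).measurableSet
  rw [← lintegral_indicator hS, arcMeasure,
    lintegral_map' (hh.indicator hS).aemeasurable hm,
    lintegral_withDensity_eq_lintegral_mul₀ (aemeasurable_enorm_deriv hu c)
      (g := fun t => S.indicator h (boundaryCurve c t))
      ((hh.indicator hS).comp_aemeasurable hb),
    ← lintegral_indicator (isOpen_boundaryDomain c).measurableSet, ← lintegral_indicator
      (measurableSet_inter_preimage_of_continuousOn (isOpen_boundaryDomain c).measurableSet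
        (continuousOn_boundaryCurve c) hS)]
  refine lintegral_congr fun t => ?_
  by_cases ht : t ∈ boundaryDomain c <;> by_cases htS : boundaryCurve c t ∈ S <;>
    simp [indicator, ht, htS]

theorem arcMeasure_apply (hu : IsFreeBoundaryMinimalSurface u) (c : M) {S : Set M}
    (hS : MeasurableSet S) : arcMeasure u c S =
      ∫⁻ t in boundaryDomain c ∩ boundaryCurve c ⁻¹' S,
        ‖deriv (fun t => u (boundaryCurve c t)) t‖ₑ := by
  have := setLIntegral_arcMeasure hu c hS (h := fun _ => 1) measurable_const
  simpa using this

/-- The arc length measures of two charts agree where both are defined: both count the preimages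
of the points of the image curve. -/
theorem arcMeasure_eq (hu : IsFreeBoundaryMinimalSurface u) {c d : M} {S : Set M}
    (hS : MeasurableSet S) (hc : S ⊆ (extChartAt (𝓡∂ 2) c).source)
    (hd : S ⊆ (extChartAt (𝓡∂ 2) d).source) : arcMeasure u c S = arcMeasure u d S := by
  have h := fun (c : M) (hc : S ⊆ (extChartAt (𝓡∂ 2) c).source) => (lintegral_encard_boundary
    ((contDiffOn_comp_boundaryCurve hu.smooth c).of_le (by simp))
    (fun t ht => deriv_boundaryCurve_ne_zero hu ht) hS hc).2
  rw [arcMeasure_apply hu c hS, arcMeasure_apply hu d hS, ← h c hc, ← h d hd]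

/-- The arc length measure of the boundary, glued from the charts at the points `c k` on the
pieces `D k` of a decomposition of the surface. -/
noncomputable def boundaryMeasure (u : M → Euc n) (c : ℕ → M) (D : ℕ → Set M) : Measure M :=
  Measure.sum fun k => (arcMeasure u (c k)).restrict (D k)

/-- The glued measure is the arc length measure in every chart, not only on the pieces used to
define it. -/
theorem restrict_boundaryMeasure (hu : IsFreeBoundaryMinimalSurface u) {c : ℕ → M} {D : ℕ → Set M}
    (hD : ∀ k, MeasurableSet (D k)) (hdisj : Pairwise (Function.onFun Disjoint D))
    (hU : ⋃ k, D k = univ) (hDc : ∀ k, D k ⊆ (extChartAt (𝓡∂ 2) (c k)).source) (d : M) :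
    (boundaryMeasure u c D).restrict (extChartAt (𝓡∂ 2) d).source = arcMeasure u d := by
  have hd := (isOpen_extChartAt_source (I := 𝓡∂ 2) d).measurableSet
  rw [← Measure.restrict_eq_self_of_ae_mem (ae_mem_arcMeasure (u := u) hd
    fun t ht => boundaryCurve_mem_source ht)]
  ext S hS
  rw [Measure.restrict_apply hS, Measure.restrict_apply hS, boundaryMeasure,
    Measure.sum_apply _ (hS.inter hd)]
  have h1 : S ∩ (extChartAt (𝓡∂ 2) d).source =
      ⋃ k, (S ∩ (extChartAt (𝓡∂ 2) d).source) ∩ D k := by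
    rw [← inter_iUnion, hU, inter_univ]
  conv_rhs => rw [h1]
  rw [measure_iUnion (fun i j hij => (hdisj hij).mono inter_subset_right inter_subset_right)
    fun k => (hS.inter hd).inter (hD k)]
  refine tsum_congr fun k => ?_
  rw [Measure.restrict_apply (hS.inter hd)]
  exact arcMeasure_eq hu ((hS.inter hd).inter (hD k)) (inter_subset_right.trans (hDc k))
    (inter_subset_left.trans inter_subset_right)

theorem integral_arcMeasure (hu : IsFreeBoundaryMinimalSurface u) {c : M} {h : M → ℝ}
    (hh : Continuous h) : ∫ p, h p ∂arcMeasure u c =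
      ∫ t in boundaryDomain c,
        h (boundaryCurve c t) * ‖deriv (fun t => u (boundaryCurve c t)) t‖ := by
  rw [arcMeasure, integral_map (aemeasurable_boundaryCurve c _)
    hh.measurable.aestronglyMeasurable, integral_withDensity_eq_integral_toReal_smul₀
    (aemeasurable_enorm_deriv hu c) (Eventually.of_forall fun t => enorm_lt_top)]
  refine integral_congr_ae (Eventually.of_forall fun t => ?_)
  simp [mul_comm]

end

end

/-! ### Boundary length of free boundary minimal surfaces -/

section

variable {n : ℕ} {M : Type*} [TopologicalSpace M] [ChartedSpace (EuclideanHalfSpace 2) M]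
  [IsManifold (𝓡∂ 2) ∞ M] {u : M → Euc n}

theorem IsConformalTransformation.norm_ballDeriv_apply {f : Euc n → Euc n}
    (hf : IsConformalTransformation f) {x : Euc n} (hx : x ∈ unitBall n) (v : Euc n) :
    ‖ballDeriv f x v‖ = ‖ballDeriv f x‖ * ‖v‖ := by
  have h := hf.inner_ballDeriv hx v v
  rw [real_inner_self_eq_norm_sq, real_inner_self_eq_norm_sq, magSq, ← mul_pow] at h
  exact (sq_eq_sq₀ (norm_nonneg _) (by positivity)).1 h

theorem hasDerivAt_image_boundaryCurve {f : Euc n → Euc n}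
    (hf : IsConformalTransformation f) (hu : IsFreeBoundaryMinimalSurface u) {c : M} {t : ℝ}
    (ht : t ∈ boundaryDomain c) :
    HasDerivAt (fun t => (f ∘ u) (boundaryCurve c t))
      (ballDeriv f (u (boundaryCurve c t)) (deriv (fun t => u (boundaryCurve c t)) t)) t := by
  have h1 := (hasDerivAt_comp_boundaryCurve hu.smooth ht).differentiableAt.hasDerivAt
  exact hasDerivWithinAt_univ.1 <| (hf.hasFDerivWithinAt (hu.mem_ball _)).comp_hasDerivWithinAt t
    h1.hasDerivWithinAt fun t _ => hu.mem_ball _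

variable [MeasurableSpace M] [BorelSpace M]

/-- The first variation formula: the flux of `X` through the boundary of a free boundary minimal
surface is the integral of its divergence along the surface. Only the resulting sign is needed. -/
theorem integral_inner_nonneg [CompactSpace M] [T2Space M] (hu : IsFreeBoundaryMinimalSurface u)
    {μ : Measure M} [IsFiniteMeasure μ]
    (hμ : ∀ c : M, μ.restrict (extChartAt (𝓡∂ 2) c).source = arcMeasure u c)
    {X : Euc n → Euc n} (hX : ContDiff ℝ ∞ X)
    (hpos : ∀ x ∈ unitBall n, ∀ e₁ e₂ : Euc n, ‖e₁‖ = 1 → ‖e₂‖ = 1 → inner ℝ e₁ e₂ = 0 →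
      0 ≤ inner ℝ (fderiv ℝ X x e₁) e₁ + inner ℝ (fderiv ℝ X x e₂) e₂) :
    0 ≤ ∫ p, inner ℝ (X (u p)) (u p) ∂μ := by
  obtain ⟨t, ρ, hρ, hsupp, hρ0, hsum⟩ := exists_partition_subordinate_charts M
  have hcont : Continuous fun p => inner ℝ (X (u p)) (u p) :=
    (hX.continuous.comp hu.smooth.continuous).inner hu.smooth.continuous
  have hci : ∀ i, Continuous fun p => ρ i p * inner ℝ (X (u p)) (u p) := fun i =>
    (hρ i).continuous.mul hcont
  have hint : ∀ i, Integrable (fun p => ρ i p * inner ℝ (X (u p)) (u p)) μ := fun i => by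
    obtain ⟨C, hC⟩ := isCompact_univ.exists_bound_of_continuousOn (hci i).continuousOn
    exact Integrable.of_bound (hci i).measurable.aestronglyMeasurable C
      (Eventually.of_forall fun p => hC p (mem_univ p))
  have h0 : ∀ i, ∀ p ∉ tsupport (ρ i), ρ i p = 0 := fun i p hp =>
    image_eq_zero_of_notMem_tsupport hp
  have hlocal : ∀ i : t, ∫ p, ρ i p * inner ℝ (X (u p)) (u p) ∂μ =
      (∫ z in chartDomain (i : M), inChart (ρ i) i z * coordDiv (inChart u i) X z) +
      ∫ z in chartDomain (i : M), coordGrad (inChart u i) (inChart (ρ i) i) X z := fun i => by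
    rw [integral_first_variation hu hX (hρ i) (isClosed_tsupport _).isCompact (hsupp i) (h0 i),
      ← integral_arcMeasure hu (hci i), ← hμ, setIntegral_eq_integral_of_forall_compl_eq_zero]
    intro p hp
    rw [h0 i p fun h => hp (hsupp i h), zero_mul]
  have hsplit : ∫ p, inner ℝ (X (u p)) (u p) ∂μ =
      ∑ i, ∫ p, ρ i p * inner ℝ (X (u p)) (u p) ∂μ := by
    rw [← integral_finsetSum _ fun i _ => hint i]
    simp only [← Finset.sum_mul, hsum, one_mul]
  rw [hsplit, Finset.sum_congr rfl fun i _ => hlocal i, Finset.sum_add_distrib,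
    sum_integral_coordGrad_eq_zero hu hX hρ (fun i => (isClosed_tsupport _).isCompact)
      (fun i => isClosed_tsupport _) hsupp h0 hsum, add_zero]
  exact Finset.sum_nonneg fun i _ => setIntegral_nonneg (measurableSet_chartDomain _) fun z hz =>
    mul_nonneg (hρ0 i _) (coordDiv_nonneg hu hpos hz)

/-- Free boundary minimal surfaces do not gain boundary length under conformal transformations of
the ball: `imageLength_le_of_flux_nonneg` applies to the image `σ` of the arc length measure of the
boundary. -/
theorem boundaryLength_comp_le [CompactSpace M] [T2Space M] {f : Euc n → Euc n}
    (hf : IsConformalTransformation f) (hu : IsFreeBoundaryMinimalSurface u) :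
    boundaryLength (f ∘ u) ≤ boundaryLength u := by
  rcases isEmpty_or_nonempty M with hM | hM
  · rw [Subsingleton.elim (f ∘ u) u]
  have hn : 2 ≤ n := by
    by_contra hcon
    exact (isEmpty_of_le_one hu (by omega)).false hM.some
  obtain ⟨s, hs, hsU⟩ := countable_cover_nhds (X := M)
    fun c => extChartAt_source_mem_nhds (I := 𝓡∂ 2) c
  obtain ⟨c, hc⟩ := hs.exists_eq_range (by
    by_contra hcon
    rw [not_nonempty_iff_eq_empty] at hcon
    simp [hcon] at hsU
    exact (empty_ne_univ hsU).elim)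
  set D := disjointed fun k => (extChartAt (𝓡∂ 2) (c k)).source with hDdef
  have hD : ∀ k, MeasurableSet (D k) := MeasurableSet.disjointed fun k =>
    (isOpen_extChartAt_source (I := 𝓡∂ 2) (c k)).measurableSet
  have hdisj : Pairwise (Function.onFun Disjoint D) := disjoint_disjointed _
  have hU : ⋃ k, D k = univ := by
    rw [hDdef, iUnion_disjointed, ← hsU, hc, biUnion_range]
  have hDc : ∀ k, D k ⊆ (extChartAt (𝓡∂ 2) (c k)).source := disjointed_subset _
  set lam := boundaryMeasure u c D with hlam
  have hball : ContinuousOn (fun x => ‖ballDeriv f x‖ₑ) (unitBall n) :=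
    hf.contDiffOn_ballDeriv.continuousOn.enorm
  have hw : Measurable fun p => ‖ballDeriv f (u p)‖ₑ :=
    (hball.comp_continuous hu.smooth.continuous hu.mem_ball).measurable
  have hlen : ∀ {h : M → ENNReal}, Measurable h → ∫⁻ p, h p ∂lam =
      ∑' k, ∫⁻ t in boundaryDomain (c k) ∩ boundaryCurve (c k) ⁻¹' D k,
        ‖deriv (fun t => u (boundaryCurve (c k) t)) t‖ₑ * h (boundaryCurve (c k) t) := fun hh => by
    rw [hlam, boundaryMeasure, lintegral_sum_measure]
    exact tsum_congr fun k => setLIntegral_arcMeasure hu (c k) (hD k) hh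
  have hlen_u : boundaryLength u = lam univ := by
    rw [boundaryLength_eq_tsum hD hdisj hU hDc
      (fun c => (contDiffOn_comp_boundaryCurve hu.smooth c).of_le (by simp))
      (fun c t ht => deriv_boundaryCurve_ne_zero hu ht), ← lintegral_one, hlen measurable_const]
    simp
  have hderiv : ∀ (c : M), ∀ t ∈ boundaryDomain c, deriv (fun t => (f ∘ u) (boundaryCurve c t)) t =
      ballDeriv f (u (boundaryCurve c t)) (deriv (fun t => u (boundaryCurve c t)) t) :=
    fun c t ht => (hasDerivAt_image_boundaryCurve hf hu ht).deriv
  have hE : ∀ k, MeasurableSet (boundaryDomain (c k) ∩ boundaryCurve (c k) ⁻¹' D k) := fun k =>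
    measurableSet_inter_preimage_of_continuousOn (isOpen_boundaryDomain (c k)).measurableSet
      (continuousOn_boundaryCurve (c k)) (hD k)
  have hlen_fu : boundaryLength (f ∘ u) = ∫⁻ p, ‖ballDeriv f (u p)‖ₑ ∂lam := by
    rw [boundaryLength_eq_tsum hD hdisj hU hDc (fun c => ?_) (fun c t ht h => ?_), hlen hw]
    · refine tsum_congr fun k => setLIntegral_congr_fun (hE k) fun t ht => ?_
      rw [hderiv _ t ht.1, ← ofReal_norm, hf.norm_ballDeriv_apply (hu.mem_ball _), mul_comm,
        ENNReal.ofReal_mul (norm_nonneg _), ofReal_norm, ofReal_norm]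
    · exact (hf.smooth.of_le (by simp)).comp
        ((contDiffOn_comp_boundaryCurve hu.smooth c).of_le (by simp)) fun t _ => hu.mem_ball _
    · rw [hderiv c t ht, ← norm_eq_zero, hf.norm_ballDeriv_apply (hu.mem_ball _), mul_eq_zero,
        norm_eq_zero (a := deriv _ t)] at h
      exact h.elim (hf.ballDeriv_norm_pos (by omega) (hu.mem_ball _)).ne'
        (deriv_boundaryCurve_ne_zero hu ht)
  -- The length is finite, but it is quicker to observe that there is nothing to prove otherwise.
  rcases eq_or_ne (lam univ) ⊤ with htop | hfin
  · rw [hlen_u, htop]; exact le_top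
  have : IsFiniteMeasure lam := ⟨lt_top_iff_ne_top.2 hfin⟩
  have hum : Measurable u := hu.smooth.continuous.measurable
  have hsphere : ∀ᵐ x ∂lam.map u, x ∈ unitSphere n := by
    rw [ae_map_iff (p := fun x => x ∈ unitSphere n) hum.aemeasurable
      Metric.isClosed_sphere.measurableSet, hlam, boundaryMeasure, Measure.ae_sum_iff]
    intro k
    refine ae_restrict_of_ae (ae_mem_arcMeasure (S := u ⁻¹' unitSphere n)
      (Metric.isClosed_sphere.preimage hu.smooth.continuous).measurableSet fun t ht => ?_)
    exact hu.boundary _ (boundaryCurve_mem_boundary ht)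
  have key := imageLength_le_of_flux_nonneg hf hn (lam.map u) hsphere fun X hX hpos => by
    rw [integral_map hum.aemeasurable
      (hX.continuous.inner continuous_id).aestronglyMeasurable]
    exact integral_inner_nonneg hu (fun d => restrict_boundaryMeasure hu hD hdisj hU hDc d) hX hpos
  have himage : imageLength f (lam.map u) = ∫⁻ p, ‖ballDeriv f (u p)‖ₑ ∂lam := by
    have hr : (lam.map u).restrict (unitBall n) = lam.map u :=
      Measure.restrict_eq_self_of_ae_mem
        (hsphere.mono fun x hx => unitSphere_subset_unitBall n hx)
    refine lintegral_map' ?_ hum.aemeasurable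
    rw [← hr]
    exact hball.aemeasurable Metric.isClosed_closedBall.measurableSet
  rw [himage, Measure.map_apply hum MeasurableSet.univ, preimage_univ] at key
  rw [hlen_fu, hlen_u]
  exact key

end

end FreeBoundary

theorem mainTheorem6 (n : ℕ)
    (f : FreeBoundary.Euc n → FreeBoundary.Euc n)
    (hf : FreeBoundary.IsConformalTransformation f) :
    (∀ (M : Type*) [TopologicalSpace M] [ChartedSpace (EuclideanHalfSpace 2) M]
        [IsManifold (𝓡∂ 2) ∞ M] [CompactSpace M] [T2Space M]
        (u : M → FreeBoundary.Euc n),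
      FreeBoundary.IsFreeBoundaryMinimalSurface u →
        FreeBoundary.boundaryLength (f ∘ u) ≤ FreeBoundary.boundaryLength u) ∧
    (∀ V : MeasureTheory.Measure
          (FreeBoundary.Euc n × (FreeBoundary.Euc n →L[ℝ] FreeBoundary.Euc n)),
      FreeBoundary.IsIntegerRectifiableVarifold V →
      FreeBoundary.IsInBall V →
      FreeBoundary.IsStationaryInBall V →
        (∃! σ : MeasureTheory.Measure (FreeBoundary.Euc n), FreeBoundary.IsBoundaryMeasure V σ) ∧
        ∀ σ : MeasureTheory.Measure (FreeBoundary.Euc n), FreeBoundary.IsBoundaryMeasure V σ →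
          FreeBoundary.imageLength f σ ≤ σ Set.univ) := by
  refine ⟨fun M _ _ _ _ _ u hu => ?_, fun V hV hB hst => FreeBoundary.varifold_boundary hf hV hB hst⟩
  let _ : MeasurableSpace M := borel M
  have : BorelSpace M := ⟨rfl⟩
  exact FreeBoundary.boundaryLength_comp_le hf hu
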